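/- Setting. Programs are sets of classes of (sequential) Java bytecode over a fixed API of which only the class hierarchy and the method signatures are known; methods have a nonempty instruction array, whose jump and handler targets are valid labels and which cannot be left by running off its end, and an exception handler array. Every method returns a value. Programs do not contain assignments to the security state class (a fresh final class) or ghost instructions. A contract $\mathcal C$ consists of initial values of security state variables $x_0,\dots,x_{k-1}$ and of \textsc{before}, \textsc{after} and \textsc{exceptional} clauses for API methods; each clause is a guard (a side-effect free expression over literals, state variables, the parameters, in \textsc{after} clauses the returned value, object and static fields, and uninterpreted operators and tests) with a simultaneous assignment to state variables. Clauses are tried top to bottom; if there are clauses for an event but no guard holds, the contract is violated. This determines a strict transition function $\delta$ on states with an error state $\bot$. The inliner $\mathcal I$ keeps the monitor state $\mathbf{ms}$ in static fields of the security state class and replaces each invoke instruction by a block of code that stores the operands in fresh local variables and reloads them; tests the target against the API classes defining or overriding the method, subclasses first, and enacts the \textsc{before} clauses of the first match (for calls without dynamic dispatch, those of the statically resolved API method, if any), terminating the program on a violation; performs the call under a catch-all handler for it alone; and then enacts the \textsc{after} clauses, respectively the \textsc{exceptional} clauses followed by rethrowing. $\mathcal I^g(P,\mathcal C)$ is $\mathcal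 I(P,\mathcal C)$ with ghost assignments embedded around each invoke instruction and at the start of its handler: these store the target and the arguments in ghost temporaries and update the ghost state $\mathbf{ms}^g$ by $\delta$, for the same case distinction over classes. Let $\Psi$ be the monitor invariant $\mathbf{ms}=\mathbf{ms}^g$. A method with assertions $A_L$ at its labels $L$ is locally valid for pre- and postcondition $\Psi$ if $\Psi\Rightarrow A_0$ is valid and, for every label $L$, $A_L\Rightarrow \mathit{wp}(L)$ is valid, $\mathit{wp}(L)$ being the weakest precondition of the instruction at $L$ with respect to the assertions at its successors. At an invoke instruction this means: $A_L$ implies $\Psi$, and if $\Psi$ holds in a configuration in which the call returns, normally or exceptionally, with the caller's local variables and ghost temporaries unchanged, then the assertion at the label where execution continues holds there (or the postcondition, if the method is left). At an instruction that is not modelled, the corresponding condition is required for an arbitrary effect that respects the static fields of the security state class and the ghost variables. An adherence proof of $\mathcal I(P,\mathcal C)$ assigns to each method of $\mathcal I^g(P,\mathcal C)$ an assertion array that makes it locally valid in this sense, for every interpretation of the uninterpreted operators and tests. Theorem (Proof Generation). For every API there are an algorithm and a polynomial $p$ such that, for every program $P$ and every contract $\mathcal C$, the algorithm, on input $(P,\mathcal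 C)$, halts within $p(|P|+|\mathcal C|)$ steps and outputs an adherence proof of $\mathcal I(P,\mathcal C)$. More precisely, its output is the following family of assertion arrays. Each method is treated separately (of the rest of the program only the class signatures are used). The array is that of a breadth-first backward traversal of the instructions, level by level: instructions that are not inlined get $\Psi$; of the inlined ones, the first instruction of each block and the rethrowing instruction get $\Psi$, and the invoke instruction, the ghost update after it and the ghost update at the start of its handler get $\Psi$ together with the equality of the saved target and arguments with their ghost copies; every other inlined instruction $L$ gets the syntactically computed $\mathit{wp}(L)$ once its successors have been annotated. In the result every instruction carries the assertion so described. Here $|\cdot|$ is the size of a standard encoding by trees with binary numbers at the leaves (a method signature lists its parameter types), and steps are counted on a machine with while programs over such trees, every elementary step being charged at least the size of the data that it reads and writes. -/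

import Mathlib

namespace IRM

/- ## A machine model with a step count

Programs work on binary trees whose leaves are natural numbers.  Every elementary step is charged
the (binary) size of the data it reads and writes, so that a run of cost `t` can be simulated by a
Turing machine in time polynomial in `t`. -/

/-- Data: binary trees with natural numbers at the leaves. -/
inductive Data where
  | num (n : ℕ)
  | pair (a b : Data)

/-- Size of a datum; a number counts with the length of its binary representation. -/
def Data.size : Data → ℕ
  | .num n => n.size + 1
  | .pair a b => a.size + b.size + 1

/-- Elementary operations. -/
inductive Prim where
  | id
  | const (d : Data)
  | fst
  | snd
  | isPair
  | add
  | sub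

/-- Effect of the elementary operations (the result is `0` on data of the wrong shape). -/
def Prim.apply : Prim → Data → Data
  | .id, x => x
  | .const d, _ => d
  | .fst, .pair a _ => a
  | .snd, .pair _ b => b
  | .isPair, .pair _ _ => .num 1
  | .add, .pair (.num a) (.num b) => .num (a + b)
  | .sub, .pair (.num a) (.num b) => .num (a - b)
  | _, _ => .num 0

/-- Programs of the machine: elementary operations, pairing, sequencing, branching, while loops. -/
inductive Algorithm where
  | prim (f : Prim)
  | pair (p q : Algorithm)
  | seq (p q : Algorithm)
  | branch (c p q : Algorithm)
  | loop (c p : Algorithm)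

/-- `Runs p x y t`: on input `x` the program `p` halts with output `y` at cost `t`.
In `branch` and `loop` the datum `0` means false and every other datum means true. -/
inductive Runs : Algorithm → Data → Data → ℕ → Prop where
  | prim (f : Prim) (x : Data) : Runs (.prim f) x (f.apply x) (x.size + (f.apply x).size + 1)
  | pair {p q : Algorithm} {x a b : Data} {s t : ℕ} (hp : Runs p x a s) (hq : Runs q x b t) :
      Runs (.pair p q) x (.pair a b) (s + t + x.size + (Data.pair a b).size + 1)
  | seq {p q : Algorithm} {x y z : Data} {s t : ℕ} (hp : Runs p x y s) (hq : Runs q y z t) :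
      Runs (.seq p q) x z (s + t + 1)
  | branchTrue {c p q : Algorithm} {x b y : Data} {s t : ℕ} (hc : Runs c x b s)
      (hb : b ≠ .num 0) (hp : Runs p x y t) : Runs (.branch c p q) x y (s + t + x.size + 1)
  | branchFalse {c p q : Algorithm} {x y : Data} {s t : ℕ} (hc : Runs c x (.num 0) s)
      (hq : Runs q x y t) : Runs (.branch c p q) x y (s + t + x.size + 1)
  | loopDone {c p : Algorithm} {x : Data} {s : ℕ} (hc : Runs c x (.num 0) s) :
      Runs (.loop c p) x x (s + x.size + 1)
  | loopStep {c p : Algorithm} {x b y z : Data} {s t u : ℕ} (hc : Runs c x b s)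
      (hb : b ≠ .num 0) (hp : Runs p x y t) (hl : Runs (.loop c p) y z u) :
      Runs (.loop c p) x z (s + t + u + x.size + 1)

/- ## Values, expressions, assertions -/

/-- Literals: integers, `null`, and all other constant-pool constants (identified by an index). -/
inductive Lit where
  | int (n : ℤ)
  | null
  | const (k : ℕ)
  deriving DecidableEq

/-- Run-time values: literals and heap locations. -/
inductive Val where
  | lit (l : Lit)
  | ref (loc : ℕ)
  deriving DecidableEq

/-- Values of expressions: run-time values, pairs, and the artificial error value `⊥`. -/
inductive DVal where
  | val (v : Val)
  | pair (a b : DVal)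
  | bot
  deriving DecidableEq

/-- Static fields: `user c f` is the field `c.f`; `sec x` is the `x`-th field of the final security
state class, which holds the embedded monitor state and whose name clashes with no other class. -/
inductive SField where
  | user (c f : ℕ)
  | sec (x : ℕ)
  deriving DecidableEq

/-- Ghost variables: the components of the ghost monitor state, and the temporaries holding the
target and the arguments of the current call (these belong to the activation record). -/
inductive GVar where
  | ms (x : ℕ)
  | tgt
  | arg (i : ℕ)
  deriving DecidableEq

/-- Relation symbols: equality and uninterpreted ones. -/
inductive RelSym where
  | eq
  | sym (r : ℕ)

mutual
/-- (Partial) expressions. -/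
inductive Expr where
  | val (v : Val)
  | field (e : Expr) (f : ℕ)
  | stat (x : SField)
  | stack (i : ℕ)
  | loc (i : ℕ)
  | ghost (g : GVar)
  | op (o : ℕ) (e₁ e₂ : Expr)
  | cond (a : Assn) (e₁ e₂ : Expr)
  | pair (e₁ e₂ : Expr)
  | bot
/-- Assertions; `inst e c` is the typing assertion `e : c`. -/
inductive Assn where
  | tt
  | ff
  | rel (r : RelSym) (e₁ e₂ : Expr)
  | and (a b : Assn)
  | not (a : Assn)
  | inst (e : Expr) (c : ℕ)
end

/-- Interpretation of the generic (partial) binary operators and of the relation symbols. -/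
structure Interp where
  op : ℕ → Val → Val → Option Val
  rel : ℕ → Val → Val → Prop

/-- Method identifiers: a name and the list of the types of the parameters (without the target
object). -/
abbrev MethodId := ℕ × List ℕ

/-- Number of parameters. -/
def MethodId.arity (m : MethodId) : ℕ := m.2.length

/-- The signature of a class: its superclass and the methods that it defines explicitly. -/
structure ClassSig where
  super : Option ℕ
  methods : List MethodId

/-- The class hierarchy: API classes, then the classes of the program.  Class identifiers are
positions in the concatenation of the two lists. -/
structure Hierarchy where
  api : List ClassSig
  client : List ClassSig

def Hierarchy.all (T : Hierarchy) : List ClassSig := T.api ++ T.client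

/-- The class `c` and its superclasses, bottom up (at most `fuel` steps up). -/
def Hierarchy.chainAux (T : Hierarchy) : ℕ → ℕ → List ℕ
  | 0, c => [c]
  | fuel + 1, c =>
    match (T.all[c]?).bind ClassSig.super with
    | none => [c]
    | some d => c :: T.chainAux fuel d

/-- The class `c` and all its superclasses, bottom up. -/
def Hierarchy.chain (T : Hierarchy) (c : ℕ) : List ℕ := T.chainAux T.all.length c

/-- `c <: d`. -/
def Hierarchy.Sub (T : Hierarchy) (c d : ℕ) : Prop := d ∈ T.chain c

/-- The class `d` contains an explicit definition of the method `m`. -/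
def Hierarchy.declares (T : Hierarchy) (d : ℕ) (m : MethodId) : Bool :=
  match T.all[d]? with
  | none => false
  | some s => decide (m ∈ s.methods)

structure Obj where
  cls : ℕ
  fields : ℕ → Option Val

/-- A configuration, seen from its top activation record: heap, static fields, operand stack (its
head is the top), local variables, and the values of the ghost variables. -/
structure Config where
  heap : ℕ → Option Obj
  statics : SField → Val
  stack : List Val
  locals : ℕ → Option Val
  ghost : GVar → Option DVal

/-- What expressions read; `none` stands for an undefined value. -/
structure Env where
  heap : ℕ → Option Obj
  stat : SField → Option DVal
  stack : ℕ → Option DVal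
  loc : ℕ → Option DVal
  ghost : GVar → Option DVal

def Config.toEnv (σ : Config) : Env where
  heap := σ.heap
  stat := fun x => some (.val (σ.statics x))
  stack := fun i => (σ.stack[i]?).map DVal.val
  loc := fun i => (σ.locals i).map DVal.val
  ghost := σ.ghost

def evalField (h : ℕ → Option Obj) (f : ℕ) : Option DVal → Option DVal
  | some (.val (.ref l)) => ((h l).bind fun o => o.fields f).map DVal.val
  | _ => none

def evalOp (I : Interp) (o : ℕ) : Option DVal → Option DVal → Option DVal
  | some (.val a), some (.val b) => (I.op o a b).map DVal.val
  | _, _ => none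

def evalPair : Option DVal → Option DVal → Option DVal
  | some a, some b => some (.pair a b)
  | _, _ => none

/-- Equality is Kleene equality: both sides undefined, or both defined and equal. -/
def holdsRel (I : Interp) : RelSym → Option DVal → Option DVal → Prop
  | .eq, x, y => x = y
  | .sym r, some (.val a), some (.val b) => I.rel r a b
  | .sym _, _, _ => False

def holdsInst (T : Hierarchy) (h : ℕ → Option Obj) (c : ℕ) : Option DVal → Prop
  | some (.val (.ref l)) => ∃ o, h l = some o ∧ T.Sub o.cls c
  | _ => False

open Classical in
mutual
/-- Semantics of expressions. -/
noncomputable def Expr.eval (I : Interp) (T : Hierarchy) (ρ : Env) : Expr → Option DVal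
  | .val v => some (.val v)
  | .field e f => evalField ρ.heap f (e.eval I T ρ)
  | .stat x => ρ.stat x
  | .stack i => ρ.stack i
  | .loc i => ρ.loc i
  | .ghost g => ρ.ghost g
  | .op o e₁ e₂ => evalOp I o (e₁.eval I T ρ) (e₂.eval I T ρ)
  | .cond a e₁ e₂ => if a.holds I T ρ then e₁.eval I T ρ else e₂.eval I T ρ
  | .pair e₁ e₂ => evalPair (e₁.eval I T ρ) (e₂.eval I T ρ)
  | .bot => some .bot
/-- Semantics of assertions. -/
noncomputable def Assn.holds (I : Interp) (T : Hierarchy) (ρ : Env) : Assn → Prop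
  | .tt => True
  | .ff => False
  | .rel r e₁ e₂ => holdsRel I r (e₁.eval I T ρ) (e₂.eval I T ρ)
  | .and a b => a.holds I T ρ ∧ b.holds I T ρ
  | .not a => ¬ a.holds I T ρ
  | .inst e c => holdsInst T ρ.heap c (e.eval I T ρ)
end

/-- The assertion `a` holds in the configuration `σ`. -/
def Config.Sat (σ : Config) (I : Interp) (T : Hierarchy) (a : Assn) : Prop :=
  a.holds I T σ.toEnv

/-- Simultaneous substitutions. -/
structure Subst where
  stack : ℕ → Expr := .stack
  loc : ℕ → Expr := .loc
  stat : SField → Expr := .stat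
  ghost : GVar → Expr := .ghost

mutual
def Expr.subst (θ : Subst) : Expr → Expr
  | .val v => .val v
  | .field e f => .field (e.subst θ) f
  | .stat x => θ.stat x
  | .stack i => θ.stack i
  | .loc i => θ.loc i
  | .ghost g => θ.ghost g
  | .op o e₁ e₂ => .op o (e₁.subst θ) (e₂.subst θ)
  | .cond a e₁ e₂ => .cond (a.subst θ) (e₁.subst θ) (e₂.subst θ)
  | .pair e₁ e₂ => .pair (e₁.subst θ) (e₂.subst θ)
  | .bot => .bot
def Assn.subst (θ : Subst) : Assn → Assn
  | .tt => .tt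
  | .ff => .ff
  | .rel r e₁ e₂ => .rel r (e₁.subst θ) (e₂.subst θ)
  | .and a b => .and (a.subst θ) (b.subst θ)
  | .not a => .not (a.subst θ)
  | .inst e c => .inst (e.subst θ) c
end

def Expr.int (n : ℤ) : Expr := .val (.lit (.int n))
def Assn.eq (e₁ e₂ : Expr) : Assn := .rel .eq e₁ e₂
def Assn.imp (a b : Assn) : Assn := .not (.and a (.not b))
/-- The conditional assertion `IF(a₀, a₁, a₂)`. -/
def Assn.ite (a₀ a₁ a₂ : Assn) : Assn := .and (a₀.imp a₁) (a₀.not.imp a₂)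
def Assn.conj : List Assn → Assn
  | [] => .tt
  | a :: as => .and a (Assn.conj as)
/-- The generalised conditional assertion `SELECT`. -/
def Assn.select : List (Assn × Assn) → Assn → Assn
  | [], d => d
  | (a, b) :: r, d => a.ite b (Assn.select r d)

/-- `shift^k`: all stack indices are increased by `k`. -/
def Assn.shift (k : ℕ) (a : Assn) : Assn := a.subst { stack := fun i => .stack (i + k) }

/-- The precondition of pushing the value of `e` on the operand stack: `unshift (a[e / s₀])`, where
the stack indices in `e` refer to the stack before the push. -/
def Assn.push (e : Expr) (a : Assn) : Assn :=
  a.subst { stack := fun i => match i with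
    | 0 => e
    | j + 1 => .stack j }

/-- The precondition of replacing the top element of the operand stack by `e`. -/
def Assn.setTop (e : Expr) (a : Assn) : Assn :=
  a.subst { stack := fun i => match i with
    | 0 => e
    | j + 1 => .stack (j + 1) }

/-- The precondition of replacing the two topmost stack elements by `e`. -/
def Assn.setTop₂ (e : Expr) (a : Assn) : Assn :=
  a.subst { stack := fun i => match i with
    | 0 => e
    | j + 1 => .stack (j + 2) }

/- ## Bytecode -/

inductive InvokeKind where
  /-- dynamic dispatch on the target object (`invokevirtual`, `invokeinterface`) -/
  | virtual
  /-- target object, but static dispatch (`invokespecial`) -/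
  | special
  /-- no target object (`invokestatic`) -/
  | static
  deriving DecidableEq

def InvokeKind.hasTarget : InvokeKind → Bool
  | .static => false
  | _ => true

/-- Number of operands that a call pops. -/
def InvokeKind.operands (k : InvokeKind) (m : MethodId) : ℕ :=
  m.arity + (if k.hasTarget then 1 else 0)

/-- Instructions.  `prim` and `cmp` are the binary arithmetic operations and the comparisons (which
push `0` or `1`); `exit` is `invokestatic System.exit`; `other k b ts` stands for any instruction of
the JVM that is not listed: it may change the operand stack, the local variables and the heap, may
continue at a label in `ts` and, if `b` is true, with the next instruction, and may raise an
exception; `ghost u` is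
the ghost multi-assignment `u`. -/
inductive Instr where
  | aload (n : ℕ)
  | astore (n : ℕ)
  | instanceof (c : ℕ)
  | athrow
  | dup
  | getfield (f : ℕ)
  | getstatic (x : SField)
  | putstatic (x : SField)
  | goto (L : ℕ)
  | iconst (n : ℤ)
  | ldc (v : Lit)
  | ificmpeq (L : ℕ)
  | ifeq (L : ℕ)
  | prim (o : ℕ)
  | cmp (r : RelSym)
  | invoke (k : InvokeKind) (c : ℕ) (m : MethodId)
  | exit
  | ret
  | other (k : ℕ) (b : Bool) (ts : List ℕ)
  | ghost (u : List (GVar × Expr))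

/-- Explicit jump targets. -/
def Instr.targets : Instr → List ℕ
  | .goto L | .ificmpeq L | .ifeq L => [L]
  | .other _ _ ts => ts
  | _ => []

/-- The instruction may pass control to the next one. -/
def Instr.FallsThrough : Instr → Prop
  | .goto _ | .athrow | .exit | .ret => False
  | .other _ b _ => b = true
  | _ => True

/-- The instruction may occur in a program before inlining. -/
def Instr.IsClient : Instr → Prop
  | .ghost _ => False
  | .putstatic (.sec _) => False
  | _ => True

def Instr.relabel (f : ℕ → ℕ) : Instr → Instr
  | .goto L => .goto (f L)
  | .ificmpeq L => .ificmpeq (f L)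
  | .ifeq L => .ifeq (f L)
  | .other k b ts => .other k b (ts.map f)
  | i => i

/-- An exception handler for the range `[lo, hi)`; `cls = none` catches everything. -/
structure Handler where
  lo : ℕ
  hi : ℕ
  target : ℕ
  cls : Option ℕ

def Handler.relabel (f : ℕ → ℕ) (h : Handler) : Handler :=
  { h with lo := f h.lo, hi := f h.hi, target := f h.target }

/-- A method definition; the local variables `0, …, maxLocals - 1` belong to the method. -/
structure MethodDef where
  code : List Instr
  handlers : List Handler
  maxLocals : ℕ

structure ClassDef where
  super : Option ℕ
  methods : List (MethodId × MethodDef)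

structure Program where
  classes : List ClassDef

/-- The API, of which only the signature is known. -/
structure Api where
  classes : List ClassSig

/-- The class hierarchy is a forest, listed superclasses first. -/
def Api.WellFormed (api : Api) : Prop :=
  ∀ (c : ℕ) (s : ClassSig) (d : ℕ), api.classes[c]? = some s → s.super = some d → d < c

def Program.sigs (P : Program) : List ClassSig :=
  P.classes.map fun cd => { super := cd.super, methods := cd.methods.map Prod.fst }

def Program.hierarchy (api : Api) (P : Program) : Hierarchy where
  api := api.classes
  client := P.sigs

/-- What the bytecode verifier guarantees about labels, and the absence of references that modify
the security state class or the ghost state. -/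
structure MethodDef.WellFormed (M : MethodDef) : Prop where
  nonempty : M.code ≠ []
  client : ∀ i ∈ M.code, i.IsClient
  targets : ∀ i ∈ M.code, ∀ t ∈ i.targets, t < M.code.length
  next : ∀ L i, M.code[L]? = some i → i.FallsThrough → L + 1 < M.code.length
  handlers : ∀ h ∈ M.handlers, h.target < M.code.length

structure Program.WellFormed (api : Api) (P : Program) : Prop where
  super : ∀ (c : ℕ) (cd : ClassDef) (d : ℕ), P.classes[c]? = some cd → cd.super = some d → d < api.classes.length + c
  methods : ∀ cd ∈ P.classes, ∀ m ∈ cd.methods, m.2.WellFormed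

/- ## Weakest preconditions and local validity -/

/-- The assertion at label `L`; there is no continuation outside of the array. -/
def asgn (A : List Assn) (L : ℕ) : Assn := A.getD L .ff

/-- The handler `h` catches the exception on top of the stack when raised at label `L`. -/
def Handler.catches (h : Handler) (L : ℕ) : Assn :=
  .and (match h.cls with
    | none => .tt
    | some c => .inst (.stack 0) c)
    (if h.lo ≤ L ∧ L < h.hi then .tt else .ff)

/-- The precondition of raising, at label `L`, the exception on top of the stack. -/
def throwWp (H : List Handler) (A : List Assn) (post : Assn) (L : ℕ) : Assn :=
  Assn.select (H.map fun h => (h.catches L, asgn A h.target)) post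

/-- The ghost multi-assignment as a substitution. -/
def ghostSubst (u : List (GVar × Expr)) : Subst :=
  { ghost := fun g => (u.lookup g).getD (.ghost g) }

/-- The weakest precondition function.  Pre- and postconditions are common to all methods. -/
def wp (M : MethodDef) (A : List Assn) (pre post : Assn) (L : ℕ) : Assn :=
  let next := asgn A (L + 1)
  match M.code[L]? with
  | none => .ff
  | some (.aload n) => next.push (.loc n)
  | some (.astore n) =>
      (next.shift 1).subst { loc := fun i => if i = n then .stack 0 else .loc i }
  | some (.instanceof c) =>
      next.setTop (.cond (.inst (.stack 0) c) (.int 1) (.int 0))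
  | some .athrow => throwWp M.handlers A post L
  | some .dup => next.push (.stack 0)
  | some (.getfield f) => next.setTop (.field (.stack 0) f)
  | some (.getstatic x) => next.push (.stat x)
  | some (.putstatic x) =>
      (next.shift 1).subst { stat := fun y => if y = x then .stack 0 else .stat y }
  | some (.goto t) => asgn A t
  | some (.iconst n) => next.push (.int n)
  | some (.ldc v) => next.push (.val (.lit v))
  | some (.ificmpeq t) =>
      Assn.ite (.eq (.stack 0) (.stack 1)) ((asgn A t).shift 2) (next.shift 2)
  | some (.ifeq t) => Assn.ite (.eq (.stack 0) (.int 0)) ((asgn A t).shift 1) (next.shift 1)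
  | some (.prim o) => next.setTop₂ (.op o (.stack 1) (.stack 0))
  | some (.cmp r) =>
      next.setTop₂ (.cond (.rel r (.stack 1) (.stack 0)) (.int 1) (.int 0))
  | some (.invoke _ _ _) => pre
  | some .exit => .tt
  | some .ret => post
  | some (.other _ _ _) => .tt
  | some (.ghost u) => next.subst (ghostSubst u)

/-- `σ'` may be the configuration in which a call made in `σ` returns to its caller, normally (`n`
operands are replaced by a result) or with an exception: the caller's local variables and ghost
temporaries are unchanged, and the heap and both monitor states are arbitrary. -/
def Config.CallFrame (σ σ' : Config) : Prop :=
  σ'.locals = σ.locals ∧ σ'.ghost .tgt = σ.ghost .tgt ∧ ∀ i, σ'.ghost (.arg i) = σ.ghost (.arg i)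

/-- `σ'` agrees with `σ` on the static fields of the final security state class and on the ghost
variables; this is all that is known of the effect of an arbitrary instruction. -/
def Config.SameMonitor (σ σ' : Config) : Prop :=
  (∀ x, σ'.statics (.sec x) = σ.statics (.sec x)) ∧ σ'.ghost = σ.ghost

/-- What a precondition in the assertion language cannot express: the flow of control out of the
instructions whose effect is not determined (calls, and instructions that are not modelled). -/
def FlowCondition (I : Interp) (T : Hierarchy) (M : MethodDef) (A : List Assn) (post : Assn)
    (L : ℕ) (σ : Config) : Prop :=
  match M.code[L]? with
  | some (.invoke k _ m) =>
      (∀ σ' v, σ.CallFrame σ' → σ'.stack = v :: σ.stack.drop (k.operands m) →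
        σ'.Sat I T post → σ'.Sat I T (asgn A (L + 1))) ∧
      (∀ σ' v, σ.CallFrame σ' → σ'.stack = [v] →
        σ'.Sat I T post → σ'.Sat I T (throwWp M.handlers A post L))
  | some (.other _ b ts) =>
      (∀ σ', σ.SameMonitor σ' → ∀ t, (b = true ∧ t = L + 1 ∨ t ∈ ts) → σ'.Sat I T (asgn A t)) ∧
      (∀ σ' v, σ.SameMonitor σ' → σ'.stack = [v] →
        σ'.Sat I T (throwWp M.handlers A post L))
  | _ => True

/-- The extended method `(M, A, pre, post)` is locally valid. -/
structure LocallyValid (I : Interp) (T : Hierarchy) (M : MethodDef) (A : List Assn)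
    (pre post : Assn) : Prop where
  length : A.length = M.code.length
  entry : ∀ σ : Config, σ.Sat I T pre → σ.Sat I T (asgn A 0)
  step : ∀ L < M.code.length, ∀ σ : Config, σ.Sat I T (asgn A L) →
    σ.Sat I T (wp M A pre post L) ∧ FlowCondition I T M A post L σ

/- ## Contracts -/

/-- Side-effect free expressions of the contract language: literals, security state variables,
parameters and (in `after` clauses) the returned value, fields, operators and tests.  Accessor and
test methods are operators. -/
inductive CExpr where
  | lit (l : Lit)
  | state (x : ℕ)
  | param (i : ℕ)
  | result
  | field (e : CExpr) (f : ℕ)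
  | static (c f : ℕ)
  | op (o : ℕ) (a b : CExpr)
  | rel (r : RelSym) (a b : CExpr)

inductive Event where
  | before
  | after
  | exceptional
  deriving DecidableEq

/-- A guarded command.  The guard is a boolean expression (it holds if its value is not `0`), the
update a simultaneous assignment to security state variables. -/
structure Clause where
  guard : CExpr
  update : List (ℕ × CExpr)

/-- The clauses for one kind of event of the API method `cls.mth`, evaluated top to bottom; if no
guard holds, the policy is violated. -/
structure Rule where
  event : Event
  cls : ℕ
  mth : MethodId
  clauses : List Clause

/-- A contract: the initial values of the security state variables, and the rules. -/
structure Contract where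
  init : List Lit
  rules : List Rule

/-- The clauses for an event, if there are any constraints on it. -/
def Contract.clauses (C : Contract) (ev : Event) (c : ℕ) (m : MethodId) : Option (List Clause) :=
  (C.rules.find? fun r => decide (r.event = ev ∧ r.cls = c ∧ r.mth = m)).map Rule.clauses

/-- Variables are declared, parameters exist, and a result is mentioned only where there is one. -/
def CExpr.WellFormed (k n : ℕ) (res : Prop) : CExpr → Prop
  | .lit _ => True
  | .state x => x < k
  | .param i => i < n
  | .result => res
  | .field e _ => e.WellFormed k n res
  | .static _ _ => True
  | .op _ a b => a.WellFormed k n res ∧ b.WellFormed k n res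
  | .rel _ a b => a.WellFormed k n res ∧ b.WellFormed k n res

def Contract.WellFormed (C : Contract) : Prop :=
  ∀ r ∈ C.rules, ∀ cl ∈ r.clauses,
    cl.guard.WellFormed C.init.length r.mth.arity (r.event = .after) ∧
    (cl.update.map Prod.fst).Nodup ∧
    ∀ u ∈ cl.update, u.1 < C.init.length ∧
      u.2.WellFormed C.init.length r.mth.arity (r.event = .after)

/-- The monitor invariant: embedded and ghost monitor state agree. -/
def Contract.inv (C : Contract) : Assn :=
  Assn.conj ((List.range C.init.length).map fun x => .eq (.stat (.sec x)) (.ghost (.ms x)))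

/-- The API classes whose definition of `m` may be the target of an invocation of `c.m`, bottom up,
each with the class (if any) that the target object is tested against. -/
def Hierarchy.dispatch (T : Hierarchy) (k : InvokeKind) (c : ℕ) (m : MethodId) :
    List (Option ℕ × ℕ) :=
  match k with
  | .virtual =>
      ((List.range T.api.length).reverse.filter fun d =>
        T.declares d m && (decide (d ∈ T.chain c) || decide (c ∈ T.chain d))).map
        fun d => (some d, d)
  | _ =>
      match (T.chain c).find? fun d => T.declares d m with
      | none => []
      | some d => if d < T.api.length then [(none, d)] else []

/- ## The ghost monitor -/

/-- The value of a contract expression in terms of the ghost variables; the returned value is on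
top of the stack. -/
def CExpr.toGhost : CExpr → Expr
  | .lit l => .val (.lit l)
  | .state x => .ghost (.ms x)
  | .param i => .ghost (.arg i)
  | .result => .stack 0
  | .field e f => .field e.toGhost f
  | .static c f => .stat (.user c f)
  | .op o a b => .op o a.toGhost b.toGhost
  | .rel r a b => .cond (.rel r a.toGhost b.toGhost) (.int 1) (.int 0)

/-- The first clause whose guard holds determines the new value of the state variable `x`; the
error value results if there is none. -/
def clausesExpr (x : ℕ) : List Clause → Expr
  | [] => .bot
  | cl :: r =>
      .cond (.not (.eq cl.guard.toGhost (.int 0)))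
        (((cl.update.lookup x).map CExpr.toGhost).getD (.ghost (.ms x)))
        (clausesExpr x r)

/-- The component `x` of `δ(msᵍ, α)`, where `α` is an action constrained by the given clauses.
The error state `⊥` (all components are `⊥`) is preserved; unconstrained actions have no effect. -/
def deltaExpr (x : ℕ) : Option (List Clause) → Expr
  | none => .ghost (.ms x)
  | some cls => .cond (.eq (.ghost (.ms x)) .bot) .bot (clausesExpr x cls)

def ghostDispatch (C : Contract) (ev : Event) (m : MethodId) (x : ℕ) :
    List (Option ℕ × ℕ) → Expr
  | [] => .ghost (.ms x)
  | (none, d) :: _ => deltaExpr x (C.clauses ev d m)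
  | (some t, d) :: r =>
      .cond (.inst (.ghost .tgt) t) (deltaExpr x (C.clauses ev d m)) (ghostDispatch C ev m x r)

/-- The ghost update of the monitor state for an event of an invocation. -/
def ghostUpdate (T : Hierarchy) (C : Contract) (ev : Event) (k : InvokeKind) (c : ℕ)
    (m : MethodId) : Instr :=
  .ghost ((List.range C.init.length).map fun x =>
    (.ms x, ghostDispatch C ev m x (T.dispatch k c m)))

/-- The ghost update that stores target and arguments; the last argument is on top of the stack. -/
def ghostArgs (k : InvokeKind) (m : MethodId) : Instr :=
  .ghost ((if k.hasTarget then [(GVar.tgt, Expr.stack m.arity)] else []) ++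
    (List.range m.arity).map fun i => (.arg i, .stack (m.arity - 1 - i)))

/-- The handler target of the invocation at `L`, if the first handler whose range contains `L`
catches everything, for this instruction and no other. -/
def MethodDef.excTarget (M : MethodDef) (L : ℕ) : Option ℕ :=
  match M.handlers.find? fun h => decide (h.lo ≤ L ∧ L < h.hi) with
  | none => none
  | some h => if h.lo = L ∧ h.hi = L + 1 ∧ h.cls = none then some h.target else none

/-- The local variables `base` (target), `base + 1, …, base + nargs` (arguments) and
`base + nargs + 1` (result) in which inlined code keeps its copies. -/
structure Frame where
  base : ℕ
  nargs : ℕ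
  hasTarget : Bool

def Frame.argReg (F : Frame) (i : ℕ) : ℕ := F.base + 1 + i
def Frame.resReg (F : Frame) : ℕ := F.base + 1 + F.nargs

/-- The copies kept by the inlined code agree with those of the ghost monitor. -/
def Frame.assn (F : Frame) : Assn :=
  Assn.conj ((if F.hasTarget then [.eq (.loc F.base) (.ghost .tgt)] else []) ++
    (List.range F.nargs).map fun i => .eq (.loc (F.argReg i)) (.ghost (.arg i)))

/-- How an instruction is to be annotated: `client` is not inlined; the others are.  `inv` are those
where control enters or leaves an inlined block, `call F` surround the invocation itself, `inner`
are all others. -/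
inductive Tag where
  | client
  | inv
  | call (F : Frame)
  | inner

/-- The label that the inliner attaches to an instruction; `frame` is present at the invocation in
a block and at the start of its exception handler. -/
structure Mark where
  tag : Tag
  frame : Option Frame

def Mark.callTag (μ : Mark) : Tag :=
  match μ.frame with
  | none => .inner
  | some F => .call F

/-- The instruction `i` at label `L` of `M` with its ghost updates, and their tags. -/
def ghostChunk (T : Hierarchy) (C : Contract) (M : MethodDef) (L : ℕ) (i : Instr) (μ : Mark) :
    List (Instr × Tag) :=
  (M.code.zipIdx.filterMap fun (j, L') =>
    match j with
    | .invoke k c m =>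
        if M.excTarget L' = some L then
          some (ghostUpdate T C .exceptional k c m, μ.callTag)
        else none
    | _ => none) ++
  match i with
  | .invoke k c m =>
      [(ghostArgs k m, μ.tag), (ghostUpdate T C .before k c m, .inner),
        (.invoke k c m, μ.callTag), (ghostUpdate T C .after k c m, μ.callTag)]
  | _ => [(i, μ.tag)]

def markAt (ms : List Mark) (L : ℕ) : Mark := ms.getD L { tag := .client, frame := none }

/-- Position of the instruction `L` of `M` after embedding the ghost updates. -/
def ghostOffset (T : Hierarchy) (C : Contract) (M : MethodDef) (L : ℕ) : ℕ :=
  ((M.code.zipIdx.take L).map fun (i, L') =>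
    (ghostChunk T C M L' i (markAt [] L')).length).sum

def ghostCode (T : Hierarchy) (C : Contract) (M : MethodDef) (ms : List Mark) :
    List (Instr × Tag) :=
  M.code.zipIdx.flatMap fun (i, L) =>
    (ghostChunk T C M L i (markAt ms L)).map fun (j, t) => (j.relabel (ghostOffset T C M), t)

/-- The method with the ghost updates for the contract embedded. -/
def ghostMethod (T : Hierarchy) (C : Contract) (M : MethodDef) : MethodDef where
  code := (ghostCode T C M []).map Prod.fst
  handlers := M.handlers.map (Handler.relabel (ghostOffset T C M))
  maxLocals := M.maxLocals

/-- Every invocation has the exception handler that the ghost monitor needs. -/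
def MethodDef.GhostReady (M : MethodDef) : Prop :=
  ∀ L k c m, M.code[L]? = some (.invoke k c m) → (M.excTarget L).isSome

/-- `pf` (an assertion array for each method of each class) is an adherence proof for the program `Q`
and the contract `C`. -/
def IsAdherenceProof (I : Interp) (api : Api) (Q : Program) (C : Contract)
    (pf : List (List (List Assn))) : Prop :=
  List.Forall₂ (fun (cd : ClassDef) (As : List (List Assn)) =>
    List.Forall₂ (fun (m : MethodId × MethodDef) (A : List Assn) =>
      m.2.GhostReady ∧
      LocallyValid I (Q.hierarchy api) (ghostMethod (Q.hierarchy api) C m.2) A C.inv C.inv)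
      cd.methods As) Q.classes pf

/- ## The inliner -/

/-- Code that evaluates a contract expression and pushes its value. -/
def CExpr.compile (F : Frame) : CExpr → List Instr
  | .lit l => [.ldc l]
  | .state x => [.getstatic (.sec x)]
  | .param i => [.aload (F.argReg i)]
  | .result => [.aload F.resReg]
  | .field e f => e.compile F ++ [.getfield f]
  | .static c f => [.getstatic (.user c f)]
  | .op o a b => a.compile F ++ b.compile F ++ [.prim o]
  | .rel r a b => a.compile F ++ b.compile F ++ [.cmp r]

/-- Code that executes an update: all right-hand sides are evaluated before the assignments. -/
def compileUpdate (F : Frame) (u : List (ℕ × CExpr)) : List Instr :=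
  (u.flatMap fun p => p.2.compile F) ++ u.reverse.map fun p => .putstatic (.sec p.1)

/-- Code at address `start` that enacts the first clause whose guard holds and continues at `done`,
and exits if there is no such clause. -/
def clausesCode (F : Frame) (done : ℕ) : ℕ → List Clause → List Instr
  | _, [] => [.iconst 1, .exit]
  | start, cl :: r =>
      let g := cl.guard.compile F
      let u := compileUpdate F cl.update
      let next := start + g.length + 1 + u.length + 1
      g ++ [.ifeq next] ++ u ++ [.goto done] ++ clausesCode F done next r

def sectionCode (F : Frame) (done start : ℕ) : Option (List Clause) → List Instr
  | none => [.goto done]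
  | some cls => clausesCode F done start cls

/-- Code at address `start` that traverses the possible targets of the call bottom up, enacts the
clauses of the first match and continues at `done`. -/
def checksCode (C : Contract) (ev : Event) (m : MethodId) (F : Frame) (done : ℕ) :
    ℕ → List (Option ℕ × ℕ) → List Instr
  | _, [] => []
  | start, (none, d) :: r =>
      let s := sectionCode F done start (C.clauses ev d m)
      s ++ checksCode C ev m F done (start + s.length) r
  | start, (some t, d) :: r =>
      let s := sectionCode F done (start + 3) (C.clauses ev d m)
      let next := start + 3 + s.length
      [.aload F.base, .instanceof t, .ifeq next] ++ s ++ checksCode C ev m F done next r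

/-- The checks for one kind of event, placed at address `start`; control leaves them at their
end. -/
def eventCode (T : Hierarchy) (C : Contract) (ev : Event) (k : InvokeKind) (c : ℕ) (m : MethodId)
    (F : Frame) (start : ℕ) : List Instr :=
  let ds := T.dispatch k c m
  checksCode C ev m F (start + (checksCode C ev m F 0 0 ds).length) start ds

/-- Code that stores the operands of the call in local variables and pushes them again. -/
def saveCode (F : Frame) : List Instr :=
  ((List.range F.nargs).reverse.map fun i => .astore (F.argReg i)) ++
  (if F.hasTarget then [.astore F.base, .aload F.base] else []) ++
  (List.range F.nargs).map fun i => .aload (F.argReg i)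

def markInner (is : List Instr) : List (Instr × Mark) :=
  is.map fun i => (i, { tag := .inner, frame := none })

/-- The first instruction of a nonempty list gets the given tag. -/
def setTag (t : Tag) : List (Instr × Mark) → List (Instr × Mark)
  | [] => []
  | (i, μ) :: r => (i, { μ with tag := t }) :: r

/-- The first instruction of a nonempty list gets the given frame. -/
def setFrame (F : Frame) : List (Instr × Mark) → List (Instr × Mark)
  | [] => []
  | (i, μ) :: r => (i, { μ with frame := some F }) :: r

def callFrame (base : ℕ) (k : InvokeKind) (m : MethodId) : Frame where
  base := base
  nargs := m.arity
  hasTarget := k.hasTarget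

/-- The position of the invocation in the block that replaces it. -/
def callPos (T : Hierarchy) (C : Contract) (base : ℕ) (k : InvokeKind) (c : ℕ) (m : MethodId) : ℕ :=
  let F := callFrame base k m
  (saveCode F).length + (eventCode T C .before k c m F 0).length

/-- The block at address `start` that replaces an invocation: save the operands, check the event
`before`, call; on a normal return save the result and go to the checks for `after`; on an
exceptional return do the checks for `exceptional` and rethrow. -/
def blockCode (T : Hierarchy) (C : Contract) (base start : ℕ) (k : InvokeKind) (c : ℕ)
    (m : MethodId) : List (Instr × Mark) :=
  let F := callFrame base k m
  let save := saveCode F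
  let bef := eventCode T C .before k c m F (start + save.length)
  let call := start + callPos T C base k c m
  let handler := call + 4
  let exc := eventCode T C .exceptional k c m F handler
  let normal := handler + exc.length + 1
  let aft := eventCode T C .after k c m F normal
  setTag .inv
    (markInner (save ++ bef) ++
      [(.invoke k c m, { tag := .inner, frame := some F })] ++
      markInner [.astore F.resReg, .aload F.resReg, .goto normal] ++
      setFrame F (markInner exc ++ [(.athrow, { tag := .inv, frame := none })]) ++
      markInner aft)

/-- The code at address `start` that replaces one instruction; `loc` relabels jump targets. -/
def inlineChunk (T : Hierarchy) (C : Contract) (base start : ℕ) (loc : ℕ → ℕ) :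
    Instr → List (Instr × Mark)
  | .invoke k c m => blockCode T C base start k c m
  | i => [(i.relabel loc, { tag := .client, frame := none })]

/-- Position of the instruction `L` of `M` after inlining. -/
def inlineOffset (T : Hierarchy) (C : Contract) (M : MethodDef) (L : ℕ) : ℕ :=
  ((M.code.take L).map fun i => (inlineChunk T C M.maxLocals 0 id i).length).sum

def inlineCode (T : Hierarchy) (C : Contract) (M : MethodDef) : List (Instr × Mark) :=
  M.code.zipIdx.flatMap fun (i, L) =>
    inlineChunk T C M.maxLocals (inlineOffset T C M L) (inlineOffset T C M) i

/-- The handlers for the invocations in the inlined blocks. -/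
def inlineHandlers (T : Hierarchy) (C : Contract) (M : MethodDef) : List Handler :=
  M.code.zipIdx.filterMap fun (i, L) =>
    match i with
    | .invoke k c m =>
        let a := inlineOffset T C M L + callPos T C M.maxLocals k c m
        some { lo := a, hi := a + 1, target := a + 4, cls := none }
    | _ => none

/-- The method with the contract inlined. -/
def inlineMethod (T : Hierarchy) (C : Contract) (M : MethodDef) : MethodDef where
  code := (inlineCode T C M).map Prod.fst
  handlers := inlineHandlers T C M ++ M.handlers.map (Handler.relabel (inlineOffset T C M))
  maxLocals := M.code.foldr (fun i n => match i with
    | .invoke _ _ m => max (M.maxLocals + 2 + m.arity) n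
    | _ => n) M.maxLocals

def inlineProgram (api : Api) (P : Program) (C : Contract) : Program where
  classes := P.classes.map fun cd =>
    { cd with methods := cd.methods.map fun m =>
        (m.1, inlineMethod (P.hierarchy api) C m.2) }

/- ## The proof generator -/

/-- The labels whose assertions the weakest precondition at `L` refers to. -/
def MethodDef.succs (M : MethodDef) (L : ℕ) : List ℕ :=
  match M.code[L]? with
  | none => []
  | some (.goto t) => [t]
  | some (.ifeq t) => [t, L + 1]
  | some (.ificmpeq t) => [t, L + 1]
  | some .athrow => M.handlers.map Handler.target
  | some .exit | some .ret | some (.invoke _ _ _) | some (.other _ _ _) => []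
  | some _ => [L + 1]

/-- The assertion that an instruction gets outright, if it does not need a computation. -/
def Tag.fixed (inv : Assn) : Tag → Option Assn
  | .client => some inv
  | .inv => some inv
  | .call F => some (.and inv F.assn)
  | .inner => none

/-- One level of the backward breadth-first traversal: an instruction without an assertion gets the
fixed one for its tag or else, as soon as its successors are annotated, its weakest precondition. -/
def annotateLevel (inv : Assn) (M : MethodDef) (tags : List Tag) (A : List (Option Assn)) :
    List (Option Assn) :=
  (List.range M.code.length).map fun L =>
    match A.getD L none, (tags.getD L .client).fixed inv with
    | some a, _ => some a
    | none, some a => some a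
    | none, none =>
        if (M.succs L).all fun s => (A.getD s none).isSome then
          some (wp M (A.map fun a => a.getD .ff) inv inv L)
        else none

/-- The breadth-first traversal of a method. -/
def annotate (inv : Assn) (M : MethodDef) (tags : List Tag) : List Assn :=
  ((annotateLevel inv M tags)^[M.code.length] (List.replicate M.code.length none)).map
    fun a => a.getD .ff

/-- The tags of the instructions of a method after inlining and embedding the ghost updates. -/
def methodTags (T : Hierarchy) (C : Contract) (M : MethodDef) : List Tag :=
  (ghostCode T C (inlineMethod T C M) ((inlineCode T C M).map Prod.snd)).map Prod.snd

/-- The assertion array for one method; of the rest of the program only signatures are used. -/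
def generateMethod (T : Hierarchy) (C : Contract) (M : MethodDef) : List Assn :=
  annotate C.inv (ghostMethod T C (inlineMethod T C M)) (methodTags T C M)

/-- The proof generator treats each method separately. -/
def generateProof (api : Api) (P : Program) (C : Contract) : List (List (List Assn)) :=
  P.classes.map fun cd => cd.methods.map fun m => generateMethod (P.hierarchy api) C m.2

/-- In the array `A`, instructions that are not inlined carry the monitor invariant `inv`, those at
the boundary of a block carry `inv`, those around an invocation carry `inv` together with the
agreement of the saved operands, and all other inlined ones carry the computed weakest
precondition. -/
def AnnotatedByWp (inv : Assn) (M : MethodDef) (tags : List Tag) (A : List Assn) : Prop :=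
  A.length = M.code.length ∧ tags.length = M.code.length ∧
  ∀ L < M.code.length,
    A[L]? = some (((tags.getD L .client).fixed inv).getD (wp M A inv inv L))

/- ## Encodings -/

class Enc (α : Type) where
  enc : α → Data

open Enc (enc)

instance : Enc ℕ := ⟨Data.num⟩

instance : Enc ℤ := ⟨fun
  | .ofNat n => .pair (.num 0) (.num n)
  | .negSucc n => .pair (.num 1) (.num n)⟩

instance {α β : Type} [Enc α] [Enc β] : Enc (α × β) := ⟨fun p => .pair (enc p.1) (enc p.2)⟩

instance {α : Type} [Enc α] : Enc (List α) :=
  ⟨fun l => l.foldr (fun a d => .pair (enc a) d) (.num 0)⟩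

instance {α : Type} [Enc α] : Enc (Option α) := ⟨fun
  | none => .num 0
  | some a => .pair (.num 1) (enc a)⟩

/-- A constructor, given by its number, applied to encoded arguments. -/
def node (k : ℕ) (d : Data) : Data := .pair (.num k) d

instance : Enc Lit := ⟨fun
  | .int n => node 0 (enc n)
  | .null => .num 0
  | .const k => node 1 (enc k)⟩

instance : Enc Val := ⟨fun
  | .lit l => node 0 (enc l)
  | .ref l => node 1 (enc l)⟩

instance : Enc SField := ⟨fun
  | .user c f => node 0 (enc (c, f))
  | .sec x => node 1 (enc x)⟩

instance : Enc GVar := ⟨fun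
  | .ms x => node 0 (enc x)
  | .tgt => .num 0
  | .arg i => node 1 (enc i)⟩

instance : Enc RelSym := ⟨fun
  | .eq => .num 0
  | .sym r => node 0 (enc r)⟩

mutual
def Expr.encode : Expr → Data
  | .val v => node 0 (enc v)
  | .field e f => node 1 (.pair e.encode (enc f))
  | .stat x => node 2 (enc x)
  | .stack i => node 3 (enc i)
  | .loc i => node 4 (enc i)
  | .ghost g => node 5 (enc g)
  | .op o e₁ e₂ => node 6 (.pair (enc o) (.pair e₁.encode e₂.encode))
  | .cond a e₁ e₂ => node 7 (.pair a.encode (.pair e₁.encode e₂.encode))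
  | .pair e₁ e₂ => node 8 (.pair e₁.encode e₂.encode)
  | .bot => .num 0
def Assn.encode : Assn → Data
  | .tt => .num 0
  | .ff => .num 1
  | .rel r e₁ e₂ => node 0 (.pair (enc r) (.pair e₁.encode e₂.encode))
  | .and a b => node 1 (.pair a.encode b.encode)
  | .not a => node 2 a.encode
  | .inst e c => node 3 (.pair e.encode (enc c))
end

instance : Enc Expr := ⟨Expr.encode⟩
instance : Enc Assn := ⟨Assn.encode⟩

instance : Enc InvokeKind := ⟨fun
  | .virtual => .num 0
  | .special => .num 1
  | .static => .num 2⟩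

instance : Enc Instr := ⟨fun
  | .aload n => node 0 (enc n)
  | .astore n => node 1 (enc n)
  | .instanceof c => node 2 (enc c)
  | .athrow => .num 0
  | .dup => .num 1
  | .getfield f => node 3 (enc f)
  | .getstatic x => node 4 (enc x)
  | .putstatic x => node 5 (enc x)
  | .goto L => node 6 (enc L)
  | .iconst n => node 7 (enc n)
  | .ldc v => node 8 (enc v)
  | .ificmpeq L => node 9 (enc L)
  | .ifeq L => node 10 (enc L)
  | .prim o => node 11 (enc o)
  | .cmp r => node 12 (enc r)
  | .invoke k c m => node 13 (enc (k, c, m))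
  | .exit => .num 2
  | .ret => .num 3
  | .other k b ts => node 14 (enc (k, (if b then 1 else 0 : ℕ), ts))
  | .ghost u => node 15 (enc u)⟩

instance : Enc Handler := ⟨fun h => enc (h.lo, h.hi, h.target, h.cls)⟩
instance : Enc MethodDef := ⟨fun M => enc (M.code, M.handlers, M.maxLocals)⟩
instance : Enc ClassDef := ⟨fun c => enc (c.super, c.methods)⟩
instance : Enc Program := ⟨fun P => enc P.classes⟩

def CExpr.encode : CExpr → Data
  | .lit l => node 0 (enc l)
  | .state x => node 1 (enc x)
  | .param i => node 2 (enc i)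
  | .result => .num 0
  | .field e f => node 3 (.pair e.encode (enc f))
  | .static c f => node 4 (enc (c, f))
  | .op o a b => node 5 (.pair (enc o) (.pair a.encode b.encode))
  | .rel r a b => node 6 (.pair (enc r) (.pair a.encode b.encode))

instance : Enc CExpr := ⟨CExpr.encode⟩
instance : Enc Event := ⟨fun
  | .before => .num 0
  | .after => .num 1
  | .exceptional => .num 2⟩
instance : Enc Clause := ⟨fun c => enc (c.guard, c.update)⟩
instance : Enc Rule := ⟨fun r => enc (r.event, r.cls, r.mth, r.clauses)⟩
instance : Enc Contract := ⟨fun C => enc (C.init, C.rules)⟩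

/-- The size of an object is that of its encoding. -/
def sizeOfEnc {α : Type} [Enc α] (a : α) : ℕ := (enc a).size

end IRM

namespace IRM

open Enc (enc)

/- ## Functions computable in polynomial time -/

theorem eval_mono (p : Polynomial ℕ) {m n : ℕ} (h : m ≤ n) : p.eval m ≤ p.eval n := by
  simp only [Polynomial.eval_eq_sum_range]
  gcongr

instance : Enc Data := ⟨id⟩
instance : Enc Unit := ⟨fun _ => .num 0⟩
instance : Enc Bool := ⟨fun b => .num (bif b then 1 else 0)⟩
instance {α β : Type} [Enc α] [Enc β] : Enc (α ⊕ β) :=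
  ⟨Sum.elim (fun a => node 0 (enc a)) fun b => node 1 (enc b)⟩

/-- `f` is computed, on encodings, at a cost polynomial in the size of the argument. -/
@[fun_prop]
def Poly {α β : Type} [Enc α] [Enc β] (f : α → β) : Prop :=
  ∃ (alg : Algorithm) (p : Polynomial ℕ), ∀ a, ∃ t ≤ p.eval (sizeOfEnc a),
    Runs alg (enc a) (enc (f a)) t

theorem Runs.size_le {p : Algorithm} {x y : Data} {t : ℕ} (h : Runs p x y t) : y.size ≤ t := by
  induction h with
  | prim => omega
  | pair => omega
  | seq => omega
  | branchTrue => omega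
  | branchFalse => omega
  | loopDone => omega
  | loopStep => omega

theorem Data.one_le_size (d : Data) : 1 ≤ d.size := by cases d <;> simp [Data.size]

section
variable {α β γ τ σ : Type} [Enc α] [Enc β] [Enc γ] [Enc τ] [Enc σ]

theorem one_le_sizeOfEnc (a : α) : 1 ≤ sizeOfEnc a := Data.one_le_size _

theorem sizeOfEnc_prod (a : α) (b : β) : sizeOfEnc (a, b) = sizeOfEnc a + sizeOfEnc b + 1 := rfl
theorem sizeOfEnc_cons (a : α) (l : List α) :
    sizeOfEnc (a :: l) = sizeOfEnc a + sizeOfEnc l + 1 := rfl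
theorem sizeOfEnc_nil : sizeOfEnc ([] : List α) = 1 := rfl

theorem length_le_sizeOfEnc (l : List α) : l.length ≤ sizeOfEnc l := by
  induction l with
  | nil => simp
  | cons x r ih => rw [sizeOfEnc_cons, List.length_cons]; omega

theorem sizeOfEnc_append (l l' : List α) :
    sizeOfEnc (l ++ l') + 1 = sizeOfEnc l + sizeOfEnc l' := by
  induction l with
  | nil => rw [List.nil_append, sizeOfEnc_nil]; omega
  | cons x r ih => rw [List.cons_append, sizeOfEnc_cons, sizeOfEnc_cons]; omega

theorem sizeOfEnc_drop_le (l : List α) (i : ℕ) : sizeOfEnc (l.drop i) ≤ sizeOfEnc l := by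
  have := sizeOfEnc_append (l.take i) (l.drop i)
  have h := one_le_sizeOfEnc (l.take i)
  rw [List.take_append_drop] at this
  omega

theorem sizeOfEnc_le_of_mem {x : α} {l : List α} (h : x ∈ l) : sizeOfEnc x ≤ sizeOfEnc l := by
  induction l with
  | nil => simp at h
  | cons y r ih =>
    rw [sizeOfEnc_cons]
    rcases List.mem_cons.1 h with rfl | h
    · omega
    · have := ih h; omega

theorem sizeOfEnc_list_le {l : List α} {B : ℕ} (h : ∀ x ∈ l, sizeOfEnc x ≤ B) :
    sizeOfEnc l ≤ l.length * (B + 1) + 1 := by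
  induction l with
  | nil => simp [sizeOfEnc_nil]
  | cons x r ih =>
    rw [sizeOfEnc_cons, List.length_cons, add_mul]
    have h1 := ih fun y hy => h y (List.mem_cons_of_mem _ hy)
    have h2 := h x List.mem_cons_self
    omega

namespace Poly

theorem size_le {f : α → β} (hf : Poly f) :
    ∃ p : Polynomial ℕ, ∀ a, sizeOfEnc (f a) ≤ p.eval (sizeOfEnc a) := by
  obtain ⟨alg, p, h⟩ := hf
  refine ⟨p, fun a => ?_⟩
  obtain ⟨t, ht, hr⟩ := h a
  exact hr.size_le.trans ht

theorem of_prim (f : Prim) {g : α → β} (h : ∀ a, f.apply (enc a) = enc (g a))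
    (q : Polynomial ℕ) (hq : ∀ a, sizeOfEnc (g a) ≤ q.eval (sizeOfEnc a)) : Poly g := by
  refine ⟨.prim f, Polynomial.X + q + 1, fun a => ⟨_, ?_, h a ▸ Runs.prim f (enc a)⟩⟩
  have := hq a
  simp only [Polynomial.eval_add, Polynomial.eval_X, Polynomial.eval_one]
  unfold sizeOfEnc at *
  omega

theorem of_enc_eq {f : α → β} {g : α → γ} (hg : Poly g) (h : ∀ a, enc (f a) = enc (g a)) :
    Poly f := by
  obtain ⟨alg, p, hp⟩ := hg
  exact ⟨alg, p, fun a => (h a).symm ▸ hp a⟩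

@[fun_prop]
theorem id : Poly (fun a : α => a) :=
  of_prim .id (fun _ => rfl) Polynomial.X (by simp)

@[fun_prop]
theorem const (b : β) : Poly (fun _ : α => b) :=
  of_prim (.const (enc b)) (fun _ => rfl) (Polynomial.C (sizeOfEnc b)) (by simp)

@[fun_prop]
theorem comp {g : β → γ} {f : α → β} (hg : Poly g) (hf : Poly f) : Poly (fun a => g (f a)) := by
  obtain ⟨q, hq⟩ := hf.size_le
  obtain ⟨alg, p, h⟩ := hf
  obtain ⟨alg', p', h'⟩ := hg
  refine ⟨.seq alg alg', p + p'.comp q + 1, fun a => ?_⟩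
  obtain ⟨t, ht, hr⟩ := h a
  obtain ⟨t', ht', hr'⟩ := h' (f a)
  refine ⟨_, ?_, .seq hr hr'⟩
  have := eval_mono p' (hq a)
  simp only [Polynomial.eval_add, Polynomial.eval_comp, Polynomial.eval_one]
  omega

@[fun_prop]
theorem prodMk {f : α → β} {g : α → γ} (hf : Poly f) (hg : Poly g) :
    Poly (fun a => (f a, g a)) := by
  obtain ⟨q, hq⟩ := hf.size_le
  obtain ⟨q', hq'⟩ := hg.size_le
  obtain ⟨alg, p, h⟩ := hf
  obtain ⟨alg', p', h'⟩ := hg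
  refine ⟨.pair alg alg', p + p' + Polynomial.X + (q + q' + 1) + 1, fun a => ?_⟩
  obtain ⟨t, ht, hr⟩ := h a
  obtain ⟨t', ht', hr'⟩ := h' a
  refine ⟨_, ?_, .pair hr hr'⟩
  have h1 := hq a
  have h2 := hq' a
  simp only [Polynomial.eval_add, Polynomial.eval_X, Polynomial.eval_one, Data.size]
  unfold sizeOfEnc at *
  omega

theorem dataFst : Poly (fun d : Data => Prim.fst.apply d) := by
  refine of_prim .fst (fun _ => rfl) Polynomial.X fun d => ?_
  rcases d with n | ⟨a, b⟩
  · simp [sizeOfEnc, enc, Prim.apply, Data.size]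
  · simp [sizeOfEnc, enc, Prim.apply, Data.size]
    omega

theorem dataSnd : Poly (fun d : Data => Prim.snd.apply d) := by
  refine of_prim .snd (fun _ => rfl) Polynomial.X fun d => ?_
  rcases d with n | ⟨a, b⟩
  · simp [sizeOfEnc, enc, Prim.apply, Data.size]
  · simp [sizeOfEnc, enc, Prim.apply, Data.size]
    omega

def isPair : Data → Bool
  | .pair _ _ => true
  | .num _ => false

theorem isPair_poly : Poly isPair := by
  refine of_prim .isPair (fun d => ?_) (Polynomial.C 2) fun d => ?_
  · rcases d with n | ⟨a, b⟩ <;> rfl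
  · rcases d with n | ⟨a, b⟩ <;> simp [isPair, sizeOfEnc, enc, Data.size]

theorem toData : Poly (fun a : α => (enc a : Data)) := of_enc_eq id fun _ => rfl

@[fun_prop]
theorem fst {f : α → β × γ} (hf : Poly f) : Poly (fun a => (f a).1) :=
  of_enc_eq (dataFst.comp (toData.comp hf)) fun _ => rfl

@[fun_prop]
theorem snd {f : α → β × γ} (hf : Poly f) : Poly (fun a => (f a).2) :=
  of_enc_eq (dataSnd.comp (toData.comp hf)) fun _ => rfl

/-- Branching on a datum. -/
theorem branch {c : α → γ} {f g h : α → β} (hc : Poly c) (hf : Poly f) (hg : Poly g)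
    (ht : ∀ a, enc (c a) ≠ .num 0 → h a = f a) (he : ∀ a, enc (c a) = .num 0 → h a = g a) :
    Poly h := by
  obtain ⟨alg, p, hc⟩ := hc
  obtain ⟨alg', p', hf⟩ := hf
  obtain ⟨alg'', p'', hg⟩ := hg
  refine ⟨.branch alg alg' alg'', p + p' + p'' + Polynomial.X + 1, fun a => ?_⟩
  obtain ⟨t, ht', hr⟩ := hc a
  obtain ⟨t', ht'', hr'⟩ := hf a
  obtain ⟨t'', ht''', hr''⟩ := hg a
  simp only [Polynomial.eval_add, Polynomial.eval_X, Polynomial.eval_one]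
  by_cases h0 : enc (c a) = .num 0
  · refine ⟨_, ?_, he a h0 ▸ Runs.branchFalse (h0 ▸ hr) hr''⟩
    unfold sizeOfEnc at *
    omega
  · refine ⟨_, ?_, ht a h0 ▸ Runs.branchTrue hr h0 hr'⟩
    unfold sizeOfEnc at *
    omega

theorem enc_bool (b : Bool) : enc b = .num 0 ↔ b = false := by
  cases b <;> simp [enc]

@[fun_prop]
theorem cond {c : α → Bool} {f g : α → β} (hc : Poly c) (hf : Poly f) (hg : Poly g) :
    Poly (fun a => bif c a then f a else g a) := by
  refine branch hc hf hg (fun a h => ?_) fun a h => ?_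
  · rw [Ne, enc_bool] at h
    simp [h]
  · rw [enc_bool] at h
    simp [h]

@[fun_prop]
theorem ite {c : α → Prop} [∀ a, Decidable (c a)] {f g : α → β} (hc : Poly (fun a => decide (c a)))
    (hf : Poly f) (hg : Poly g) : Poly (fun a => if c a then f a else g a) := by
  convert cond hc hf hg using 2
  simp [Bool.cond_decide]

@[fun_prop]
theorem not {c : α → Bool} (hc : Poly c) : Poly (fun a => !c a) := by
  refine branch hc (const false) (const true) (fun a h => ?_) fun a h => ?_
  · rw [Ne, enc_bool] at h
    simp [h]
  · rw [enc_bool] at h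
    simp [h]

@[fun_prop]
theorem and {c d : α → Bool} (hc : Poly c) (hd : Poly d) : Poly (fun a => c a && d a) := by
  refine branch hc hd (const false) (fun a h => ?_) fun a h => ?_
  · rw [Ne, enc_bool] at h
    simp [h]
  · rw [enc_bool] at h
    simp [h]

@[fun_prop]
theorem or {c d : α → Bool} (hc : Poly c) (hd : Poly d) : Poly (fun a => c a || d a) := by
  refine branch hc (const true) hd (fun a h => ?_) fun a h => ?_
  · rw [Ne, enc_bool] at h
    simp [h]
  · rw [enc_bool] at h
    simp [h]

/- ### Numbers -/

theorem size_add_le (m n : ℕ) : (m + n).size ≤ m.size + n.size + 1 := by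
  rw [Nat.size_le]
  have h1 := Nat.lt_size_self m
  have h2 := Nat.lt_size_self n
  have h3 : 2 ^ m.size ≤ 2 ^ (m.size + n.size) := Nat.pow_le_pow_right (by omega) (by omega)
  have h4 : 2 ^ n.size ≤ 2 ^ (m.size + n.size) := Nat.pow_le_pow_right (by omega) (by omega)
  rw [pow_succ]
  omega

@[fun_prop]
theorem add {f g : α → ℕ} (hf : Poly f) (hg : Poly g) : Poly (fun a => f a + g a) := by
  have : Poly (fun p : ℕ × ℕ => p.1 + p.2) := by
    refine of_prim .add (fun _ => rfl) Polynomial.X fun p => ?_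
    have := size_add_le p.1 p.2
    rw [sizeOfEnc_prod, Polynomial.eval_X]
    simp only [sizeOfEnc, enc, Data.size]
    omega
  exact this.comp (hf.prodMk hg)

@[fun_prop]
theorem sub {f g : α → ℕ} (hf : Poly f) (hg : Poly g) : Poly (fun a => f a - g a) := by
  have : Poly (fun p : ℕ × ℕ => p.1 - p.2) := by
    refine of_prim .sub (fun _ => rfl) Polynomial.X fun p => ?_
    have := Nat.size_le_size (Nat.sub_le p.1 p.2)
    rw [sizeOfEnc_prod, Polynomial.eval_X]
    simp only [sizeOfEnc, enc, Data.size]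
    omega
  exact this.comp (hf.prodMk hg)

theorem isZero {f : α → ℕ} (hf : Poly f) : Poly (fun a => decide (f a = 0)) := by
  refine branch hf (const false) (const true) (fun a h => ?_) fun a h => ?_
  · simpa [enc] using h
  · simpa [enc] using h

@[fun_prop]
theorem natLe {f g : α → ℕ} (hf : Poly f) (hg : Poly g) : Poly (fun a => decide (f a ≤ g a)) := by
  convert isZero (hf.sub hg) using 3
  omega

@[fun_prop]
theorem natLt {f g : α → ℕ} (hf : Poly f) (hg : Poly g) : Poly (fun a => decide (f a < g a)) := by
  convert natLe (hf.add (const 1)) hg using 3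
  omega

@[fun_prop]
theorem natEq {f g : α → ℕ} (hf : Poly f) (hg : Poly g) : Poly (fun a => decide (f a = g a)) := by
  convert (natLe hf hg).and (natLe hg hf) using 2
  rw [← Bool.decide_and]
  congr 1
  simp only [eq_iff_iff]
  omega

@[fun_prop]
theorem andProp {c d : α → Prop} [∀ a, Decidable (c a)] [∀ a, Decidable (d a)]
    (hc : Poly (fun a => decide (c a))) (hd : Poly (fun a => decide (d a))) :
    Poly (fun a => decide (c a ∧ d a)) := by
  convert hc.and hd using 2
  simp

/- ### Constructors and case distinctions -/

@[fun_prop]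
theorem some {f : α → β} (hf : Poly f) : Poly (fun a => Option.some (f a)) :=
  of_enc_eq ((const 1).prodMk hf) fun _ => rfl

@[fun_prop]
theorem cons {f : α → β} {g : α → List β} (hf : Poly f) (hg : Poly g) :
    Poly (fun a => f a :: g a) :=
  of_enc_eq (hf.prodMk hg) fun _ => rfl

@[fun_prop]
theorem inl {f : α → β} (hf : Poly f) : Poly (fun a => (Sum.inl (f a) : β ⊕ γ)) :=
  of_enc_eq ((const 0).prodMk hf) fun _ => rfl

@[fun_prop]
theorem inr {f : α → γ} (hf : Poly f) : Poly (fun a => (Sum.inr (f a) : β ⊕ γ)) :=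
  of_enc_eq ((const 1).prodMk hf) fun _ => rfl

/-- A case distinction with one argument: the data of the constructor are accessible to `f`. -/
theorem casesAux {c : γ → Bool} {k : γ → Data} {f : α → β} {g h : γ → β} (hc : Poly c)
    (hk : Poly k) (hf : Poly f) (hg : Poly g) (proj : γ → Option α)
    (h1 : ∀ x, c x = true → ∃ y, proj x = Option.some y ∧ enc y = k x ∧ h x = f y)
    (h2 : ∀ x, c x = false → h x = g x) : Poly h := by
  obtain ⟨q, hq⟩ := hk.size_le
  obtain ⟨algc, pc, hc⟩ := hc
  obtain ⟨algf, pf, hf⟩ := hf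
  obtain ⟨algk, pk, hk⟩ := hk
  obtain ⟨algg, pg, hg⟩ := hg
  refine ⟨.branch algc (.seq algk algf) algg,
    pc + (pk + pf.comp q + 1) + pg + Polynomial.X + 1, fun x => ?_⟩
  obtain ⟨tc, htc, hrc⟩ := hc x
  obtain ⟨tk, htk, hrk⟩ := hk x
  simp only [Polynomial.eval_add, Polynomial.eval_X, Polynomial.eval_one, Polynomial.eval_comp]
  by_cases hx : c x = true
  · obtain ⟨y, -, hy, hxy⟩ := h1 x hx
    obtain ⟨tf, htf, hrf⟩ := hf y
    rw [hy] at hrf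
    refine ⟨_, ?_, hxy ▸ Runs.branchTrue hrc (by rw [hx]; simp [enc]) (.seq hrk hrf)⟩
    have h3 : sizeOfEnc y = sizeOfEnc (k x) := congrArg Data.size hy
    have h4 := eval_mono pf (h3.le.trans (hq x))
    unfold sizeOfEnc at *
    omega
  · have hx' : c x = false := by simpa using hx
    obtain ⟨tg, htg, hrg⟩ := hg x
    refine ⟨_, ?_, h2 x hx' ▸ Runs.branchFalse (by simpa [hx', enc] using hrc) hrg⟩
    unfold sizeOfEnc at *
    omega

@[fun_prop]
theorem optionElim {f : α → τ → β} {o : α → Option τ} {b : α → β}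
    (hf : Poly (fun p : α × τ => f p.1 p.2)) (hb : Poly b) (ho : Poly o) :
    Poly (fun a => (o a).elim (b a) (f a)) := by
  refine casesAux (c := fun a => isPair (enc (o a)))
    (k := fun a => Data.pair (enc a) (Prim.snd.apply (enc (o a))))
    (isPair_poly.comp (toData.comp ho))
    (of_enc_eq (id.prodMk (dataSnd.comp (toData.comp ho))) fun _ => rfl) hf hb
    (fun a => (o a).map fun x => (a, x)) (fun a h => ?_) fun a h => ?_
  · cases hx : o a with
    | none => rw [hx] at h; simp [enc, isPair] at h
    | some x => exact ⟨(a, x), rfl, rfl, rfl⟩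
  · cases hx : o a with
    | none => rfl
    | some x => rw [hx] at h; simp [enc, isPair] at h

/-- The number at a leaf. -/
def toNat : Data → ℕ
  | .num n => n
  | .pair _ _ => 0

theorem toNat_poly : Poly toNat := by
  refine of_enc_eq (g := fun d => bif isPair d then Data.num 0 else d)
    (isPair_poly.cond (const _) id) fun d => ?_
  rcases d with n | ⟨a, b⟩ <;> rfl

/-- The arguments of the `k`-th constructor. -/
def untag (k : ℕ) (d : Data) : Data :=
  bif isPair d && decide (toNat (Prim.fst.apply d) = k) then .pair (.num 1) (Prim.snd.apply d)
  else .num 0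

theorem untag_poly (k : ℕ) : Poly (untag k) := by
  have h : Poly (fun d => Data.pair (.num 1) (Prim.snd.apply d)) :=
    of_enc_eq ((const 1).prodMk dataSnd) fun _ => rfl
  exact (isPair_poly.and (natEq (toNat_poly.comp dataFst) (const k))).cond h (const _)

/-- A destructor. -/
theorem of_untag (k : ℕ) {f : α → Option β} (h : ∀ a, enc (f a) = untag k (enc a)) : Poly f :=
  of_enc_eq ((untag_poly k).comp toData) h

@[fun_prop]
theorem sumElim {f : α → τ → β} {g : α → σ → β} {o : α → τ ⊕ σ}
    (hf : Poly (fun p : α × τ => f p.1 p.2)) (hg : Poly (fun p : α × σ => g p.1 p.2))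
    (ho : Poly o) : Poly (fun a => Sum.elim (f a) (g a) (o a)) := by
  have hl : Poly (fun o : τ ⊕ σ => o.getLeft?) := of_untag 0 fun o => by cases o <;> rfl
  have hr : Poly (fun o : τ ⊕ σ => o.getRight?) := of_untag 1 fun o => by cases o <;> rfl
  have h0 : Poly (fun a => (o a).getLeft?) := hl.comp ho
  have h1 : Poly (fun a => (o a).getRight?) := hr.comp ho
  -- the default value is irrelevant
  by_cases hα : Nonempty α
  · obtain ⟨a₀⟩ := hα
    let b₀ := Sum.elim (f a₀) (g a₀) (o a₀)
    convert optionElim hf (optionElim hg (const b₀) h1) h0 using 2 with a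
    cases o a <;> rfl
  · exact of_prim .id (fun a => (hα ⟨a⟩).elim) 0 fun a => (hα ⟨a⟩).elim

/-- Case distinction on lists. -/
def listCases (l : List τ) (b : β) (f : τ → List τ → β) : β :=
  match l with
  | [] => b
  | x :: r => f x r

@[fun_prop]
theorem listCases_poly {f : α → τ → List τ → β} {l : α → List τ} {b : α → β}
    (hf : Poly (fun p : α × τ × List τ => f p.1 p.2.1 p.2.2)) (hb : Poly b) (hl : Poly l) :
    Poly (fun a => listCases (l a) (b a) (f a)) := by
  refine casesAux (c := fun a => isPair (enc (l a))) (k := fun a => Data.pair (enc a) (enc (l a)))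
    (isPair_poly.comp (toData.comp hl)) (of_enc_eq (id.prodMk hl) fun _ => rfl) hf hb
    (fun a => (l a).head?.map fun x => (a, x, (l a).tail)) (fun a h => ?_) fun a h => ?_
  · cases hx : l a with
    | nil => rw [hx] at h; simp [enc, isPair] at h
    | cons x r => exact ⟨(a, x, r), rfl, rfl, rfl⟩
  · cases hx : l a with
    | nil => rfl
    | cons x r => rw [hx] at h; simp [enc, isPair] at h

/- ### Loops -/

theorem loop_runs {c : σ → Bool} {f : σ → σ} {p q : Algorithm} {T B : ℕ} :
    ∀ (n : ℕ) (s : σ), (∀ i ≤ n, sizeOfEnc (f^[i] s) ≤ B ∧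
      ∃ t ≤ T, Runs p (enc (f^[i] s)) (enc (c (f^[i] s))) t) →
    (∀ i < n, c (f^[i] s) = true ∧ ∃ t ≤ T, Runs q (enc (f^[i] s)) (enc (f^[i + 1] s)) t) →
    c (f^[n] s) = false →
    ∃ t ≤ (n + 1) * (2 * T + B + 1), Runs (.loop p q) (enc s) (enc (f^[n] s)) t := by
  intro n
  induction n with
  | zero =>
    intro s h1 _ h3
    obtain ⟨hB, t, ht, hr⟩ := h1 0 le_rfl
    rw [h3] at hr
    refine ⟨_, ?_, Runs.loopDone hr⟩
    simp only [sizeOfEnc, Function.iterate_zero, _root_.id] at hB ⊢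
    omega
  | succ n ih =>
    intro s h1 h2 h3
    obtain ⟨hB, t, ht, hr⟩ := h1 0 (by omega)
    obtain ⟨hc, t', ht', hr'⟩ := h2 0 (by omega)
    obtain ⟨u, hu, hl⟩ := ih (f s) (fun i hi => h1 (i + 1) (by omega))
      (fun i hi => h2 (i + 1) (by omega)) h3
    rw [hc] at hr
    refine ⟨_, ?_, Runs.loopStep hr (by simp [enc]) hr' hl⟩
    simp only [sizeOfEnc, Function.iterate_zero, _root_.id] at hB ⊢
    rw [add_mul (n + 1)]
    omega

theorem iterate {c : σ → Bool} {f : σ → σ} {s : α → σ} (hc : Poly c) (hf : Poly f) (hs : Poly s)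
    (n : α → ℕ) (q : Polynomial ℕ) (hn : ∀ a, n a ≤ q.eval (sizeOfEnc a))
    (hq : ∀ a, ∀ i ≤ n a, sizeOfEnc (f^[i] (s a)) ≤ q.eval (sizeOfEnc a))
    (hlt : ∀ a, ∀ i < n a, c (f^[i] (s a)) = true) (hend : ∀ a, c (f^[n a] (s a)) = false) :
    Poly (fun a => f^[n a] (s a)) := by
  obtain ⟨algc, pc, hc⟩ := hc
  obtain ⟨algf, pf, hf⟩ := hf
  obtain ⟨algs, ps, hs⟩ := hs
  refine ⟨.seq algs (.loop algc algf),
    ps + (q + 1) * (2 * (pc.comp q + pf.comp q) + q + 1) + 1, fun a => ?_⟩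
  obtain ⟨t, ht, hr⟩ := hs a
  obtain ⟨u, hu, hl⟩ := loop_runs (p := algc) (q := algf)
    (T := (pc.comp q + pf.comp q).eval (sizeOfEnc a)) (B := q.eval (sizeOfEnc a)) (n a) (s a)
    (fun i hi => ⟨hq a i hi, by
      obtain ⟨t, ht, hr⟩ := hc (f^[i] (s a))
      refine ⟨t, ht.trans ((eval_mono pc (hq a i hi)).trans ?_), hr⟩
      simp⟩)
    (fun i hi => ⟨hlt a i hi, by
      obtain ⟨t, ht, hr⟩ := hf (f^[i] (s a))
      rw [Function.iterate_succ_apply']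
      refine ⟨t, ht.trans ((eval_mono pf (hq a i hi.le)).trans ?_), hr⟩
      simp⟩) (hend a)
  refine ⟨_, ?_, .seq hr hl⟩
  have h1 := Nat.mul_le_mul_right
    (2 * (pc.comp q + pf.comp q).eval (sizeOfEnc a) + q.eval (sizeOfEnc a) + 1)
    (Nat.add_le_add_right (hn a) 1)
  simp only [Polynomial.eval_add, Polynomial.eval_mul, Polynomial.eval_one,
    Polynomial.eval_ofNat] at h1 hu ⊢
  omega

/-- A fold all of whose intermediate results are of polynomial size. -/
theorem foldl_of_bound {g : α → β → τ → β} {l : α → List τ} {b : α → β}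
    (hg : Poly (fun p : α × β × τ => g p.1 p.2.1 p.2.2)) (hl : Poly l) (hb : Poly b)
    (q : Polynomial ℕ)
    (hq : ∀ a l', l' <+: l a → sizeOfEnc (l'.foldl (g a) (b a)) ≤ q.eval (sizeOfEnc a)) :
    Poly (fun a => (l a).foldl (g a) (b a)) := by
  let f : α × List τ × β → α × List τ × β := fun s =>
    listCases s.2.1 s fun x r => (s.1, r, g s.1 s.2.2 x)
  have hf : Poly f := by
    have : Poly (fun p : (α × List τ × β) × τ × List τ =>
        g p.1.1 p.1.2.2 p.2.1) := hg.comp (f := fun p : (α × List τ × β) × τ × List τ =>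
          (p.1.1, p.1.2.2, p.2.1)) (by fun_prop)
    fun_prop
  have hit : ∀ a i, i ≤ (l a).length →
      f^[i] (a, l a, b a) = (a, (l a).drop i, ((l a).take i).foldl (g a) (b a)) := by
    intro a i
    induction i with
    | zero => intro _; rfl
    | succ i ih =>
      intro hi
      rw [Function.iterate_succ_apply', ih (by omega)]
      simp only [f]
      rw [List.drop_eq_getElem_cons (by omega), List.take_succ_eq_append_getElem (by omega),
        List.foldl_append]
      rfl
  obtain ⟨ql, hql⟩ := hl.size_le
  have key : Poly (fun a => f^[(l a).length] (a, l a, b a)) := by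
    refine iterate (c := fun s => listCases s.2.1 false fun _ _ => true) (by fun_prop) hf
      (by fun_prop) (fun a => (l a).length) (Polynomial.X + ql + q + 2) ?_ ?_ ?_ ?_
    · intro a
      have h1 := length_le_sizeOfEnc (l a)
      have h2 := hql a
      simp only [Polynomial.eval_add]
      omega
    · intro a i hi
      rw [hit a i hi, sizeOfEnc_prod, sizeOfEnc_prod]
      have h1 := sizeOfEnc_drop_le (l a) i
      have h2 := hql a
      have h3 := hq a _ (List.take_prefix i (l a))
      simp only [Polynomial.eval_add, Polynomial.eval_X, Polynomial.eval_ofNat]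
      omega
    · intro a i hi
      rw [hit a i hi.le]
      simp only
      rw [List.drop_eq_getElem_cons hi]
      rfl
    · intro a
      rw [hit a _ le_rfl]
      simp [listCases]
  convert key.snd.snd using 2 with a
  rw [hit a _ le_rfl]
  simp

end Poly
end
end IRM

namespace IRM

open Enc (enc)

section
variable {α β γ τ σ : Type} [Enc α] [Enc β] [Enc γ] [Enc τ] [Enc σ]

theorem sizeOfEnc_some (a : α) : sizeOfEnc (some a) = sizeOfEnc a + 3 := by
  have : sizeOfEnc (some a) = sizeOfEnc (1, a) := rfl
  rw [this, sizeOfEnc_prod]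
  have : sizeOfEnc 1 = 2 := by simp [sizeOfEnc, enc, Data.size]
  omega

theorem sizeOfEnc_none : sizeOfEnc (none : Option α) = 1 := by
  simp [sizeOfEnc, enc, Data.size]

theorem sizeOfEnc_nat_le (n : ℕ) : sizeOfEnc n ≤ n + 1 := by
  have : n.size ≤ n := Nat.size_le.2 Nat.lt_two_pow_self
  simpa [sizeOfEnc, enc, Data.size] using this

theorem sizeOfEnc_nat_mono {m n : ℕ} (h : m ≤ n) : sizeOfEnc m ≤ sizeOfEnc n := by
  simpa [sizeOfEnc, enc, Data.size] using Nat.size_le_size h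

theorem sizeOfEnc_nat_succ (n : ℕ) : sizeOfEnc (n + 1) ≤ sizeOfEnc n + 1 := by
  have : (n + 1).size ≤ n.size + 1 := by
    rw [Nat.size_le, pow_succ]
    have := Nat.lt_size_self n
    omega
  simpa [sizeOfEnc, enc, Data.size] using this

namespace Poly

/- ### Lists -/

theorem foldl_of_add {g : α → β → τ → β} {l : α → List τ} {b : α → β}
    (hg : Poly (fun p : α × β × τ => g p.1 p.2.1 p.2.2)) (hl : Poly l) (hb : Poly b)
    (q : Polynomial ℕ)
    (hq : ∀ a b x, sizeOfEnc (g a b x) ≤ sizeOfEnc b + q.eval (sizeOfEnc a + sizeOfEnc x)) :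
    Poly (fun a => (l a).foldl (g a) (b a)) := by
  obtain ⟨ql, hql⟩ := hl.size_le
  obtain ⟨qb, hqb⟩ := hb.size_le
  refine foldl_of_bound hg hl hb (qb + ql * q.comp (Polynomial.X + ql)) fun a l' hl' => ?_
  have key : ∀ (l' : List τ) b, (∀ x ∈ l', x ∈ l a) → sizeOfEnc (l'.foldl (g a) b) ≤
      sizeOfEnc b + l'.length * q.eval (sizeOfEnc a + sizeOfEnc (l a)) := by
    intro l'
    induction l' with
    | nil => simp
    | cons x r ih =>
      intro b hx
      have h1 := ih (g a b x) fun y hy => hx y (List.mem_cons_of_mem _ hy)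
      have h2 := hq a b x
      have h3 := eval_mono q (Nat.add_le_add_left (sizeOfEnc_le_of_mem (hx x List.mem_cons_self))
        (sizeOfEnc a))
      rw [List.foldl_cons, List.length_cons, add_mul]
      omega
  have h1 := key l' (b a) fun x hx => hl'.subset hx
  have h2 := hqb a
  have h3 : l'.length ≤ ql.eval (sizeOfEnc a) :=
    hl'.length_le.trans ((length_le_sizeOfEnc _).trans (hql a))
  have h4 := eval_mono q (Nat.add_le_add_left (hql a) (sizeOfEnc a))
  have h5 := Nat.mul_le_mul h3 h4
  simp only [Polynomial.eval_add, Polynomial.eval_mul, Polynomial.eval_comp, Polynomial.eval_X]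
  omega

@[fun_prop]
theorem reverse {l : α → List τ} (hl : Poly l) : Poly (fun a => (l a).reverse) := by
  have : Poly (fun a => (l a).foldl (fun r x => x :: r) []) := by
    refine foldl_of_add (g := fun _ r x => x :: r) (by fun_prop) hl (const []) (Polynomial.X + 1)
      fun a b x => ?_
    rw [sizeOfEnc_cons]
    simp only [Polynomial.eval_add, Polynomial.eval_X, Polynomial.eval_one]
    omega
  convert this using 2
  simp

theorem foldr_of_bound {g : α → τ → β → β} {l : α → List τ} {b : α → β}
    (hg : Poly (fun p : α × τ × β => g p.1 p.2.1 p.2.2)) (hl : Poly l) (hb : Poly b)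
    (q : Polynomial ℕ)
    (hq : ∀ a l', l' <:+ l a → sizeOfEnc (l'.foldr (g a) (b a)) ≤ q.eval (sizeOfEnc a)) :
    Poly (fun a => (l a).foldr (g a) (b a)) := by
  have : Poly (fun a => (l a).reverse.foldl (fun b x => g a x b) (b a)) := by
    refine foldl_of_bound (g := fun a b x => g a x b)
      (hg.comp (f := fun p : α × β × τ => (p.1, p.2.2, p.2.1)) (by fun_prop)) hl.reverse hb q
      fun a l' hl' => ?_
    have := hq a l'.reverse (by simpa using List.reverse_suffix.2 hl')
    simpa using this
  simpa using this

theorem foldr_of_add {g : α → τ → β → β} {l : α → List τ} {b : α → β}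
    (hg : Poly (fun p : α × τ × β => g p.1 p.2.1 p.2.2)) (hl : Poly l) (hb : Poly b)
    (q : Polynomial ℕ)
    (hq : ∀ a x b, sizeOfEnc (g a x b) ≤ sizeOfEnc b + q.eval (sizeOfEnc a + sizeOfEnc x)) :
    Poly (fun a => (l a).foldr (g a) (b a)) := by
  have : Poly (fun a => (l a).reverse.foldl (fun b x => g a x b) (b a)) :=
    foldl_of_add (g := fun a b x => g a x b)
      (hg.comp (f := fun p : α × β × τ => (p.1, p.2.2, p.2.1)) (by fun_prop)) hl.reverse hb q
      fun a b x => hq a x b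
  simpa using this

@[fun_prop]
theorem append {f g : α → List τ} (hf : Poly f) (hg : Poly g) : Poly (fun a => f a ++ g a) := by
  have : Poly (fun a => (f a).foldr (fun x r => x :: r) (g a)) := by
    refine foldr_of_add (g := fun _ x r => x :: r) (by fun_prop) hf hg (Polynomial.X + 1)
      fun a b x => ?_
    rw [sizeOfEnc_cons]
    simp only [Polynomial.eval_add, Polynomial.eval_X, Polynomial.eval_one]
    omega
  simpa using this

@[fun_prop]
theorem flatMap {f : α → τ → List β} {l : α → List τ} (hf : Poly (fun p : α × τ => f p.1 p.2))
    (hl : Poly l) : Poly (fun a => (l a).flatMap (f a)) := by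
  obtain ⟨q, hq⟩ := hf.size_le
  have : Poly (fun a => (l a).foldr (fun x r => f a x ++ r) []) := by
    have h : Poly (fun p : α × τ × List β => f p.1 p.2.1) :=
      hf.comp (f := fun p : α × τ × List β => (p.1, p.2.1)) (by fun_prop)
    refine foldr_of_add (g := fun a x r => f a x ++ r) (by fun_prop) hl (const [])
      (q.comp (Polynomial.X + 1)) fun a x b => ?_
    have h1 := sizeOfEnc_append (f a x) b
    have h2 := hq (a, x)
    rw [sizeOfEnc_prod] at h2
    dsimp only at h2
    simp only [Polynomial.eval_comp, Polynomial.eval_add, Polynomial.eval_X, Polynomial.eval_one]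
    omega
  convert this using 2 with a
  induction l a with
  | nil => rfl
  | cons x r ih => rw [List.flatMap_cons, ih]; rfl

@[fun_prop]
theorem map {f : α → τ → β} {l : α → List τ} (hf : Poly (fun p : α × τ => f p.1 p.2))
    (hl : Poly l) : Poly (fun a => (l a).map (f a)) := by
  have : Poly (fun a => (l a).flatMap fun x => [f a x]) := by fun_prop
  convert this using 2 with a
  induction l a with
  | nil => rfl
  | cons x r ih => rw [List.map_cons, ih]; rfl

@[fun_prop]
theorem filter {f : α → τ → Bool} {l : α → List τ} (hf : Poly (fun p : α × τ => f p.1 p.2))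
    (hl : Poly l) : Poly (fun a => (l a).filter (f a)) := by
  have : Poly (fun a => (l a).flatMap fun x => bif f a x then [x] else []) := by fun_prop
  convert this using 2 with a
  induction l a with
  | nil => rfl
  | cons x r ih => rw [List.flatMap_cons, List.filter_cons, ih]; cases f a x <;> rfl

@[fun_prop]
theorem find? {f : α → τ → Bool} {l : α → List τ} (hf : Poly (fun p : α × τ => f p.1 p.2))
    (hl : Poly l) : Poly (fun a => (l a).find? (f a)) := by
  have h : Poly (fun p : α × τ × Option τ => f p.1 p.2.1) :=
    hf.comp (f := fun p : α × τ × Option τ => (p.1, p.2.1)) (by fun_prop)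
  have : Poly (fun a => (l a).foldr (fun x r => bif f a x then Option.some x else r) none) := by
    refine foldr_of_add (g := fun a x r => bif f a x then Option.some x else r) (by fun_prop) hl
      (const none) (Polynomial.X + 3) fun a x b => ?_
    simp only [Polynomial.eval_add, Polynomial.eval_X, Polynomial.eval_ofNat]
    cases f a x
    · simp only [cond_false]; omega
    · simp only [cond_true, sizeOfEnc_some]; omega
  convert this using 2 with a
  induction l a with
  | nil => rfl
  | cons x r ih => rw [List.find?_cons, ih]; cases h : f a x <;> simp [h, ← ih]

@[fun_prop]
theorem length {l : α → List τ} (hl : Poly l) : Poly (fun a => (l a).length) := by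
  have : Poly (fun a => (l a).foldr (fun _ n => n + 1) 0) := by
    refine foldr_of_add (g := fun _ _ n => n + 1) (by fun_prop) hl (const 0) 1 fun a x b => ?_
    simpa using sizeOfEnc_nat_succ b
  convert this using 2 with a
  induction l a with
  | nil => rfl
  | cons x r ih => rw [List.length_cons, ih]; rfl

@[fun_prop]
theorem rangeLength {l : α → List τ} (hl : Poly l) : Poly (fun a => List.range (l a).length) := by
  have hr : ∀ l : List τ, l.foldl (fun r _ => r ++ [r.length]) [] = List.range l.length := by
    intro l
    induction l using List.reverseRecOn with
    | nil => rfl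
    | append_singleton l x ih => simp [ih, List.range_succ]
  obtain ⟨q, hq⟩ := hl.size_le
  have : Poly (fun a => (l a).foldl (fun r _ => r ++ [r.length]) []) := by
    refine foldl_of_bound (g := fun _ r _ => r ++ [r.length]) (by fun_prop) hl (const [])
      (q * (q + 2) + 1) fun a l' hl' => ?_
    have h1 : l'.length ≤ q.eval (sizeOfEnc a) :=
      hl'.length_le.trans ((length_le_sizeOfEnc _).trans (hq a))
    rw [hr]
    refine (sizeOfEnc_list_le (B := l'.length + 1) fun x hx => ?_).trans ?_
    · have := sizeOfEnc_nat_le x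
      have := List.mem_range.1 hx
      omega
    · rw [List.length_range]
      have := Nat.mul_le_mul h1 (Nat.add_le_add_right h1 2)
      simpa using this
  simpa only [hr] using this

@[fun_prop]
theorem optionMap {f : α → τ → β} {o : α → Option τ} (hf : Poly (fun p : α × τ => f p.1 p.2))
    (ho : Poly o) : Poly (fun a => (o a).map (f a)) := by
  have : Poly (fun a => (o a).elim none fun x => Option.some (f a x)) := by fun_prop
  convert this using 2 with a
  cases o a <;> rfl

@[fun_prop]
theorem optionBind {f : α → τ → Option β} {o : α → Option τ}
    (hf : Poly (fun p : α × τ => f p.1 p.2)) (ho : Poly o) : Poly (fun a => (o a).bind (f a)) := by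
  have : Poly (fun a => (o a).elim none fun x => f a x) := by fun_prop
  convert this using 2 with a
  cases o a <;> rfl

@[fun_prop]
theorem headD {l : α → List τ} {b : α → τ} (hl : Poly l) (hb : Poly b) :
    Poly (fun a => (l a).headD (b a)) := by
  have : Poly (fun a => listCases (l a) (b a) fun x _ => x) := by fun_prop
  convert this using 2 with a
  cases l a <;> rfl

@[fun_prop]
theorem getElem? {l : α → List τ} {i : α → ℕ} (hl : Poly l) (hi : Poly i) :
    Poly (fun a => (l a)[i a]?) := by
  let g : ℕ × Option τ → τ → ℕ × Option τ := fun s x =>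
    if s.1 = 0 then s else if s.1 = 1 then (0, Option.some x) else (s.1 - 1, none)
  have h0 : ∀ (l : List τ) o, l.foldl g (0, o) = (0, o) := by
    intro l o
    induction l with
    | nil => rfl
    | cons x r ih => rw [List.foldl_cons]; exact ih
  have hg : ∀ (l : List τ) i, (l.foldl g (i + 1, none)).2 = l[i]? := by
    intro l
    induction l with
    | nil => simp
    | cons x r ih =>
      intro i
      rw [List.foldl_cons]
      cases i with
      | zero =>
        have : g (0 + 1, none) x = (0, Option.some x) := rfl
        rw [this, h0]
        rfl
      | succ i =>
        have : g (i + 1 + 1, none) x = (i + 1, none) := by simp [g]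
        rw [this, ih]
        rfl
  have : Poly (fun a => (l a).foldl g (i a + 1, none)) := by
    refine foldl_of_add (g := fun _ s x => g s x) (by fun_prop) hl (by fun_prop) (Polynomial.X + 4)
      fun a s x => ?_
    obtain ⟨n, o⟩ := s
    simp only [Polynomial.eval_add, Polynomial.eval_X, Polynomial.eval_ofNat, g]
    have h1 := one_le_sizeOfEnc o
    have h2 := one_le_sizeOfEnc n
    have h3 := sizeOfEnc_nat_mono (Nat.sub_le n 1)
    split_ifs
    · omega
    · rw [sizeOfEnc_prod, sizeOfEnc_prod, sizeOfEnc_some]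
      have : sizeOfEnc 0 = 1 := by simp [sizeOfEnc, enc, Data.size]
      omega
    · rw [sizeOfEnc_prod, sizeOfEnc_prod, sizeOfEnc_none]
      omega
  convert this.snd using 2 with a
  rw [hg]

@[fun_prop]
theorem tails {l : α → List τ} (hl : Poly l) : Poly (fun a => (l a).tails) := by
  have hr : ∀ l : List τ,
      l.foldr (fun x r => (x :: r.headD []) :: r) [[]] = l.tails := by
    intro l
    induction l with
    | nil => rfl
    | cons x r ih =>
      rw [List.foldr_cons, ih, List.tails_cons]
      cases r <;> simp
  obtain ⟨q, hq⟩ := hl.size_le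
  have : Poly (fun a => (l a).foldr (fun x r => (x :: r.headD []) :: r) [[]]) := by
    refine foldr_of_bound (g := fun _ x r => (x :: r.headD []) :: r) (by fun_prop) hl (const [[]])
      ((q + 1) * (q + 1) + 1) fun a l' hl' => ?_
    rw [hr]
    refine (sizeOfEnc_list_le (B := sizeOfEnc (l a)) fun x hx => ?_).trans ?_
    · have h := ((List.mem_tails _ _).1 hx).trans hl'
      obtain ⟨r, hr⟩ := h
      have := sizeOfEnc_drop_le (r ++ x) r.length
      rwa [List.drop_left, hr] at this
    · have h1 : l'.length + 1 ≤ q.eval (sizeOfEnc a) + 1 :=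
        Nat.add_le_add_right (hl'.length_le.trans ((length_le_sizeOfEnc _).trans (hq a))) 1
      have := Nat.mul_le_mul h1 (Nat.add_le_add_right (hq a) 1)
      rw [List.length_tails]
      simpa using this
  simpa only [hr] using this

@[fun_prop]
theorem listAny {f : α → τ → Bool} {l : α → List τ} (hf : Poly (fun p : α × τ => f p.1 p.2))
    (hl : Poly l) : Poly (fun a => (l a).any (f a)) := by
  have : Poly (fun a => ((l a).find? (f a)).elim false fun _ => true) := by fun_prop
  convert this using 2 with a
  induction l a with
  | nil => rfl
  | cons x r ih => rw [List.any_cons, List.find?_cons, ih]; cases h : f a x <;> rfl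

@[fun_prop]
theorem listNatEq {f g : α → List ℕ} (hf : Poly f) (hg : Poly g) :
    Poly (fun a => decide (f a = g a)) := by
  let step : Option (List ℕ) → ℕ → Option (List ℕ) := fun s x =>
    s.elim none fun r => listCases r none fun y r => if x = y then Option.some r else none
  have h0 : ∀ l : List ℕ, l.foldl step none = none := by
    intro l
    induction l with
    | nil => rfl
    | cons x r ih => rw [List.foldl_cons]; exact ih
  have hr : ∀ l r : List ℕ, (l.foldl step (Option.some r)).elim false
      (fun r => listCases r true fun _ _ => false) = decide (l = r) := by
    intro l
    induction l with
    | nil => intro r; cases r <;> rfl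
    | cons x l ih =>
      intro r
      rw [List.foldl_cons]
      cases r with
      | nil =>
        have : step (Option.some []) x = none := rfl
        rw [this, h0]
        simp
      | cons y r =>
        by_cases hxy : x = y
        · have : step (Option.some (y :: r)) x = Option.some r := by simp [step, listCases, hxy]
          rw [this, ih]
          simp [hxy]
        · have : step (Option.some (y :: r)) x = none := by simp [step, listCases, hxy]
          rw [this, h0]
          simp [hxy]
  have : Poly (fun a => (f a).foldl step (Option.some (g a))) := by
    refine foldl_of_add (g := fun _ s x => step s x) (by fun_prop) hf (by fun_prop) 0
      fun a s x => ?_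
    rcases s with _ | _ | ⟨y, r⟩
    · simp [step]
    · simp [step, listCases, sizeOfEnc_none, one_le_sizeOfEnc]
    · by_cases hxy : x = y
      · simp only [step, Option.elim, listCases, hxy, if_true, sizeOfEnc_some, sizeOfEnc_cons]
        omega
      · simp [step, listCases, hxy, sizeOfEnc_none, one_le_sizeOfEnc]
  simp only [← hr]
  fun_prop

end Poly
end
end IRM

namespace IRM

open Enc (enc)

section
variable {α β γ τ σ T : Type} [Enc α] [Enc β] [Enc γ] [Enc τ] [Enc σ] [Enc T]

theorem sizeOfEnc_inl (a : α) : sizeOfEnc (Sum.inl a : α ⊕ β) = sizeOfEnc a + 2 := by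
  have : sizeOfEnc (Sum.inl a : α ⊕ β) = sizeOfEnc (0, a) := rfl
  rw [this, sizeOfEnc_prod]
  have : sizeOfEnc 0 = 1 := by simp [sizeOfEnc, enc, Data.size]
  omega

theorem sizeOfEnc_inr (b : β) : sizeOfEnc (Sum.inr b : α ⊕ β) = sizeOfEnc b + 3 := by
  have : sizeOfEnc (Sum.inr b : α ⊕ β) = sizeOfEnc (1, b) := rfl
  rw [this, sizeOfEnc_prod]
  have : sizeOfEnc 1 = 2 := by simp [sizeOfEnc, enc, Data.size]
  omega

namespace Poly

/-- A while loop with a decreasing measure and states that grow slowly. -/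
theorem while_of_measure {c : σ → Bool} {f : σ → σ} {s : α → σ} {out : σ → β} {h : α → β}
    (hc : Poly c) (hf : Poly f) (hs : Poly s) (hout : Poly out) (Inv : α → σ → Prop)
    (μ : α → σ → ℕ) (q : Polynomial ℕ) (hinit : ∀ a, Inv a (s a))
    (hμ : ∀ a, μ a (s a) ≤ q.eval (sizeOfEnc a))
    (hstep : ∀ a x, Inv a x → c x = true → Inv a (f x) ∧ μ a (f x) < μ a x ∧
      sizeOfEnc (f x) ≤ sizeOfEnc x + q.eval (sizeOfEnc a))
    (hend : ∀ a x, Inv a x → c x = false → out x = h a) : Poly h := by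
  have key : ∀ a m x, Inv a x → μ a x ≤ m → ∃ n ≤ m, (∀ i < n, c (f^[i] x) = true) ∧
      c (f^[n] x) = false ∧ ∀ i ≤ n, Inv a (f^[i] x) ∧
        sizeOfEnc (f^[i] x) ≤ sizeOfEnc x + i * q.eval (sizeOfEnc a) := by
    intro a m
    induction m with
    | zero =>
      intro x hx hm
      cases hcx : c x with
      | false => exact ⟨0, le_rfl, by simp, hcx, fun i hi => by
          obtain rfl : i = 0 := by omega
          simpa using hx⟩
      | true => have := (hstep a x hx hcx).2.1; omega
    | succ m ih =>
      intro x hx hm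
      cases hcx : c x with
      | false => exact ⟨0, by omega, by simp, hcx, fun i hi => by
          obtain rfl : i = 0 := by omega
          simpa using hx⟩
      | true =>
        obtain ⟨h1, h2, h3⟩ := hstep a x hx hcx
        obtain ⟨n, hn, hn1, hn2, hn3⟩ := ih (f x) h1 (by omega)
        refine ⟨n + 1, by omega, fun i hi => ?_, hn2, fun i hi => ?_⟩
        · cases i with
          | zero => exact hcx
          | succ i => exact hn1 i (by omega)
        · cases i with
          | zero => simpa using hx
          | succ i =>
            obtain ⟨h4, h5⟩ := hn3 i (by omega)
            refine ⟨h4, h5.trans ?_⟩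
            rw [add_mul]
            omega
  choose n hn h1 h2 h3 using fun a => key a _ (s a) (hinit a) le_rfl
  obtain ⟨qs, hqs⟩ := hs.size_le
  have hp : Poly (fun a => f^[n a] (s a)) := by
    refine iterate hc hf hs n (q + (qs + q * q)) (fun a => ?_) (fun a i hi => ?_) h1 h2
    · have := (hn a).trans (hμ a)
      simp only [Polynomial.eval_add]
      omega
    · have h4 := (h3 a i hi).2
      have h5 := hqs a
      have h6 := Nat.mul_le_mul_right (q.eval (sizeOfEnc a)) (hi.trans ((hn a).trans (hμ a)))
      simp only [Polynomial.eval_add, Polynomial.eval_mul]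
      omega
  convert hout.comp hp using 2 with a
  exact (hend a _ (h3 a _ le_rfl).1 (h2 a)).symm

/-- Flattening of trees by a recursion in which every node is replaced by a list of results and
subtrees. -/
theorem flatten {f : α → T → List τ} {ex : α → T → List (τ ⊕ T)}
    (hex : Poly (fun p : α × T => ex p.1 p.2))
    (hf : ∀ a t, f a t = (ex a t).flatMap (Sum.elim (fun x => [x]) (f a)))
    (hsize : ∀ a t,
      ((ex a t).map (Sum.elim (fun _ => 0) sizeOfEnc)).sum + 1 ≤ sizeOfEnc t) :
    Poly (fun p : α × T => f p.1 p.2) := by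
  obtain ⟨q, hq⟩ := hex.size_le
  let wt : List (τ ⊕ T) → ℕ := fun w => (w.map (Sum.elim (fun _ => 0) sizeOfEnc)).sum
  let em : List (τ ⊕ T) → ℕ := fun w => (w.map (Sum.elim (fun _ => 1) fun _ => 0)).sum
  have hem : ∀ w, em w ≤ w.length := by
    intro w
    induction w with
    | nil => simp [em]
    | cons x r ih => rcases x with x | x <;> simp [em] at ih ⊢ <;> omega
  let step : α × List (τ ⊕ T) × List τ → α × List (τ ⊕ T) × List τ := fun s => listCases s.2.1 s fun x r =>
    Sum.elim (fun y => (s.1, r, y :: s.2.2)) (fun t => (s.1, ex s.1 t ++ r, s.2.2)) x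
  have hstep : Poly step := by
    have : Poly (fun p : ((α × List (τ ⊕ T) × List τ) × (τ ⊕ T) × List (τ ⊕ T)) × T => ex p.1.1.1 p.2) :=
      hex.comp (f := fun p : ((α × List (τ ⊕ T) × List τ) × (τ ⊕ T) × List (τ ⊕ T)) × T => (p.1.1.1, p.2)) (by fun_prop)
    fun_prop
  refine while_of_measure (c := fun s : α × List (τ ⊕ T) × List τ => listCases s.2.1 false fun _ _ => true) (f := step)
    (s := fun p : α × T => (p.1, [Sum.inr p.2], [])) (out := fun s : α × List (τ ⊕ T) × List τ => s.2.2.reverse)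
    (by fun_prop) hstep (by fun_prop) (by fun_prop)
    (fun p s => s.1 = p.1 ∧ wt s.2.1 ≤ sizeOfEnc p.2 ∧
      s.2.2.reverse ++ s.2.1.flatMap (Sum.elim (fun x => [x]) (f p.1)) = f p.1 p.2)
    (fun p s => wt s.2.1 * (q.eval (sizeOfEnc p) + 1) + em s.2.1)
    (Polynomial.X * (q + 1) + q) ?_ ?_ ?_ ?_
  · rintro ⟨a, t⟩
    simp [wt]
  · rintro ⟨a, t⟩
    have h1 : sizeOfEnc t ≤ sizeOfEnc (a, t) := by rw [sizeOfEnc_prod]; omega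
    have := Nat.mul_le_mul_right (q.eval (sizeOfEnc (a, t)) + 1) h1
    simp only [wt, em, List.map_cons, List.map_nil, List.sum_cons, List.sum_nil, Sum.elim_inr,
      add_zero, Polynomial.eval_add, Polynomial.eval_mul, Polynomial.eval_X, Polynomial.eval_one]
    omega
  · rintro ⟨a, t⟩ ⟨a', w, out⟩ ⟨rfl, h2, h3⟩ hc
    rcases w with _ | ⟨y | u, r⟩
    · simp [listCases] at hc
    · have hs : step (a', Sum.inl y :: r, out) = (a', r, y :: out) := rfl
      rw [hs]
      refine ⟨⟨rfl, by simpa [wt] using h2, by simpa using h3⟩, by simp [wt, em], ?_⟩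
      simp only [sizeOfEnc_prod, sizeOfEnc_cons, sizeOfEnc_inl]
      omega
    · have hs : step (a', Sum.inr u :: r, out) = (a', ex a' u ++ r, out) := rfl
      rw [hs]
      have h4 := hsize a' u
      have h5 : sizeOfEnc u ≤ sizeOfEnc t := by
        simp only [wt, List.map_cons, List.sum_cons, Sum.elim_inr] at h2
        omega
      have h6 := hq (a', u)
      have h7 := eval_mono q (show sizeOfEnc (a', u) ≤ sizeOfEnc (a', t) by
        simp only [sizeOfEnc_prod]; omega)
      have h8 := (hem (ex a' u)).trans (length_le_sizeOfEnc _)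
      dsimp only at h6 h2 h3
      refine ⟨⟨rfl, ?_, ?_⟩, ?_, ?_⟩
      · simp only [wt, List.map_append, List.sum_append, List.map_cons, List.sum_cons,
          Sum.elim_inr] at h2 ⊢
        omega
      · rw [← h3, List.flatMap_append, ← hf]
        simp
      · simp only [wt, em, List.map_append, List.sum_append, List.map_cons, List.sum_cons,
          Sum.elim_inr] at h4 h8 ⊢
        have h9 := Nat.mul_le_mul_right (q.eval (sizeOfEnc (a', t)) + 1) h4
        simp only [add_mul] at h9 ⊢
        omega
      · have h9 := sizeOfEnc_append (ex a' u) r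
        simp only [sizeOfEnc_prod, sizeOfEnc_cons, sizeOfEnc_inr, Polynomial.eval_add] at h6 h7 ⊢
        omega
  · rintro ⟨a, t⟩ ⟨a', w, out⟩ ⟨rfl, h2, h3⟩ hc
    rcases w with _ | ⟨y, r⟩
    · simpa using h3
    · simp [listCases] at hc

end Poly
end

/- ## Assertions in postfix notation -/

/-- Tokens: the variables (operand stack, local variables, static fields, ghost variables), a datum
to be pushed, and the operation that combines the two topmost data to a pair. -/
abbrev Tok := ℕ ⊕ ℕ ⊕ SField ⊕ GVar ⊕ Option Data

namespace Tok
abbrev stack (i : ℕ) : Tok := .inl i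
abbrev loc (i : ℕ) : Tok := .inr (.inl i)
abbrev stat (x : SField) : Tok := .inr (.inr (.inl x))
abbrev ghost (g : GVar) : Tok := .inr (.inr (.inr (.inl g)))
abbrev push {α : Type} [Enc α] (a : α) : Tok := .inr (.inr (.inr (.inr (some (enc a)))))
abbrev mk : Tok := .inr (.inr (.inr (.inr none)))
end Tok

open Tok in
mutual
def Expr.toks : Expr → List Tok
  | .val v => [push (Expr.val v)]
  | .field e f => push 1 :: e.toks ++ [push f, mk, mk]
  | .stat x => [stat x]
  | .stack i => [stack i]
  | .loc i => [loc i]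
  | .ghost g => [ghost g]
  | .op o e₁ e₂ => push 6 :: push o :: e₁.toks ++ e₂.toks ++ [mk, mk, mk]
  | .cond a e₁ e₂ => push 7 :: a.toks ++ e₁.toks ++ e₂.toks ++ [mk, mk, mk]
  | .pair e₁ e₂ => push 8 :: e₁.toks ++ e₂.toks ++ [mk, mk]
  | .bot => [push Expr.bot]
def Assn.toks : Assn → List Tok
  | .tt => [push Assn.tt]
  | .ff => [push Assn.ff]
  | .rel r e₁ e₂ => push 0 :: push r :: e₁.toks ++ e₂.toks ++ [mk, mk, mk]
  | .and a b => push 1 :: a.toks ++ b.toks ++ [mk, mk]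
  | .not a => push 2 :: a.toks ++ [mk]
  | .inst e c => push 3 :: e.toks ++ [push c, mk, mk]
end

/-- Substitution of token lists for variables. -/
def substTok (s l : ℕ → List Tok) (x : SField → List Tok) (g : GVar → List Tok) (t : Tok) :
    List Tok :=
  Sum.elim s (fun u => Sum.elim l (fun u => Sum.elim x (fun u => Sum.elim g
    (fun d => [.inr (.inr (.inr (.inr d)))]) u) u) u) t

def substToks (s l : ℕ → List Tok) (x : SField → List Tok) (g : GVar → List Tok)
    (ts : List Tok) : List Tok :=
  ts.flatMap (substTok s l x g)

section
variable (θ : Subst)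

mutual
theorem Expr.toks_subst (e : Expr) : (e.subst θ).toks = substToks (fun i => (θ.stack i).toks)
    (fun i => (θ.loc i).toks) (fun x => (θ.stat x).toks) (fun g => (θ.ghost g).toks) e.toks := by
  cases e with
  | field e f => simp [Expr.subst, Expr.toks, Expr.toks_subst e, substToks, substTok]
  | op o e₁ e₂ =>
    simp [Expr.subst, Expr.toks, Expr.toks_subst e₁, Expr.toks_subst e₂, substToks, substTok]
  | cond a e₁ e₂ =>
    simp [Expr.subst, Expr.toks, Assn.toks_subst a, Expr.toks_subst e₁, Expr.toks_subst e₂,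
      substToks, substTok]
  | pair e₁ e₂ =>
    simp [Expr.subst, Expr.toks, Expr.toks_subst e₁, Expr.toks_subst e₂, substToks, substTok]
  | _ => simp [Expr.subst, Expr.toks, substToks, substTok]
theorem Assn.toks_subst (a : Assn) : (a.subst θ).toks = substToks (fun i => (θ.stack i).toks)
    (fun i => (θ.loc i).toks) (fun x => (θ.stat x).toks) (fun g => (θ.ghost g).toks) a.toks := by
  cases a with
  | rel r e₁ e₂ =>
    simp [Assn.subst, Assn.toks, Expr.toks_subst e₁, Expr.toks_subst e₂, substToks, substTok]
  | and a b =>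
    simp [Assn.subst, Assn.toks, Assn.toks_subst a, Assn.toks_subst b, substToks, substTok]
  | not a => simp [Assn.subst, Assn.toks, Assn.toks_subst a, substToks, substTok]
  | inst e c => simp [Assn.subst, Assn.toks, Expr.toks_subst e, substToks, substTok]
  | _ => simp [Assn.subst, Assn.toks, substToks, substTok]
end
end

/-- The effect of a token on a stack of data. -/
def parseStep (st : List Data) (t : Tok) : List Data :=
  Sum.elim (fun i => enc (Expr.stack i) :: st) (fun u => Sum.elim (fun i => enc (Expr.loc i) :: st)
    (fun u => Sum.elim (fun x => enc (Expr.stat x) :: st) (fun u => Sum.elim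
      (fun g => enc (Expr.ghost g) :: st) (fun d => d.elim
        (Poly.listCases st [] fun b r => Poly.listCases r [] fun a r => Data.pair a b :: r)
        fun d => d :: st) u) u) u) t

mutual
theorem Expr.parse_toks (e : Expr) (st : List Data) :
    e.toks.foldl parseStep st = enc e :: st := by
  cases e with
  | field e f =>
    simp only [Expr.toks, List.foldl_cons, List.cons_append, List.foldl_append]
    rw [Expr.parse_toks e]
    rfl
  | op o e₁ e₂ =>
    simp only [Expr.toks, List.foldl_cons, List.cons_append, List.foldl_append]
    rw [Expr.parse_toks e₁, Expr.parse_toks e₂]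
    rfl
  | cond a e₁ e₂ =>
    simp only [Expr.toks, List.foldl_cons, List.cons_append, List.foldl_append]
    rw [Assn.parse_toks a, Expr.parse_toks e₁, Expr.parse_toks e₂]
    rfl
  | pair e₁ e₂ =>
    simp only [Expr.toks, List.foldl_cons, List.cons_append, List.foldl_append]
    rw [Expr.parse_toks e₁, Expr.parse_toks e₂]
    rfl
  | _ => rfl
theorem Assn.parse_toks (a : Assn) (st : List Data) :
    a.toks.foldl parseStep st = enc a :: st := by
  cases a with
  | rel r e₁ e₂ =>
    simp only [Assn.toks, List.foldl_cons, List.cons_append, List.foldl_append]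
    rw [Expr.parse_toks e₁, Expr.parse_toks e₂]
    rfl
  | and a b =>
    simp only [Assn.toks, List.foldl_cons, List.cons_append, List.foldl_append]
    rw [Assn.parse_toks a, Assn.parse_toks b]
    rfl
  | not a =>
    simp only [Assn.toks, List.foldl_cons, List.cons_append, List.foldl_append]
    rw [Assn.parse_toks a]
    rfl
  | inst e c =>
    simp only [Assn.toks, List.foldl_cons, List.cons_append, List.foldl_append]
    rw [Expr.parse_toks e]
    rfl
  | _ => rfl
end

namespace Poly
section
variable {α β γ τ σ T : Type} [Enc α] [Enc β] [Enc γ] [Enc τ] [Enc σ] [Enc T]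

@[fun_prop]
theorem node {k : ℕ} {f : α → β} (hf : Poly f) : Poly (fun a => IRM.node k (enc (f a))) :=
  of_enc_eq ((const k).prodMk hf) fun _ => rfl

@[fun_prop]
theorem encode {f : α → β} (hf : Poly f) : Poly (fun a => (enc (f a) : Data)) := toData.comp hf

@[fun_prop]
theorem dataPair {f g : α → Data} (hf : Poly f) (hg : Poly g) : Poly (fun a => (f a).pair (g a)) :=
  of_enc_eq (hf.prodMk hg) fun _ => rfl

@[fun_prop]
theorem substToks {s l : α → ℕ → List Tok} {x : α → SField → List Tok} {g : α → GVar → List Tok}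
    {ts : α → List Tok} (hs : Poly (fun p : α × ℕ => s p.1 p.2))
    (hl : Poly (fun p : α × ℕ => l p.1 p.2)) (hx : Poly (fun p : α × SField => x p.1 p.2))
    (hg : Poly (fun p : α × GVar => g p.1 p.2)) (ht : Poly ts) :
    Poly (fun a => substToks (s a) (l a) (x a) (g a) (ts a)) := by
  have h1 : Poly (fun p : (α × Tok) × ℕ => s p.1.1 p.2) :=
    hs.comp (f := fun p : (α × Tok) × ℕ => (p.1.1, p.2)) (by fun_prop)
  have h2 : ∀ {β : Type} [Enc β], Poly (fun p : ((α × Tok) × β) × ℕ => l p.1.1.1 p.2) :=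
    fun {β} _ => hl.comp (f := fun p : ((α × Tok) × β) × ℕ => (p.1.1.1, p.2)) (by fun_prop)
  have h3 : ∀ {β γ : Type} [Enc β] [Enc γ],
      Poly (fun p : (((α × Tok) × β) × γ) × SField => x p.1.1.1.1 p.2) :=
    fun {β γ} _ _ => hx.comp (f := fun p : (((α × Tok) × β) × γ) × SField => (p.1.1.1.1, p.2))
      (by fun_prop)
  have h4 : ∀ {β γ δ : Type} [Enc β] [Enc γ] [Enc δ],
      Poly (fun p : ((((α × Tok) × β) × γ) × δ) × GVar => g p.1.1.1.1.1 p.2) :=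
    fun {β γ δ} _ _ _ => hg.comp
      (f := fun p : ((((α × Tok) × β) × γ) × δ) × GVar => (p.1.1.1.1.1, p.2)) (by fun_prop)
  unfold IRM.substToks substTok
  fun_prop

@[fun_prop]
theorem exprStack {f : α → ℕ} (hf : Poly f) : Poly (fun a => Expr.stack (f a)) :=
  of_enc_eq (node (k := 3) hf) fun _ => rfl

@[fun_prop]
theorem exprLoc {f : α → ℕ} (hf : Poly f) : Poly (fun a => Expr.loc (f a)) :=
  of_enc_eq (node (k := 4) hf) fun _ => rfl

@[fun_prop]
theorem exprStat {f : α → SField} (hf : Poly f) : Poly (fun a => Expr.stat (f a)) :=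
  of_enc_eq (node (k := 2) hf) fun _ => rfl

@[fun_prop]
theorem exprGhost {f : α → GVar} (hf : Poly f) : Poly (fun a => Expr.ghost (f a)) :=
  of_enc_eq (node (k := 5) hf) fun _ => rfl

/-- The assertions that a function returns may be computed in postfix notation. -/
theorem parse : Poly (fun ts : List Tok => (ts.foldl parseStep []).headD (.num 0)) := by
  have : Poly (fun ts : List Tok => ts.foldl parseStep []) := by
    refine foldl_of_add (g := fun _ st t => parseStep st t) ?_ id (const []) (Polynomial.X + 10)
      fun a st t => ?_
    · unfold parseStep
      fun_prop
    · have hn : ∀ (k : ℕ) (d : Data), sizeOfEnc (IRM.node k d) = sizeOfEnc (k, d) := fun _ _ => rfl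
      have hk : ∀ k ≤ 7, sizeOfEnc k ≤ 8 := fun k hk => (sizeOfEnc_nat_le k).trans (by omega)
      have h2 := hk 2 (by omega)
      have h3 := hk 3 (by omega)
      have h4 := hk 4 (by omega)
      have h5 := hk 5 (by omega)
      have hE : ∀ {β : Type} [Enc β] (x : β), sizeOfEnc (enc x : Data) = sizeOfEnc x :=
        fun _ => rfl
      simp only [Polynomial.eval_add, Polynomial.eval_X, Polynomial.eval_ofNat]
      rcases t with i | i | x | g | _ | d
      · show sizeOfEnc (IRM.node 3 (enc i) :: st) ≤ _
        simp only [sizeOfEnc_cons, hn, hE, sizeOfEnc_prod, sizeOfEnc_inl]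
        omega
      · show sizeOfEnc (IRM.node 4 (enc i) :: st) ≤ _
        simp only [sizeOfEnc_cons, hn, hE, sizeOfEnc_prod, sizeOfEnc_inl, sizeOfEnc_inr]
        omega
      · show sizeOfEnc (IRM.node 2 (enc x) :: st) ≤ _
        simp only [sizeOfEnc_cons, hn, hE, sizeOfEnc_prod, sizeOfEnc_inl, sizeOfEnc_inr]
        omega
      · show sizeOfEnc (IRM.node 5 (enc g) :: st) ≤ _
        simp only [sizeOfEnc_cons, hn, hE, sizeOfEnc_prod, sizeOfEnc_inl, sizeOfEnc_inr]
        omega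
      · have h1 := one_le_sizeOfEnc st
        rcases st with _ | ⟨b, _ | ⟨a, r⟩⟩
        · show sizeOfEnc ([] : List Data) ≤ _
          omega
        · show sizeOfEnc ([] : List Data) ≤ _
          rw [sizeOfEnc_nil]
          omega
        · show sizeOfEnc (Data.pair a b :: r) ≤ _
          have : sizeOfEnc (Data.pair a b) = sizeOfEnc (a, b) := rfl
          simp only [sizeOfEnc_cons, this, sizeOfEnc_prod]
          omega
      · show sizeOfEnc (d :: st) ≤ _
        simp only [sizeOfEnc_cons, sizeOfEnc_inr, sizeOfEnc_some]
        omega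
  fun_prop

theorem assnList_of_toks {f : α → List Assn} (hf : Poly fun a => (f a).map Assn.toks) :
    Poly f := by
  have := map (f := fun _ ts => (List.foldl parseStep [] ts).headD (.num 0)) (parse.comp (snd id)) hf
  refine of_enc_eq this fun a => ?_
  induction f a with
  | nil => rfl
  | cons x r ih =>
    simp only [List.map_cons, Assn.parse_toks] at ih ⊢
    show Data.pair _ _ = Data.pair _ _
    exact congrArg _ ih

end
end Poly

end IRM

namespace IRM

/- ## Substitutions -/

theorem Subst.ext' {θ η : Subst} (h₁ : ∀ i, θ.stack i = η.stack i) (h₂ : ∀ i, θ.loc i = η.loc i)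
    (h₃ : ∀ x, θ.stat x = η.stat x) (h₄ : ∀ g, θ.ghost g = η.ghost g) : θ = η := by
  cases θ; cases η
  simp only [Subst.mk.injEq]
  exact ⟨funext h₁, funext h₂, funext h₃, funext h₄⟩

/-- Composition of substitutions: first `θ`, then `η` in the result. -/
def Subst.comp (θ η : Subst) : Subst where
  stack i := (θ.stack i).subst η
  loc i := (θ.loc i).subst η
  stat x := (θ.stat x).subst η
  ghost g := (θ.ghost g).subst η

mutual
theorem Expr.subst_subst (θ η : Subst) (e : Expr) :
    (e.subst θ).subst η = e.subst (θ.comp η) := by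
  cases e with
  | field e f => simp [Expr.subst, Expr.subst_subst θ η e]
  | op o e₁ e₂ => simp [Expr.subst, Expr.subst_subst θ η e₁, Expr.subst_subst θ η e₂]
  | cond a e₁ e₂ =>
    simp [Expr.subst, Assn.subst_subst θ η a, Expr.subst_subst θ η e₁, Expr.subst_subst θ η e₂]
  | pair e₁ e₂ => simp [Expr.subst, Expr.subst_subst θ η e₁, Expr.subst_subst θ η e₂]
  | _ => simp [Expr.subst, Subst.comp]
theorem Assn.subst_subst (θ η : Subst) (a : Assn) :
    (a.subst θ).subst η = a.subst (θ.comp η) := by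
  cases a with
  | rel r e₁ e₂ => simp [Assn.subst, Expr.subst_subst θ η e₁, Expr.subst_subst θ η e₂]
  | and a b => simp [Assn.subst, Assn.subst_subst θ η a, Assn.subst_subst θ η b]
  | not a => simp [Assn.subst, Assn.subst_subst θ η a]
  | inst e c => simp [Assn.subst, Expr.subst_subst θ η e]
  | _ => simp [Assn.subst]
end

mutual
theorem Expr.subst_id (e : Expr) : e.subst {} = e := by
  cases e with
  | field e f => simp [Expr.subst, Expr.subst_id e]
  | op o e₁ e₂ => simp [Expr.subst, Expr.subst_id e₁, Expr.subst_id e₂]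
  | cond a e₁ e₂ => simp [Expr.subst, Assn.subst_id a, Expr.subst_id e₁, Expr.subst_id e₂]
  | pair e₁ e₂ => simp [Expr.subst, Expr.subst_id e₁, Expr.subst_id e₂]
  | _ => simp [Expr.subst]
theorem Assn.subst_id (a : Assn) : a.subst {} = a := by
  cases a with
  | rel r e₁ e₂ => simp [Assn.subst, Expr.subst_id e₁, Expr.subst_id e₂]
  | and a b => simp [Assn.subst, Assn.subst_id a, Assn.subst_id b]
  | not a => simp [Assn.subst, Assn.subst_id a]
  | inst e c => simp [Assn.subst, Expr.subst_id e]
  | _ => simp [Assn.subst]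
end

theorem Assn.push_shift (e : Expr) (a : Assn) : (a.shift 1).push e = a := by
  unfold Assn.push Assn.shift
  rw [Assn.subst_subst]
  conv_rhs => rw [← Assn.subst_id a]
  congr 1

/-- The environment in which a substituted expression is to be read. -/
noncomputable def Env.subst (I : Interp) (T : Hierarchy) (ρ : Env) (θ : Subst) : Env where
  heap := ρ.heap
  stat x := (θ.stat x).eval I T ρ
  stack i := (θ.stack i).eval I T ρ
  loc i := (θ.loc i).eval I T ρ
  ghost g := (θ.ghost g).eval I T ρ

section
variable (I : Interp) (T : Hierarchy) (ρ : Env) (θ : Subst)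

mutual
theorem Expr.eval_subst (e : Expr) : (e.subst θ).eval I T ρ = e.eval I T (ρ.subst I T θ) := by
  cases e with
  | field e f => simp [Expr.subst, Expr.eval, Expr.eval_subst e, Env.subst]
  | op o e₁ e₂ => simp [Expr.subst, Expr.eval, Expr.eval_subst e₁, Expr.eval_subst e₂]
  | cond a e₁ e₂ =>
    simp only [Expr.subst, Expr.eval, Expr.eval_subst e₁, Expr.eval_subst e₂]
    rw [propext (Assn.holds_subst a)]
  | pair e₁ e₂ => simp [Expr.subst, Expr.eval, Expr.eval_subst e₁, Expr.eval_subst e₂]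
  | _ => simp [Expr.subst, Expr.eval, Env.subst]
theorem Assn.holds_subst (a : Assn) :
    (a.subst θ).holds I T ρ ↔ a.holds I T (ρ.subst I T θ) := by
  cases a with
  | rel r e₁ e₂ => simp [Assn.subst, Assn.holds, Expr.eval_subst e₁, Expr.eval_subst e₂]
  | and a b => simp [Assn.subst, Assn.holds, Assn.holds_subst a, Assn.holds_subst b]
  | not a => simp [Assn.subst, Assn.holds, Assn.holds_subst a]
  | inst e c => simp [Assn.subst, Assn.holds, Expr.eval_subst e, Env.subst]
  | _ => simp [Assn.subst, Assn.holds]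
end

theorem Assn.holds_ite (a b c : Assn) : (Assn.ite a b c).holds I T ρ ↔
    (a.holds I T ρ → b.holds I T ρ) ∧ (¬ a.holds I T ρ → c.holds I T ρ) := by
  simp only [Assn.ite, Assn.imp, Assn.holds]
  tauto

theorem Assn.holds_conj (l : List Assn) :
    (Assn.conj l).holds I T ρ ↔ ∀ a ∈ l, a.holds I T ρ := by
  induction l with
  | nil => simp [Assn.conj, Assn.holds]
  | cons a r ih => simp [Assn.conj, Assn.holds, ih]

theorem Assn.holds_eq (e₁ e₂ : Expr) :
    (Assn.eq e₁ e₂).holds I T ρ ↔ e₁.eval I T ρ = e₂.eval I T ρ := by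
  simp [Assn.eq, Assn.holds, holdsRel]

end

/- ## Weakest preconditions of inlined code -/

/-- The weakest precondition of an instruction in terms of the assertion at the next one. -/
def Instr.step (i : Instr) (A : Assn) : Assn :=
  match i with
  | .aload n => A.push (.loc n)
  | .astore n => (A.shift 1).subst { loc := fun i => if i = n then .stack 0 else .loc i }
  | .instanceof c => A.setTop (.cond (.inst (.stack 0) c) (.int 1) (.int 0))
  | .getfield f => A.setTop (.field (.stack 0) f)
  | .getstatic x => A.push (.stat x)
  | .putstatic x => (A.shift 1).subst { stat := fun y => if y = x then .stack 0 else .stat y }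
  | .iconst n => A.push (.int n)
  | .ldc v => A.push (.val (.lit v))
  | .prim o => A.setTop₂ (.op o (.stack 1) (.stack 0))
  | .cmp r => A.setTop₂ (.cond (.rel r (.stack 1) (.stack 0)) (.int 1) (.int 0))
  | .ghost u => A.subst (ghostSubst u)
  | _ => A

/-- The weakest precondition of code without jumps. -/
def stepsWp (is : List Instr) (A : Assn) : Assn := is.foldr Instr.step A

/-- The weakest preconditions of the instructions of code without jumps. -/
def stepsAnns (is : List Instr) (A : Assn) : List Assn :=
  match is with
  | [] => []
  | i :: r => stepsWp (i :: r) A :: stepsAnns r A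

theorem stepsWp_cons (i : Instr) (r : List Instr) (A : Assn) :
    stepsWp (i :: r) A = i.step (stepsWp r A) := rfl

theorem stepsWp_append (l r : List Instr) (A : Assn) :
    stepsWp (l ++ r) A = stepsWp l (stepsWp r A) := List.foldr_append

theorem length_stepsAnns (is : List Instr) (A : Assn) : (stepsAnns is A).length = is.length := by
  induction is with
  | nil => rfl
  | cons i r ih => simp [stepsAnns, ih]

/-- Ghost variables replaced by the copies that the inlined code keeps. -/
def locSubst (F : Frame) : Subst where
  stack := fun _ => .loc F.resReg
  ghost := fun g => match g with
    | .ms x => .stat (.sec x)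
    | .tgt => .loc F.base
    | .arg i => .loc (F.argReg i)

/-- The value of a contract expression in terms of the variables of the inlined code. -/
def CExpr.toLoc (F : Frame) (e : CExpr) : Expr := e.toGhost.subst (locSubst F)

theorem CExpr.toLoc_subst (F : Frame) (e : CExpr) (θ : Subst) (h₁ : θ.loc = .loc)
    (h₂ : θ.stat = .stat) : (e.toLoc F).subst θ = e.toLoc F := by
  unfold CExpr.toLoc
  induction e with
  | field e f ih => simp [CExpr.toGhost, Expr.subst, ih]
  | op o a b iha ihb => simp [CExpr.toGhost, Expr.subst, iha, ihb]
  | rel r a b iha ihb => simp [CExpr.toGhost, Expr.subst, Assn.subst, Expr.int, iha, ihb]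
  | _ => simp [CExpr.toGhost, Expr.subst, locSubst, h₁, h₂]

theorem stepsWp_compile (F : Frame) (e : CExpr) (A : Assn) :
    stepsWp (e.compile F) A = A.push (e.toLoc F) := by
  induction e generalizing A with
  | field e f ih =>
    rw [CExpr.compile, stepsWp_append, ih]
    simp only [stepsWp, List.foldr_cons, List.foldr_nil, Instr.step, Assn.push, Assn.setTop]
    rw [Assn.subst_subst]
    congr 1
    refine Subst.ext' (fun i => ?_) (fun _ => rfl) (fun _ => rfl) fun _ => rfl
    cases i <;> rfl
  | op o a b iha ihb =>
    rw [CExpr.compile, stepsWp_append, stepsWp_append, iha, ihb]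
    simp only [stepsWp, List.foldr_cons, List.foldr_nil, Instr.step, Assn.push, Assn.setTop₂]
    rw [Assn.subst_subst, Assn.subst_subst]
    congr 1
    refine Subst.ext' (fun i => ?_) (fun _ => rfl) (fun _ => rfl) fun _ => rfl
    rcases i with _ | i
    · simp only [Subst.comp, Expr.subst]
      rw [CExpr.toLoc_subst F b _ rfl rfl]
      rfl
    · rfl
  | rel r a b iha ihb =>
    rw [CExpr.compile, stepsWp_append, stepsWp_append, iha, ihb]
    simp only [stepsWp, List.foldr_cons, List.foldr_nil, Instr.step, Assn.push, Assn.setTop₂]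
    rw [Assn.subst_subst, Assn.subst_subst]
    congr 1
    refine Subst.ext' (fun i => ?_) (fun _ => rfl) (fun _ => rfl) fun _ => rfl
    rcases i with _ | i
    · simp only [Subst.comp, Expr.subst, Assn.subst, Expr.int]
      rw [CExpr.toLoc_subst F b _ rfl rfl]
      rfl
    · rfl
  | _ => rfl

/-- The simultaneous assignment that an update performs on the security state class. -/
def updateSubst (F : Frame) (u : List (ℕ × CExpr)) : Subst where
  stat := fun y => match y with
    | .user c f => .stat (.user c f)
    | .sec x => ((u.lookup x).map (CExpr.toLoc F)).getD (.stat (.sec x))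

theorem stepsWp_compileUpdate (F : Frame) (u : List (ℕ × CExpr)) (D : Assn) :
    stepsWp (compileUpdate F u) D = D.subst (updateSubst F u) := by
  induction u generalizing D with
  | nil =>
    conv_lhs => rw [← Assn.subst_id D]
    show D.subst {} = _
    congr 1
    refine Subst.ext' (fun _ => rfl) (fun _ => rfl) (fun y => ?_) fun _ => rfl
    cases y <;> rfl
  | cons p r ih =>
    have h : compileUpdate F (p :: r) =
        p.2.compile F ++ (compileUpdate F r ++ [.putstatic (.sec p.1)]) := by
      simp [compileUpdate]
    rw [h, stepsWp_append, stepsWp_compile, stepsWp_append, ih]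
    simp only [stepsWp, List.foldr_cons, List.foldr_nil, Instr.step, Assn.push, Assn.shift]
    rw [Assn.subst_subst, Assn.subst_subst, Assn.subst_subst]
    congr 1
    refine Subst.ext' (fun i => rfl) (fun _ => rfl) (fun y => ?_) fun _ => rfl
    rcases y with ⟨c, f⟩ | x
    · rfl
    · by_cases hx : x = p.1
      · subst hx
        simp [Subst.comp, Expr.subst, updateSubst, List.lookup]
      · have hx' : (x == p.1) = false := by simpa using hx
        simp only [Subst.comp, Expr.subst, updateSubst, List.lookup, hx', SField.sec.injEq, hx,
          if_false]
        cases r.lookup x with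
        | none => rfl
        | some e =>
          simp only [Option.map_some, Option.getD_some]
          rw [CExpr.toLoc_subst F e _ rfl rfl]

/-- The weakest precondition of the conditional jump. -/
def ifeqWp (t n : Assn) : Assn :=
  Assn.ite (.eq (.stack 0) (.int 0)) (t.shift 1) (n.shift 1)

theorem push_ifeqWp (e : Expr) (t n : Assn) :
    (ifeqWp t n).push e = Assn.ite (.eq e (.int 0)) t n := by
  have h : ∀ a : Assn, (a.shift 1).push e = a := Assn.push_shift e
  unfold Assn.push at h
  simp only [ifeqWp, Assn.ite, Assn.imp, Assn.push, Assn.subst, Assn.eq, Expr.subst, Expr.int, h]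

/-- The assertion at the start of code for clauses that continues at the assertion `D`. -/
def clausesWp (F : Frame) (D : Assn) : List Clause → Assn
  | [] => .tt
  | cl :: r => Assn.ite (.eq (cl.guard.toLoc F) (.int 0)) (clausesWp F D r)
      (D.subst (updateSubst F cl.update))

/-- The assertions at the code for clauses. -/
def clausesAnns (F : Frame) (D : Assn) : List Clause → List Assn
  | [] => [.tt, .tt]
  | cl :: r =>
      let j := ifeqWp (clausesWp F D r) (D.subst (updateSubst F cl.update))
      stepsAnns (cl.guard.compile F) j ++ j :: stepsAnns (compileUpdate F cl.update) D ++
        D :: clausesAnns F D r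

def sectionWp (F : Frame) (D : Assn) : Option (List Clause) → Assn
  | none => D
  | some cls => clausesWp F D cls

def sectionAnns (F : Frame) (D : Assn) : Option (List Clause) → List Assn
  | none => [D]
  | some cls => clausesAnns F D cls

/-- The assertion at the start of the checks for an event, which continue at the assertion `D`. -/
def checksWp (C : Contract) (ev : Event) (m : MethodId) (F : Frame) (D : Assn) :
    List (Option ℕ × ℕ) → Assn
  | [] => D
  | (none, d) :: _ => sectionWp F D (C.clauses ev d m)
  | (some t, d) :: r =>
      Assn.ite (.eq (.cond (.inst (.loc F.base) t) (.int 1) (.int 0)) (.int 0))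
        (checksWp C ev m F D r) (sectionWp F D (C.clauses ev d m))

/-- The assertions at the checks for an event. -/
def checksAnns (C : Contract) (ev : Event) (m : MethodId) (F : Frame) (D : Assn) :
    List (Option ℕ × ℕ) → List Assn
  | [] => []
  | (none, d) :: r => sectionAnns F D (C.clauses ev d m) ++ checksAnns C ev m F D r
  | (some t, d) :: r =>
      let s := C.clauses ev d m
      let j := ifeqWp (checksWp C ev m F D r) (sectionWp F D s)
      stepsAnns [.aload F.base, .instanceof t] j ++ j :: sectionAnns F D s ++
        checksAnns C ev m F D r

/-- The substitution performed by code that saves operands in local variables. -/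
def saveSubst (F : Frame) : Subst where
  loc := fun v =>
    if F.base < v ∧ v ≤ F.base + F.nargs then .stack (F.nargs - (v - F.base))
    else if F.hasTarget ∧ v = F.base then .stack F.nargs
    else .loc v

theorem stepsWp_stores (F : Frame) (n : ℕ) (A : Assn) :
    stepsWp ((List.range n).reverse.map fun i => .astore (F.argReg i)) A =
      A.subst { stack := fun j => .stack (j + n), loc := fun v =>
        if F.base < v ∧ v ≤ F.base + n then .stack (n - (v - F.base)) else .loc v } := by
  induction n generalizing A with
  | zero =>
    conv_lhs => rw [← Assn.subst_id A]
    show A.subst {} = _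
    congr 1
    refine Subst.ext' (fun _ => rfl) (fun v => ?_) (fun _ => rfl) fun _ => rfl
    dsimp only
    rw [if_neg (by omega)]
  | succ n ih =>
    simp only [List.range_succ, List.reverse_append, List.reverse_cons, List.reverse_nil,
      List.nil_append, List.cons_append, List.map_cons, stepsWp_cons]
    rw [ih]
    simp only [Instr.step, Assn.shift]
    rw [Assn.subst_subst, Assn.subst_subst]
    congr 1
    refine Subst.ext' (fun _ => rfl) (fun v => ?_) (fun _ => rfl) fun _ => rfl
    simp only [Subst.comp]
    by_cases h : F.base < v ∧ v ≤ F.base + n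
    · rw [if_pos h, if_pos (by omega)]
      simp only [Expr.subst]
      congr 1
      omega
    · rw [if_neg h]
      simp only [Expr.subst]
      by_cases h' : v = F.argReg n
      · rw [if_pos h', if_pos (by unfold Frame.argReg at h'; omega)]
        congr 1
        unfold Frame.argReg at h'
        omega
      · rw [if_neg h', if_neg (by unfold Frame.argReg at h'; omega)]

theorem stepsWp_loads (F : Frame) (n : ℕ) (A : Assn) :
    stepsWp ((List.range n).map fun i => .aload (F.argReg i)) A =
      A.subst { stack := fun j =>
        if j < n then .loc (F.argReg (n - 1 - j)) else .stack (j - n) } := by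
  induction n generalizing A with
  | zero =>
    conv_lhs => rw [← Assn.subst_id A]
    show A.subst {} = _
    congr 1
  | succ n ih =>
    rw [List.range_succ, List.map_append, stepsWp_append, ih]
    simp only [stepsWp, List.map_cons, List.map_nil, List.foldr_cons, List.foldr_nil, Instr.step,
      Assn.push]
    rw [Assn.subst_subst]
    congr 1
    refine Subst.ext' (fun j => ?_) (fun _ => rfl) (fun _ => rfl) fun _ => rfl
    rcases j with _ | j
    · simp [Subst.comp, Expr.subst]
    · simp only [Subst.comp, Expr.subst]
      by_cases h : j < n
      · rw [if_pos h, if_pos (by omega)]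
        congr 2
        omega
      · rw [if_neg h, if_neg (by omega)]
        congr 1
        omega

theorem stepsWp_saveCode (F : Frame) (A : Assn) :
    stepsWp (saveCode F) A = A.subst (saveSubst F) := by
  unfold saveCode
  rw [stepsWp_append, stepsWp_append, stepsWp_loads, stepsWp_stores]
  obtain ⟨base, n, b⟩ := F
  cases b
  · simp only [stepsWp, List.foldr_nil, Bool.false_eq_true, if_false]
    rw [Assn.subst_subst]
    congr 1
    refine Subst.ext' (fun j => ?_) (fun v => ?_) (fun _ => rfl) fun _ => rfl
    · simp only [Subst.comp, Frame.argReg, saveSubst]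
      split_ifs with h
      · simp only [Expr.subst]
        rw [if_pos (by omega)]
        congr 1
        omega
      · simp only [Expr.subst]
        congr 1
        omega
    · simp [Subst.comp, saveSubst, Expr.subst]
  · simp only [stepsWp, List.foldr_nil, List.foldr_cons, if_true, Instr.step, Assn.shift, Assn.push]
    rw [Assn.subst_subst, Assn.subst_subst, Assn.subst_subst, Assn.subst_subst]
    congr 1
    refine Subst.ext' (fun j => ?_) (fun v => ?_) (fun _ => rfl) fun _ => rfl
    · simp only [Subst.comp, Frame.argReg, saveSubst]
      split_ifs with h
      · simp only [Expr.subst]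
        rw [if_neg (by omega)]
        simp only [Expr.subst]
        rw [if_pos (by omega)]
        congr 1
        omega
      · simp only [Expr.subst]
        rcases Nat.exists_eq_add_of_le (Nat.not_lt.1 h) with ⟨i, rfl⟩
        rw [Nat.add_sub_cancel_left]
        rcases i with _ | i
        · simp [Expr.subst]
        · simp only [Expr.subst]
          congr 1
          omega
    · simp only [Subst.comp, saveSubst, Expr.subst]
      by_cases h : v = base
      · subst h
        simp [Expr.subst]
      · simp [Expr.subst, h]

/-- The assertions at the block that replaces an invocation, with its ghost updates. -/
def blockAnns (T : Hierarchy) (C : Contract) (base : ℕ) (k : InvokeKind) (c : ℕ) (m : MethodId) :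
    List Assn :=
  let F := callFrame base k m
  let ds := T.dispatch k c m
  let call := C.inv.and F.assn
  let bef := (ghostUpdate T C .before k c m).step call
  let args := (ghostArgs k m).step bef
  let aft := checksWp C .after m F C.inv ds
  C.inv :: (stepsAnns (saveCode F) (checksWp C .before m F args ds) ++
      checksAnns C .before m F args ds ++ [args]).tail ++
    [bef, call, call] ++ stepsAnns [.astore F.resReg, .aload F.resReg] aft ++ [aft, call] ++
    checksAnns C .exceptional m F C.inv ds ++ C.inv :: checksAnns C .after m F C.inv ds

end IRM

namespace IRM

open Enc (enc)

/- ## Operations on programs and contracts in polynomial time -/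

instance : Enc Frame := ⟨fun F => enc (F.base, F.nargs, F.hasTarget)⟩
instance : Enc ClassSig := ⟨fun s => enc (s.super, s.methods)⟩
instance : Enc Hierarchy := ⟨fun T => enc (T.api, T.client)⟩

def GVar.elim {β : Type} (f : ℕ → β) (b : β) (g : ℕ → β) : GVar → β
  | .ms x => f x
  | .tgt => b
  | .arg i => g i

def SField.elim {β : Type} (f : ℕ × ℕ → β) (g : ℕ → β) : SField → β
  | .user c x => f (c, x)
  | .sec x => g x

/-- Case distinction on contract expressions. -/
def CExpr.elim {β : Type} (l : Lit → β) (s p : ℕ → β) (r : β) (f : CExpr × ℕ → β)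
    (st : ℕ × ℕ → β) (op : ℕ × CExpr × CExpr → β) (rel : RelSym × CExpr × CExpr → β) : CExpr → β
  | .lit x => l x
  | .state x => s x
  | .param x => p x
  | .result => r
  | .field e x => f (e, x)
  | .static c x => st (c, x)
  | .op o a b => op (o, a, b)
  | .rel o a b => rel (o, a, b)

def Instr.asInvoke : Instr → Option (InvokeKind × ℕ × MethodId)
  | .invoke k c m => some (k, c, m)
  | _ => none

namespace Poly
section
variable {α β γ τ σ T : Type} [Enc α] [Enc β] [Enc γ] [Enc τ] [Enc σ] [Enc T]

@[fun_prop]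
theorem frameBase {f : α → Frame} (hf : Poly f) : Poly (fun a => (f a).base) :=
  of_enc_eq (fst (of_enc_eq (g := fun a => (f a)) hf
    (f := fun a => ((f a).base, (f a).nargs, (f a).hasTarget)) fun _ => rfl)) fun _ => rfl

@[fun_prop]
theorem frameNargs {f : α → Frame} (hf : Poly f) : Poly (fun a => (f a).nargs) :=
  fst (snd (of_enc_eq (g := fun a => (f a)) hf
    (f := fun a => ((f a).base, (f a).nargs, (f a).hasTarget)) fun _ => rfl))

@[fun_prop]
theorem frameArgReg {f : α → Frame} {i : α → ℕ} (hf : Poly f) (hi : Poly i) :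
    Poly (fun a => (f a).argReg (i a)) := by
  unfold Frame.argReg; fun_prop

@[fun_prop]
theorem frameResReg {f : α → Frame} (hf : Poly f) : Poly (fun a => (f a).resReg) := by
  unfold Frame.resReg; fun_prop

@[fun_prop]
theorem sigSuper {f : α → ClassSig} (hf : Poly f) : Poly (fun a => (f a).super) :=
  fst (of_enc_eq hf (f := fun a => ((f a).super, (f a).methods)) fun _ => rfl)

@[fun_prop]
theorem sigMethods {f : α → ClassSig} (hf : Poly f) : Poly (fun a => (f a).methods) :=
  snd (of_enc_eq hf (f := fun a => ((f a).super, (f a).methods)) fun _ => rfl)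

@[fun_prop]
theorem sigMk {f : α → Option ℕ} {g : α → List MethodId} (hf : Poly f) (hg : Poly g) :
    Poly (fun a => ClassSig.mk (f a) (g a)) := of_enc_eq (hf.prodMk hg) fun _ => rfl

@[fun_prop]
theorem hierarchyApi {f : α → Hierarchy} (hf : Poly f) : Poly (fun a => (f a).api) :=
  fst (of_enc_eq hf (f := fun a => ((f a).api, (f a).client)) fun _ => rfl)

@[fun_prop]
theorem hierarchyClient {f : α → Hierarchy} (hf : Poly f) : Poly (fun a => (f a).client) :=
  snd (of_enc_eq hf (f := fun a => ((f a).api, (f a).client)) fun _ => rfl)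

@[fun_prop]
theorem hierarchyMk {f g : α → List ClassSig} (hf : Poly f) (hg : Poly g) :
    Poly (fun a => Hierarchy.mk (f a) (g a)) := of_enc_eq (hf.prodMk hg) fun _ => rfl

@[fun_prop]
theorem programClasses {f : α → Program} (hf : Poly f) : Poly (fun a => (f a).classes) :=
  of_enc_eq hf fun _ => rfl

@[fun_prop]
theorem classSuper {f : α → ClassDef} (hf : Poly f) : Poly (fun a => (f a).super) :=
  fst (of_enc_eq hf (f := fun a => ((f a).super, (f a).methods)) fun _ => rfl)

@[fun_prop]
theorem classMethods {f : α → ClassDef} (hf : Poly f) : Poly (fun a => (f a).methods) :=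
  snd (of_enc_eq hf (f := fun a => ((f a).super, (f a).methods)) fun _ => rfl)

@[fun_prop]
theorem methodCode {f : α → MethodDef} (hf : Poly f) : Poly (fun a => (f a).code) :=
  fst (of_enc_eq hf (f := fun a => ((f a).code, (f a).handlers, (f a).maxLocals)) fun _ => rfl)

@[fun_prop]
theorem methodMaxLocals {f : α → MethodDef} (hf : Poly f) : Poly (fun a => (f a).maxLocals) :=
  snd (snd (of_enc_eq hf
    (f := fun a => ((f a).code, (f a).handlers, (f a).maxLocals)) fun _ => rfl))

@[fun_prop]
theorem clauseGuard {f : α → Clause} (hf : Poly f) : Poly (fun a => (f a).guard) :=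
  fst (of_enc_eq hf (f := fun a => ((f a).guard, (f a).update)) fun _ => rfl)

@[fun_prop]
theorem clauseUpdate {f : α → Clause} (hf : Poly f) : Poly (fun a => (f a).update) :=
  snd (of_enc_eq hf (f := fun a => ((f a).guard, (f a).update)) fun _ => rfl)

theorem ruleTuple {f : α → Rule} (hf : Poly f) :
    Poly (fun a => ((f a).event, (f a).cls, (f a).mth, (f a).clauses)) := of_enc_eq hf fun _ => rfl

@[fun_prop]
theorem ruleEvent {f : α → Rule} (hf : Poly f) : Poly (fun a => (f a).event) := fst (ruleTuple hf)

@[fun_prop]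
theorem ruleCls {f : α → Rule} (hf : Poly f) : Poly (fun a => (f a).cls) := fst (snd (ruleTuple hf))

@[fun_prop]
theorem ruleMth {f : α → Rule} (hf : Poly f) : Poly (fun a => (f a).mth) :=
  fst (snd (snd (ruleTuple hf)))

@[fun_prop]
theorem ruleClauses {f : α → Rule} (hf : Poly f) : Poly (fun a => (f a).clauses) :=
  snd (snd (snd (ruleTuple hf)))

@[fun_prop]
theorem contractInit {f : α → Contract} (hf : Poly f) : Poly (fun a => (f a).init) :=
  fst (of_enc_eq hf (f := fun a => ((f a).init, (f a).rules)) fun _ => rfl)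

@[fun_prop]
theorem contractRules {f : α → Contract} (hf : Poly f) : Poly (fun a => (f a).rules) :=
  snd (of_enc_eq hf (f := fun a => ((f a).init, (f a).rules)) fun _ => rfl)

@[fun_prop]
theorem eventEq {f g : α → Event} (hf : Poly f) (hg : Poly g) :
    Poly (fun a => decide (f a = g a)) := by
  have h : ∀ {f : α → Event}, Poly f → Poly (fun a => toNat (enc (f a))) :=
    fun hf => toNat_poly.comp (toData.comp hf)
  convert natEq (h hf) (h hg) using 3 with a
  cases f a <;> cases g a <;> simp [toNat, enc]

@[fun_prop]
theorem kindEq {f g : α → InvokeKind} (hf : Poly f) (hg : Poly g) :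
    Poly (fun a => decide (f a = g a)) := by
  have h : ∀ {f : α → InvokeKind}, Poly f → Poly (fun a => toNat (enc (f a))) :=
    fun hf => toNat_poly.comp (toData.comp hf)
  convert natEq (h hf) (h hg) using 3 with a
  cases f a <;> cases g a <;> simp [toNat, enc]

@[fun_prop]
theorem kindHasTarget {f : α → InvokeKind} (hf : Poly f) : Poly (fun a => (f a).hasTarget) := by
  have : Poly (fun a => !decide (f a = .static)) := by fun_prop
  convert this using 2 with a
  cases f a <;> rfl

@[fun_prop]
theorem methodIdEq {f g : α → MethodId} (hf : Poly f) (hg : Poly g) :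
    Poly (fun a => decide (f a = g a)) := by
  have : Poly (fun a => decide ((f a).1 = (g a).1) && decide ((f a).2 = (g a).2)) := by fun_prop
  convert this using 2 with a
  rw [← Bool.decide_and]
  simp only [Prod.ext_iff]

@[fun_prop]
theorem methodIdMem {f : α → MethodId} {l : α → List MethodId} (hf : Poly f) (hl : Poly l) :
    Poly (fun a => decide (f a ∈ l a)) := by
  have : Poly (fun a => (l a).any fun x => decide (f a = x)) := by fun_prop
  convert this using 2 with a
  rw [Bool.eq_iff_iff, decide_eq_true_iff, List.any_eq_true]
  simp

@[fun_prop]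
theorem natMem {f : α → ℕ} {l : α → List ℕ} (hf : Poly f) (hl : Poly l) :
    Poly (fun a => decide (f a ∈ l a)) := by
  have : Poly (fun a => (l a).any fun x => decide (f a = x)) := by fun_prop
  convert this using 2 with a
  rw [Bool.eq_iff_iff, decide_eq_true_iff, List.any_eq_true]
  simp

@[fun_prop]
theorem gvarMs {f : α → ℕ} (hf : Poly f) : Poly (fun a => GVar.ms (f a)) :=
  of_enc_eq (node (k := 0) hf) fun _ => rfl

@[fun_prop]
theorem gvarArg {f : α → ℕ} (hf : Poly f) : Poly (fun a => GVar.arg (f a)) :=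
  of_enc_eq (node (k := 1) hf) fun _ => rfl

@[fun_prop]
theorem sfieldUser {f g : α → ℕ} (hf : Poly f) (hg : Poly g) :
    Poly (fun a => SField.user (f a) (g a)) :=
  of_enc_eq (node (k := 0) (hf.prodMk hg)) fun _ => rfl

@[fun_prop]
theorem sfieldSec {f : α → ℕ} (hf : Poly f) : Poly (fun a => SField.sec (f a)) :=
  of_enc_eq (node (k := 1) hf) fun _ => rfl

@[fun_prop]
theorem valLit {f : α → Lit} (hf : Poly f) : Poly (fun a => Val.lit (f a)) :=
  of_enc_eq (node (k := 0) hf) fun _ => rfl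

@[fun_prop]
theorem exprVal {f : α → Val} (hf : Poly f) : Poly (fun a => Expr.val (f a)) :=
  of_enc_eq (node (k := 0) hf) fun _ => rfl

@[fun_prop]
theorem gvarElim {f : α → ℕ → β} {b : α → β} {g : α → ℕ → β} {x : α → GVar}
    (hf : Poly (fun p : α × ℕ => f p.1 p.2)) (hb : Poly b) (hg : Poly (fun p : α × ℕ => g p.1 p.2))
    (hx : Poly x) : Poly (fun a => GVar.elim (f a) (b a) (g a) (x a)) := by
  have h1 : Poly (GVar.elim Option.some none fun _ => none) :=
    of_untag 0 fun x => by cases x <;> rfl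
  have h2 : Poly (GVar.elim (fun _ => none) none Option.some) :=
    of_untag 1 fun x => by cases x <;> rfl
  have : Poly (fun a => (GVar.elim Option.some none (fun _ => none) (x a)).elim
      ((GVar.elim (fun _ => none) none Option.some (x a)).elim (b a) (g a)) (f a)) := by fun_prop
  convert this using 2 with a
  cases x a <;> rfl

@[fun_prop]
theorem sfieldElim {f : α → ℕ × ℕ → β} {g : α → ℕ → β} {x : α → SField}
    (hf : Poly (fun p : α × ℕ × ℕ => f p.1 p.2)) (hg : Poly (fun p : α × ℕ => g p.1 p.2))
    (hx : Poly x) : Poly (fun a => SField.elim (f a) (g a) (x a)) := by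
  have : Poly (fun a => Sum.elim (f a) (g a) ((x a).elim Sum.inl Sum.inr)) :=
    sumElim hf hg (of_enc_eq hx fun a => by cases x a <;> rfl)
  convert this using 2 with a
  cases x a <;> rfl

@[fun_prop]
theorem cexprElim {l : α → Lit → β} {s p : α → ℕ → β} {r : α → β} {f : α → CExpr × ℕ → β}
    {st : α → ℕ × ℕ → β} {op : α → ℕ × CExpr × CExpr → β} {rel : α → RelSym × CExpr × CExpr → β}
    {e : α → CExpr} (hl : Poly (fun p : α × Lit => l p.1 p.2))
    (hs : Poly (fun p : α × ℕ => s p.1 p.2)) (hp : Poly (fun q : α × ℕ => p q.1 q.2))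
    (hr : Poly r) (hf : Poly (fun p : α × CExpr × ℕ => f p.1 p.2))
    (hst : Poly (fun p : α × ℕ × ℕ => st p.1 p.2))
    (hop : Poly (fun p : α × ℕ × CExpr × CExpr => op p.1 p.2))
    (hrel : Poly (fun p : α × RelSym × CExpr × CExpr => rel p.1 p.2)) (he : Poly e) :
    Poly (fun a => (e a).elim (l a) (s a) (p a) (r a) (f a) (st a) (op a) (rel a)) := by
  have h0 : Poly (CExpr.elim Option.some (fun _ => none) (fun _ => none) none (fun _ => none)
    (fun _ => none) (fun _ => none) fun _ => none) := of_untag 0 fun x => by cases x <;> rfl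
  have h1 : Poly (CExpr.elim (fun _ => none) Option.some (fun _ => none) none (fun _ => none)
    (fun _ => none) (fun _ => none) fun _ => none) := of_untag 1 fun x => by cases x <;> rfl
  have h2 : Poly (CExpr.elim (fun _ => none) (fun _ => none) Option.some none (fun _ => none)
    (fun _ => none) (fun _ => none) fun _ => none) := of_untag 2 fun x => by cases x <;> rfl
  have h3 : Poly (CExpr.elim (fun _ => none) (fun _ => none) (fun _ => none) none Option.some
    (fun _ => none) (fun _ => none) fun _ => none) := of_untag 3 fun x => by cases x <;> rfl
  have h4 : Poly (CExpr.elim (fun _ => none) (fun _ => none) (fun _ => none) none (fun _ => none)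
    Option.some (fun _ => none) fun _ => none) := of_untag 4 fun x => by cases x <;> rfl
  have h5 : Poly (CExpr.elim (fun _ => none) (fun _ => none) (fun _ => none) none (fun _ => none)
    (fun _ => none) Option.some fun _ => none) := of_untag 5 fun x => by cases x <;> rfl
  have h6 : Poly (CExpr.elim (fun _ => none) (fun _ => none) (fun _ => none) none (fun _ => none)
    (fun _ => none) (fun _ => none) Option.some) := of_untag 6 fun x => by cases x <;> rfl
  have := optionElim hl (optionElim hs (optionElim hp (optionElim hf (optionElim hst (optionElim hop
    (optionElim hrel hr (h6.comp he)) (h5.comp he)) (h4.comp he)) (h3.comp he)) (h2.comp he))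
    (h1.comp he)) (h0.comp he)
  convert this using 2 with a
  cases e a <;> rfl

@[fun_prop]
theorem instrAsInvoke {i : α → Instr} (hi : Poly i) : Poly (fun a => (i a).asInvoke) := by
  have : Poly Instr.asInvoke := of_untag 13 fun i => by cases i <;> rfl
  exact this.comp hi

/- ### Class hierarchies -/

@[fun_prop]
theorem hierarchy {api : Api} {f : α → Program} (hf : Poly f) :
    Poly (fun a => (f a).hierarchy api) := by
  unfold Program.hierarchy Program.sigs
  fun_prop

@[fun_prop]
theorem hierarchyAll {f : α → Hierarchy} (hf : Poly f) : Poly (fun a => (f a).all) := by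
  unfold Hierarchy.all
  fun_prop

@[fun_prop]
theorem hierarchyDeclares {f : α → Hierarchy} {d : α → ℕ} {m : α → MethodId} (hf : Poly f)
    (hd : Poly d) (hm : Poly m) : Poly (fun a => (f a).declares (d a) (m a)) := by
  have : Poly (fun a => ((f a).all[d a]?).elim false fun s => decide (m a ∈ s.methods)) := by
    fun_prop
  convert this using 2 with a
  unfold Hierarchy.declares
  cases (f a).all[d a]? <;> rfl

@[fun_prop]
theorem hierarchyChain {f : α → Hierarchy} {c : α → ℕ} (hf : Poly f) (hc : Poly c) :
    Poly (fun a => (f a).chain (c a)) := by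
  let step : Hierarchy → Option ℕ × List ℕ → Option ℕ × List ℕ := fun T s =>
    s.1.elim s fun d => ((T.all[d]?).bind ClassSig.super, d :: s.2)
  have hnone : ∀ T (l : List ℕ) r, l.foldl (fun s _ => step T s) (none, r) = (none, r) := by
    intro T l r
    induction l with
    | nil => rfl
    | cons x l ih => exact ih
  have hstep : ∀ T (l : List ℕ) c r, ((0 :: l).foldl (fun s _ => step T s) (Option.some c, r)).2 =
      (T.chainAux l.length c).reverse ++ r := by
    intro T l
    induction l with
    | nil => intro c r; rfl
    | cons x l ih =>
      intro c r
      have h0 : step T (Option.some c, r) = ((T.all[c]?).bind ClassSig.super, c :: r) := rfl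
      rw [List.foldl_cons, h0, List.length_cons, Hierarchy.chainAux]
      cases h : (T.all[c]?).bind ClassSig.super with
      | none => rw [hnone]; simp
      | some d =>
        have := ih d (c :: r)
        rw [List.foldl_cons] at this ⊢
        exact this.trans (by simp)
  have hall : Poly Hierarchy.all := hierarchyAll id
  obtain ⟨q, hq⟩ := hall.size_le
  have hs : Poly (fun p : Hierarchy × (Option ℕ × List ℕ) × ℕ => step p.1 p.2.1) := by fun_prop
  have key : Poly (fun p : Hierarchy × ℕ =>
      (0 :: List.range p.1.all.length).foldl (fun s _ => step p.1 s) (Option.some p.2, [])) := by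
    refine foldl_of_add (g := fun (p : Hierarchy × ℕ) s _ => step p.1 s)
      (hs.comp (f := fun p : (Hierarchy × ℕ) × (Option ℕ × List ℕ) × ℕ => (p.1.1, p.2))
        (by fun_prop)) (by fun_prop) (by fun_prop) (q + 10) ?_
    rintro ⟨T, c⟩ ⟨o, l⟩ x
    cases o with
    | none => simp [step]
    | some d =>
      have h1 : sizeOfEnc ((T.all[d]?).bind ClassSig.super) ≤ q.eval (sizeOfEnc T) + 1 := by
        cases h : T.all[d]? with
        | none => rw [Option.bind_none, sizeOfEnc_none]; omega
        | some s =>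
          have h2 := sizeOfEnc_le_of_mem (List.mem_of_getElem? h)
          have h3 := hq T
          have : sizeOfEnc s = sizeOfEnc (s.super, s.methods) := rfl
          rw [sizeOfEnc_prod] at this
          rw [Option.bind_some]
          omega
      have h2 := eval_mono q (show sizeOfEnc T ≤ sizeOfEnc (T, c) + sizeOfEnc x by
        rw [sizeOfEnc_prod]; omega)
      simp only [step, Option.elim, sizeOfEnc_prod, sizeOfEnc_cons, sizeOfEnc_some,
        Polynomial.eval_add, Polynomial.eval_ofNat] at h2 ⊢
      omega
  have : Poly (fun a => ((0 :: List.range (f a).all.length).foldl (fun s _ => step (f a) s)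
      (Option.some (c a), [])).2.reverse) := (key.comp (hf.prodMk hc)).snd.reverse
  convert this using 2 with a
  rw [hstep, List.length_range]
  simp [Hierarchy.chain]

@[fun_prop]
theorem hierarchyDispatch {f : α → Hierarchy} {k : α → InvokeKind} {c : α → ℕ} {m : α → MethodId}
    (hf : Poly f) (hk : Poly k) (hc : Poly c) (hm : Poly m) :
    Poly (fun a => (f a).dispatch (k a) (c a) (m a)) := by
  have : Poly (fun a => bif decide (k a = .virtual) then
      ((List.range (f a).api.length).reverse.filter fun d => (f a).declares d (m a) &&
        (decide (d ∈ (f a).chain (c a)) || decide (c a ∈ (f a).chain d))).map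
          fun d => (Option.some d, d)
      else (((f a).chain (c a)).find? fun d => (f a).declares d (m a)).elim [] fun d =>
        if d < (f a).api.length then [(Option.none, d)] else []) := by
    fun_prop
  convert this using 2 with a
  unfold Hierarchy.dispatch
  cases k a
  · rfl
  · cases ((f a).chain (c a)).find? fun d => (f a).declares d (m a) <;> rfl
  · cases ((f a).chain (c a)).find? fun d => (f a).declares d (m a) <;> rfl

@[fun_prop]
theorem contractClauses {C : α → Contract} {ev : α → Event} {c : α → ℕ} {m : α → MethodId}
    (hC : Poly C) (hev : Poly ev) (hc : Poly c) (hm : Poly m) :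
    Poly (fun a => (C a).clauses (ev a) (c a) (m a)) := by
  unfold Contract.clauses
  fun_prop

end
end Poly
end IRM

namespace IRM

open Enc (enc)

/- ## The assertions of a block in polynomial time -/

theorem Expr.toks_ne_nil (e : Expr) : e.toks ≠ [] := by cases e <;> simp [Expr.toks]

/-- Straight-line operations: `inl (e, k)` replaces the topmost `k` operands by `e`; the other two
store the topmost operand in a local variable or static field. -/
abbrev SOp := (List Tok × ℕ) ⊕ ℕ ⊕ SField

def Instr.sop : Instr → SOp
  | .aload n => .inl ([.loc n], 0)
  | .astore n => .inr (.inl n)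
  | .instanceof c => .inl ((Expr.cond (.inst (.stack 0) c) (.int 1) (.int 0)).toks, 1)
  | .getfield f => .inl ((Expr.field (.stack 0) f).toks, 1)
  | .getstatic x => .inl ([.stat x], 0)
  | .putstatic x => .inr (.inr x)
  | .iconst n => .inl ((Expr.int n).toks, 0)
  | .ldc v => .inl ((Expr.val (.lit v)).toks, 0)
  | .prim o => .inl ((Expr.op o (.stack 1) (.stack 0)).toks, 2)
  | .cmp r => .inl ((Expr.cond (.rel r (.stack 1) (.stack 0)) (.int 1) (.int 0)).toks, 2)
  | _ => .inl ([.stack 0], 1)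

/-- The effect of a straight-line operation on an assertion in postfix notation. -/
def sopToks (o : SOp) (ts : List Tok) : List Tok :=
  Sum.elim
    (fun p => substToks (fun i => if i = 0 then p.1 else [.stack (i - 1 + p.2)])
      (fun i => [.loc i]) (fun x => [.stat x]) (fun g => [.ghost g]) ts)
    (Sum.elim
      (fun n => substToks (fun i => [.stack (i + 1)]) (fun i => if i = n then [.stack 0] else [.loc i])
        (fun x => [.stat x]) (fun g => [.ghost g]) ts)
      (fun y => substToks (fun i => [.stack (i + 1)]) (fun i => [.loc i])
        (fun x => if x = y then [.stack 0] else [.stat x]) (fun g => [.ghost g]) ts)) o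

theorem toks_top (A : Assn) (e : Expr) (k : ℕ) (s : ℕ → Expr) (h₀ : s 0 = e)
    (h₁ : ∀ j, s (j + 1) = .stack (j + k)) :
    (A.subst { stack := s }).toks = sopToks (.inl (e.toks, k)) A.toks := by
  rw [Assn.toks_subst]
  unfold sopToks
  simp only [Sum.elim_inl]
  congr 1
  funext i
  cases i with
  | zero => simp [h₀]
  | succ j => simp [h₁, Expr.toks]

theorem Instr.toks_step (i : Instr) (A : Assn) (hi : ∀ u, i ≠ .ghost u) :
    (i.step A).toks = sopToks i.sop A.toks := by
  have hid : A.toks = sopToks (.inl ([.stack 0], 1)) A.toks := by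
    have := toks_top A (.stack 0) 1 .stack rfl fun _ => rfl
    conv_lhs => rw [← Assn.subst_id A]
    exact this
  cases i with
  | ghost u => exact absurd rfl (hi u)
  | astore n =>
    simp only [Instr.step, Instr.sop, Assn.shift]
    rw [Assn.subst_subst, Assn.toks_subst]
    simp only [sopToks, Sum.elim_inr, Sum.elim_inl, Subst.comp, Expr.subst, Expr.toks]
    congr 1
    funext i
    split_ifs <;> rfl
  | putstatic y =>
    simp only [Instr.step, Instr.sop, Assn.shift]
    rw [Assn.subst_subst, Assn.toks_subst]
    simp only [sopToks, Sum.elim_inr, Subst.comp, Expr.subst, Expr.toks]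
    congr 1
    funext i
    split_ifs <;> rfl
  | aload n => exact toks_top _ _ _ _ rfl fun _ => rfl
  | instanceof c => exact toks_top _ _ _ _ rfl fun _ => rfl
  | getfield c => exact toks_top _ _ _ _ rfl fun _ => rfl
  | getstatic c => exact toks_top _ _ _ _ rfl fun _ => rfl
  | iconst c => exact toks_top _ _ _ _ rfl fun _ => rfl
  | ldc c => exact toks_top _ _ _ _ rfl fun _ => rfl
  | prim c => exact toks_top _ _ _ _ rfl fun _ => rfl
  | cmp c => exact toks_top _ _ _ _ rfl fun _ => rfl
  | _ => exact hid

theorem length_le_substToks {s l : ℕ → List Tok} {x : SField → List Tok} {g : GVar → List Tok}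
    (hs : ∀ i, s i ≠ []) (hl : ∀ i, l i ≠ []) (hx : ∀ i, x i ≠ []) (hg : ∀ i, g i ≠ [])
    (ts : List Tok) : ts.length ≤ (substToks s l x g ts).length := by
  induction ts with
  | nil => simp
  | cons t r ih =>
    have : 1 ≤ (substTok s l x g t).length := by
      rw [Nat.one_le_iff_ne_zero, Ne, List.length_eq_zero_iff]
      rcases t with i | i | i | i | i
      · exact hs i
      · exact hl i
      · exact hx i
      · exact hg i
      · simp [substTok]
    rw [substToks] at ih ⊢
    rw [List.flatMap_cons, List.length_append, List.length_cons]
    omega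

theorem length_le_sopToks (i : Instr) (ts : List Tok) :
    ts.length ≤ (sopToks i.sop ts).length := by
  have htop : ∀ (e : List Tok) k, e ≠ [] → ts.length ≤ (sopToks (.inl (e, k)) ts).length := by
    intro e k he
    refine length_le_substToks (fun i => ?_) ?_ ?_ ?_ ts
    · dsimp only
      split_ifs
      · exact he
      · simp
    all_goals simp
  have hst : ∀ n, ts.length ≤ (sopToks (.inr n) ts).length := by
    rintro (n | n)
    all_goals
      refine length_le_substToks ?_ ?_ ?_ ?_ ts <;> intro i <;> (try split_ifs) <;> simp
  cases i with
  | astore => exact hst _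
  | putstatic => exact hst _
  | _ => exact htop _ _ (by first | exact Expr.toks_ne_nil _ | simp)

theorem sizeOfEnc_sopToks_le {M : ℕ} (o : SOp) (ts : List Tok) (h : ∀ t ∈ ts, sizeOfEnc t ≤ M) :
    ∀ t ∈ sopToks o ts, sizeOfEnc t ≤ M + sizeOfEnc o + 10 := by
  have h1 : ∀ i n : ℕ, sizeOfEnc (Tok.stack (i + n)) ≤ sizeOfEnc (Tok.stack i) + sizeOfEnc n + 1 := by
    intro i n
    have := Poly.size_add_le i n
    simp only [sizeOfEnc_inl]
    simp only [sizeOfEnc, enc, Data.size]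
    omega
  have h2 : sizeOfEnc (Tok.stack 0) ≤ 3 := by
    simp only [sizeOfEnc_inl]
    simp [sizeOfEnc, enc, Data.size]
  have h3 : sizeOfEnc 1 ≤ 2 := by simp [sizeOfEnc, enc, Data.size]
  intro t ht
  rcases o with ⟨e, k⟩ | n | y
  · simp only [sopToks, Sum.elim_inl, substToks, List.mem_flatMap] at ht
    obtain ⟨u, hu, ht⟩ := ht
    have hM := h u hu
    rw [sizeOfEnc_inl, sizeOfEnc_prod]
    rcases u with i | i | i | i | i <;> simp only [substTok, Sum.elim_inl, Sum.elim_inr] at ht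
    · split_ifs at ht
      · have := sizeOfEnc_le_of_mem ht
        omega
      · rw [List.mem_singleton] at ht
        subst ht
        have h4 := h1 (i - 1) k
        have h5 : sizeOfEnc (Tok.stack (i - 1)) ≤ sizeOfEnc (Tok.stack i) := by
          simp only [sizeOfEnc_inl]
          exact Nat.add_le_add_right (sizeOfEnc_nat_mono (Nat.sub_le i 1)) _
        simp only [Tok.stack] at h4 h5 ⊢
        omega
    all_goals
      rw [List.mem_singleton] at ht
      subst ht
      exact hM.trans (by omega)
  · simp only [sopToks, Sum.elim_inr, Sum.elim_inl, substToks, List.mem_flatMap] at ht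
    obtain ⟨u, hu, ht⟩ := ht
    have hM := h u hu
    rcases u with i | i | i | i | i <;> simp only [substTok, Sum.elim_inl, Sum.elim_inr] at ht
    · rw [List.mem_singleton] at ht
      subst ht
      have h4 := h1 i 1
      simp only [Tok.stack] at h4 ⊢
      omega
    · split_ifs at ht <;> rw [List.mem_singleton] at ht <;> subst ht
      · simp only [Tok.stack] at h2 ⊢
        omega
      · simp only [Tok.loc]
        omega
    all_goals
      rw [List.mem_singleton] at ht
      subst ht
      exact hM.trans (by omega)
  · simp only [sopToks, Sum.elim_inr, substToks, List.mem_flatMap] at ht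
    obtain ⟨u, hu, ht⟩ := ht
    have hM := h u hu
    rcases u with i | i | i | i | i <;> simp only [substTok, Sum.elim_inl, Sum.elim_inr] at ht
    · rw [List.mem_singleton] at ht
      subst ht
      have h4 := h1 i 1
      simp only [Tok.stack] at h4 ⊢
      omega
    · rw [List.mem_singleton] at ht
      subst ht
      exact hM.trans (by omega)
    · split_ifs at ht <;> rw [List.mem_singleton] at ht <;> subst ht
      · simp only [Tok.stack] at h2 ⊢
        omega
      · simp only [Tok.stat]
        omega
    all_goals
      rw [List.mem_singleton] at ht
      subst ht
      exact hM.trans (by omega)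

namespace Poly
section
variable {α β γ τ σ T : Type} [Enc α] [Enc β] [Enc γ] [Enc τ] [Enc σ] [Enc T]

@[fun_prop]
theorem tokPush {f : α → β} (hf : Poly f) : Poly (fun a => Tok.push (f a)) := by
  unfold Tok.push
  fun_prop

@[fun_prop]
theorem sfieldEq {f g : α → SField} (hf : Poly f) (hg : Poly g) :
    Poly (fun a => decide (f a = g a)) := by
  have : Poly (fun a => (f a).elim
      (fun x => (g a).elim (fun y => decide (x.1 = y.1) && decide (x.2 = y.2)) fun _ => false)
      fun x => (g a).elim (fun _ => false) fun y => decide (x = y)) := by fun_prop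
  convert this using 2 with a
  cases f a <;> cases g a <;> simp [SField.elim]

@[fun_prop]
theorem sopToks {o : α → SOp} {ts : α → List Tok} (ho : Poly o) (ht : Poly ts) :
    Poly (fun a => sopToks (o a) (ts a)) := by
  unfold IRM.sopToks
  fun_prop

/-- All weakest preconditions of code without jumps, if that of the first instruction is known to be
of polynomial size. -/
theorem stepsAnns {is : α → List Instr} {A : α → Assn} (hi : Poly (fun a => (is a).map Instr.sop))
    (hA : Poly (fun a => (A a).toks)) (hg : ∀ a, ∀ i ∈ is a, ∀ u, i ≠ .ghost u)
    (h : ∃ q : Polynomial ℕ, ∀ a, (stepsWp (is a) (A a)).toks.length ≤ q.eval (sizeOfEnc a)) :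
    Poly (fun a => (stepsAnns (is a) (A a)).map Assn.toks) := by
  have hwp : ∀ (l : List Instr) A, (∀ i ∈ l, ∀ u, i ≠ .ghost u) →
      (stepsWp l A).toks = (l.map Instr.sop).foldr IRM.sopToks A.toks := by
    intro l A hl
    induction l with
    | nil => rfl
    | cons i r ih =>
      rw [stepsWp_cons, Instr.toks_step _ _ (hl i List.mem_cons_self),
        ih fun j hj => hl j (List.mem_cons_of_mem _ hj)]
      rfl
  have hanns : ∀ (l : List Instr) A, (∀ i ∈ l, ∀ u, i ≠ .ghost u) →
      (IRM.stepsAnns l A).map Assn.toks = (l.map Instr.sop).foldr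
        (fun o acc => IRM.sopToks o (acc.headD A.toks) :: acc) [] := by
    intro l A hl
    induction l with
    | nil => rfl
    | cons i r ih =>
      have hr : ∀ j ∈ r, ∀ u, j ≠ .ghost u := fun j hj => hl j (List.mem_cons_of_mem _ hj)
      have h1 := ih hr
      rw [List.map_cons, List.foldr_cons, ← h1, IRM.stepsAnns, List.map_cons, hwp _ _ hl,
        List.map_cons, List.foldr_cons, ← hwp _ _ hr]
      congr 2
      cases r <;> rfl
  have hlen : ∀ (l l' : List Instr) A, (∀ i ∈ l', ∀ u, i ≠ .ghost u) → l <:+ l' →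
      (stepsWp l A).toks.length ≤ (stepsWp l' A).toks.length := by
    rintro l l' A hl ⟨r, rfl⟩
    induction r with
    | nil => rfl
    | cons i r ih =>
      refine (ih fun j hj => hl j (List.mem_cons_of_mem _ hj)).trans ?_
      rw [List.cons_append, stepsWp_cons, Instr.toks_step _ _ (hl i List.mem_cons_self)]
      exact length_le_sopToks _ _
  have htok : ∀ (l : List Instr) A M N, (∀ i ∈ l, ∀ u, i ≠ .ghost u) →
      (∀ t ∈ A.toks, sizeOfEnc t ≤ M) → (∀ i ∈ l, sizeOfEnc i.sop ≤ N) →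
      ∀ t ∈ (stepsWp l A).toks, sizeOfEnc t ≤ M + l.length * (N + 10) := by
    intro l A M N hl hM
    induction l with
    | nil => exact fun _ t ht => (hM t ht).trans (Nat.le_add_right _ _)
    | cons i r ih =>
      intro hN t ht
      rw [stepsWp_cons, Instr.toks_step _ _ (hl i List.mem_cons_self)] at ht
      have h1 := sizeOfEnc_sopToks_le _ _ (ih (fun j hj => hl j (List.mem_cons_of_mem _ hj))
        fun j hj => hN j (List.mem_cons_of_mem _ hj)) t ht
      have h2 := hN i List.mem_cons_self
      rw [List.length_cons, add_mul]
      omega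
  obtain ⟨q, hq⟩ := h
  obtain ⟨qi, hqi⟩ := hi.size_le
  obtain ⟨qA, hqA⟩ := hA.size_le
  have key : Poly (fun a => ((is a).map Instr.sop).foldr
      (fun o acc => IRM.sopToks o (acc.headD (A a).toks) :: acc) []) := by
    have hs : Poly (fun p : α × SOp × List (List Tok) =>
        IRM.sopToks p.2.1 (p.2.2.headD (A p.1).toks) :: p.2.2) := by
      have : Poly (fun p : α × SOp × List (List Tok) => (A p.1).toks) := hA.comp (fst id)
      fun_prop
    refine foldr_of_bound (g := fun a o acc => IRM.sopToks o (acc.headD (A a).toks) :: acc) hs hi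
      (const []) (qi * (q * (qA + qi * (qi + 10) + 1) + 1 + 1) + 1) fun a l' hl' => ?_
    obtain ⟨r, hr⟩ := hl'
    obtain ⟨l₁, l₂, hl, rfl, rfl⟩ := List.map_eq_append_iff.1 hr.symm
    have hg' : ∀ i ∈ l₂, ∀ u, i ≠ .ghost u := fun i hi => hg a i (by rw [hl]; simp [hi])
    rw [← hanns _ _ hg']
    have hlen2 : l₂.length ≤ qi.eval (sizeOfEnc a) := by
      refine le_trans ?_ ((length_le_sizeOfEnc _).trans (hqi a))
      rw [List.length_map, hl, List.length_append]
      omega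
    have hel : ∀ l, l <:+ l₂ → sizeOfEnc (stepsWp l (A a)).toks ≤
        (q * (qA + qi * (qi + 10) + 1) + 1).eval (sizeOfEnc a) := by
      intro l hl3
      have hg3 : ∀ i ∈ l, ∀ u, i ≠ .ghost u := fun i hi => hg' i (hl3.subset hi)
      refine (sizeOfEnc_list_le (htok l (A a) (qA.eval (sizeOfEnc a)) (qi.eval (sizeOfEnc a)) hg3
        (fun t ht => (sizeOfEnc_le_of_mem ht).trans (hqA a)) fun i hi => ?_)).trans ?_
      · refine (sizeOfEnc_le_of_mem (List.mem_map_of_mem ?_)).trans (hqi a)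
        rw [hl]
        exact List.mem_append_right _ (hl3.subset hi)
      · have h1 : (stepsWp l (A a)).toks.length ≤ q.eval (sizeOfEnc a) :=
          (hlen l (is a) (A a) (hg a) (hl3.trans ⟨l₁, hl.symm⟩)).trans (hq a)
        have h2 := Nat.mul_le_mul_right (qi.eval (sizeOfEnc a) + 10) (hl3.length_le.trans hlen2)
        have h3 := Nat.mul_le_mul h1 (Nat.add_le_add_right
          (Nat.add_le_add_left h2 (qA.eval (sizeOfEnc a))) 1)
        simpa using h3
    have hmem : ∀ l : List Instr, ∀ x ∈ (IRM.stepsAnns l (A a)).map Assn.toks,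
        ∃ l', l' <:+ l ∧ x = (stepsWp l' (A a)).toks := by
      intro l
      induction l with
      | nil => simp [IRM.stepsAnns]
      | cons i r ih =>
        intro x hx
        rw [IRM.stepsAnns, List.map_cons, List.mem_cons] at hx
        rcases hx with rfl | hx
        · exact ⟨_, List.suffix_refl _, rfl⟩
        · obtain ⟨l', h1, h2⟩ := ih x hx
          exact ⟨l', h1.trans (List.suffix_cons _ _), h2⟩
    refine (sizeOfEnc_list_le (B := (q * (qA + qi * (qi + 10) + 1) + 1).eval (sizeOfEnc a))
      fun x hx => ?_).trans ?_
    · obtain ⟨l', h1, rfl⟩ := hmem _ x hx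
      exact hel _ h1
    · rw [List.length_map, length_stepsAnns]
      have := Nat.mul_le_mul_right
        ((q * (qA + qi * (qi + 10) + 1) + 1).eval (sizeOfEnc a) + 1) hlen2
      simpa using this
  convert key using 2 with a
  exact hanns _ _ (hg a)

end
end Poly
end IRM

namespace IRM

open Enc (enc)

section
variable {α β γ τ σ T : Type} [Enc α] [Enc β] [Enc γ] [Enc τ] [Enc σ] [Enc T]

theorem sizeOfEnc_list (l : List α) :
    sizeOfEnc l = (l.map fun x => sizeOfEnc x + 1).sum + 1 := by
  induction l with
  | nil => rfl
  | cons x r ih => rw [sizeOfEnc_cons, ih, List.map_cons, List.sum_cons]; omega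

namespace Poly

theorem foldr_of_nil {g : α → τ → List β → List β} {l : α → List τ} {b : α → List β}
    (hg : Poly (fun p : α × τ × List β => g p.1 p.2.1 p.2.2)) (hl : Poly l) (hb : Poly b)
    (h : ∀ a x b, sizeOfEnc (g a x b) ≤ sizeOfEnc b + sizeOfEnc (g a x [])) :
    Poly (fun a => (l a).foldr (g a) (b a)) := by
  have : Poly (fun p : α × τ => g p.1 p.2 []) :=
    hg.comp (f := fun p : α × τ => (p.1, p.2, [])) (by fun_prop)
  obtain ⟨q, hq⟩ := this.size_le
  refine foldr_of_add hg hl hb (q.comp (Polynomial.X + 1)) fun a x b => ?_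
  have h1 := hq (a, x)
  have h2 := h a x b
  rw [sizeOfEnc_prod] at h1
  simp only [Polynomial.eval_comp, Polynomial.eval_add, Polynomial.eval_X, Polynomial.eval_one] at h1 ⊢
  omega

@[fun_prop]
theorem lookup {l : α → List (ℕ × τ)} {x : α → ℕ} (hl : Poly l) (hx : Poly x) :
    Poly (fun a => (l a).lookup (x a)) := by
  have : Poly (fun a => ((l a).find? fun p => decide (x a = p.1)).map fun p => p.2) := by fun_prop
  convert this using 2 with a
  induction l a with
  | nil => rfl
  | cons p r ih =>
    by_cases h : x a = p.1
    · simp [List.lookup, h]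
    · have h' : (x a == p.1) = false := by simpa using h
      simp [List.lookup, h', ih, h]

end Poly
end

/-- Postfix notation of contract expressions in terms of ghost variables. -/
def CExpr.ghostToks (e : CExpr) : List Tok := e.toGhost.toks
def CExpr.locToks (F : Frame) (e : CExpr) : List Tok := (e.toLoc F).toks
def CExpr.sops (F : Frame) (e : CExpr) : List SOp := (e.compile F).map Instr.sop
def updateSops (F : Frame) (u : List (ℕ × CExpr)) : List SOp :=
  (compileUpdate F u).map Instr.sop

/-- Postfix notation of a conditional assertion. -/
def iteToks (a b c : List Tok) : List Tok :=
  .push 1 :: (.push 2 :: (.push 1 :: a ++ (.push 2 :: b ++ [.mk]) ++ [.mk, .mk]) ++ [.mk]) ++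
    (.push 2 :: (.push 1 :: (.push 2 :: a ++ [.mk]) ++ (.push 2 :: c ++ [.mk]) ++ [.mk, .mk]) ++
      [.mk]) ++ [.mk, .mk]

theorem sizeOfEnc_iteToks (a b c : List Tok) :
    sizeOfEnc (iteToks a b c) ≤ sizeOfEnc b + sizeOfEnc (iteToks a [] c) := by
  unfold iteToks
  simp only [sizeOfEnc_list, List.map_append, List.sum_append, List.map_cons, List.sum_cons,
    List.map_nil, List.sum_nil, List.cons_append]
  omega

theorem Assn.toks_ite (a b c : Assn) : (Assn.ite a b c).toks = iteToks a.toks b.toks c.toks := rfl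

/-- Postfix notation of `e = 0`. -/
def eqZeroToks (e : List Tok) : List Tok :=
  .push 0 :: .push RelSym.eq :: e ++ (Expr.int 0).toks ++ [.mk, .mk, .mk]

theorem toks_eqZero (e : Expr) : (Assn.eq e (.int 0)).toks = eqZeroToks e.toks := rfl

attribute [irreducible] iteToks eqZeroToks

theorem sizeOfEnc_cexpr_op (o : ℕ) (a b : CExpr) :
    sizeOfEnc (CExpr.op o a b) = sizeOfEnc (5, o, a, b) := rfl
theorem sizeOfEnc_cexpr_rel (o : RelSym) (a b : CExpr) :
    sizeOfEnc (CExpr.rel o a b) = sizeOfEnc (6, o, a, b) := rfl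
theorem sizeOfEnc_cexpr_field (e : CExpr) (f : ℕ) :
    sizeOfEnc (CExpr.field e f) = sizeOfEnc (3, e, f) := rfl

namespace Poly
section
variable {α β γ τ σ T : Type} [Enc α] [Enc β] [Enc γ] [Enc τ] [Enc σ] [Enc T]

@[fun_prop]
theorem ghostToks {e : α → CExpr} (he : Poly e) : Poly (fun a => (e a).ghostToks) := by
  let ex : CExpr → List (Tok ⊕ CExpr) := fun e => e.elim
    (fun l => [.inl (.push (Expr.val (.lit l)))]) (fun x => [.inl (.ghost (.ms x))])
    (fun x => [.inl (.ghost (.arg x))]) [.inl (.stack 0)]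
    (fun p => [.inl (.push 1), .inr p.1, .inl (.push p.2), .inl .mk, .inl .mk])
    (fun p => [.inl (.stat (.user p.1 p.2))])
    (fun p => [.inl (.push 6), .inl (.push p.1), .inr p.2.1, .inr p.2.2, .inl .mk, .inl .mk,
      .inl .mk])
    (fun p => [.inl (.push 7), .inl (.push 0), .inl (.push p.1), .inr p.2.1, .inr p.2.2,
      .inl .mk, .inl .mk, .inl .mk, .inl (.push (Expr.int 1)), .inl (.push (Expr.int 0)),
      .inl .mk, .inl .mk, .inl .mk])
  have := flatten (f := fun (_ : Unit) e => e.ghostToks) (ex := fun _ => ex)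
    (by fun_prop) (fun _ e => by
      cases e <;> simp [CExpr.ghostToks, CExpr.toGhost, Expr.toks, Assn.toks, Expr.int, ex,
        CExpr.elim])
    (fun _ e => by
      cases e with
      | op o a b =>
        rw [sizeOfEnc_cexpr_op]
        simp only [ex, CExpr.elim, sizeOfEnc_prod, List.map_cons, List.map_nil, List.sum_cons,
          List.sum_nil, Sum.elim_inl, Sum.elim_inr]
        omega
      | rel o a b =>
        rw [sizeOfEnc_cexpr_rel]
        simp only [ex, CExpr.elim, sizeOfEnc_prod, List.map_cons, List.map_nil, List.sum_cons,
          List.sum_nil, Sum.elim_inl, Sum.elim_inr]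
        omega
      | field e f =>
        rw [sizeOfEnc_cexpr_field]
        simp only [ex, CExpr.elim, sizeOfEnc_prod, List.map_cons, List.map_nil, List.sum_cons,
          List.sum_nil, Sum.elim_inl, Sum.elim_inr]
        omega
      | _ => simpa [ex, CExpr.elim] using one_le_sizeOfEnc _)
  exact this.comp ((const ()).prodMk he)

@[fun_prop]
theorem sops {F : α → Frame} {e : α → CExpr} (hF : Poly F) (he : Poly e) :
    Poly (fun a => (e a).sops (F a)) := by
  let ex : Frame → CExpr → List (SOp ⊕ CExpr) := fun F e => e.elim
    (fun l => [.inl (.inl ([.push (Expr.val (.lit l))], 0))])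
    (fun x => [.inl (.inl ([.stat (.sec x)], 0))])
    (fun x => [.inl (.inl ([.loc (F.argReg x)], 0))]) [.inl (.inl ([.loc F.resReg], 0))]
    (fun p => [.inr p.1, .inl (.inl ([.push 1, .stack 0, .push p.2, .mk, .mk], 1))])
    (fun p => [.inl (.inl ([.stat (.user p.1 p.2)], 0))])
    (fun p => [.inr p.2.1, .inr p.2.2,
      .inl (.inl ([.push 6, .push p.1, .stack 1, .stack 0, .mk, .mk, .mk], 2))])
    (fun p => [.inr p.2.1, .inr p.2.2,
      .inl (.inl ([.push 7, .push 0, .push p.1, .stack 1, .stack 0, .mk, .mk, .mk,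
        .push (Expr.int 1), .push (Expr.int 0), .mk, .mk, .mk], 2))])
  have := flatten (f := CExpr.sops) (ex := ex)
    (by fun_prop) (fun _ e => by
      cases e <;> simp [CExpr.sops, CExpr.compile, Instr.sop, Expr.toks, Assn.toks, Expr.int, ex,
        CExpr.elim])
    (fun _ e => by
      cases e with
      | op o a b =>
        rw [sizeOfEnc_cexpr_op]
        simp only [ex, CExpr.elim, sizeOfEnc_prod, List.map_cons, List.map_nil, List.sum_cons,
          List.sum_nil, Sum.elim_inl, Sum.elim_inr]
        omega
      | rel o a b =>
        rw [sizeOfEnc_cexpr_rel]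
        simp only [ex, CExpr.elim, sizeOfEnc_prod, List.map_cons, List.map_nil, List.sum_cons,
          List.sum_nil, Sum.elim_inl, Sum.elim_inr]
        omega
      | field e f =>
        rw [sizeOfEnc_cexpr_field]
        simp only [ex, CExpr.elim, sizeOfEnc_prod, List.map_cons, List.map_nil, List.sum_cons,
          List.sum_nil, Sum.elim_inl, Sum.elim_inr]
        omega
      | _ => simpa [ex, CExpr.elim] using one_le_sizeOfEnc _)
  exact this.comp (hF.prodMk he)

@[fun_prop]
theorem updateSops {F : α → Frame} {u : α → List (ℕ × CExpr)} (hF : Poly F) (hu : Poly u) :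
    Poly (fun a => updateSops (F a) (u a)) := by
  have : Poly (fun a => (u a).flatMap (fun p => p.2.sops (F a)) ++
      (u a).reverse.map fun p => (.inr (.inr (.sec p.1)) : SOp)) := by fun_prop
  convert this using 2 with a
  simp [IRM.updateSops, compileUpdate, CExpr.sops, Instr.sop, List.map_flatMap, Function.comp_def]

@[fun_prop]
theorem locToks {F : α → Frame} {e : α → CExpr} (hF : Poly F) (he : Poly e) :
    Poly (fun a => (e a).locToks (F a)) := by
  have : Poly (fun a => IRM.substToks (fun _ => [.loc (F a).resReg]) (fun i => [.loc i])
      (fun x => [.stat x]) (fun g => g.elim (fun x => [.stat (.sec x)]) [.loc (F a).base]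
        fun i => [.loc ((F a).argReg i)]) (e a).ghostToks) := by fun_prop
  convert this using 2 with a
  rw [CExpr.locToks, CExpr.toLoc, Expr.toks_subst]
  congr 1
  funext g
  cases g <;> rfl

@[fun_prop]
theorem iteToks {f g h : α → List Tok} (hf : Poly f) (hg : Poly g) (hh : Poly h) :
    Poly (fun a => iteToks (f a) (g a) (h a)) := by
  unfold IRM.iteToks
  fun_prop

@[fun_prop]
theorem eqZeroToks {f : α → List Tok} (hf : Poly f) : Poly (fun a => eqZeroToks (f a)) := by
  unfold IRM.eqZeroToks
  fun_prop

theorem shift {A : α → Assn} {k : α → ℕ} (hA : Poly fun a => (A a).toks) (hk : Poly k) :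
    Poly fun a => ((A a).shift (k a)).toks := by
  simp only [Assn.shift, Assn.toks_subst, Expr.toks]
  fun_prop

theorem ifeqWp {A B : α → Assn} (hA : Poly fun a => (A a).toks) (hB : Poly fun a => (B a).toks) :
    Poly fun a => (ifeqWp (A a) (B a)).toks := by
  have h1 := shift hA (const 1)
  have h2 := shift hB (const 1)
  simp only [IRM.ifeqWp, Assn.toks_ite]
  exact iteToks (const _) h1 h2

theorem substUpdate {F : α → Frame} {D : α → Assn} {u : α → List (ℕ × CExpr)} (hF : Poly F)
    (hD : Poly fun a => (D a).toks) (hu : Poly u) :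
    Poly fun a => ((D a).subst (updateSubst (F a) (u a))).toks := by
  have : Poly fun a => IRM.substToks (fun i => [.stack i]) (fun i => [.loc i]) (fun y => y.elim
      (fun p => [.stat (.user p.1 p.2)]) fun x => ((u a).lookup x).elim [.stat (.sec x)] fun e =>
        e.locToks (F a)) (fun g => [.ghost g]) (D a).toks := by fun_prop
  convert this using 2 with a
  rw [Assn.toks_subst]
  congr 1
  funext y
  cases y with
  | user c f => rfl
  | sec x =>
    simp only [updateSubst, SField.elim]
    cases (u a).lookup x <;> rfl

theorem compileAnns {F : α → Frame} {A : α → Assn} {e : α → CExpr} (hF : Poly F)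
    (hA : Poly fun a => (A a).toks) (he : Poly e) :
    Poly fun a => (IRM.stepsAnns ((e a).compile (F a)) (A a)).map Assn.toks := by
  refine stepsAnns (sops hF he) hA ?_ ?_
  · intro a
    generalize F a = F
    induction e a with
    | _ => simp_all [CExpr.compile, or_imp]
  · have : Poly fun a => IRM.substToks
        (fun i => if i = 0 then (e a).locToks (F a) else [.stack (i - 1)]) (fun i => [.loc i])
        (fun x => [.stat x]) (fun g => [.ghost g]) (A a).toks := by fun_prop
    obtain ⟨q, hq⟩ := this.size_le
    refine ⟨q, fun a => le_trans ?_ ((length_le_sizeOfEnc _).trans (hq a))⟩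
    rw [stepsWp_compile, Assn.push, Assn.toks_subst]
    apply le_of_eq
    congr 2
    funext i
    cases i <;> rfl

theorem updateAnns {F : α → Frame} {A : α → Assn} {u : α → List (ℕ × CExpr)} (hF : Poly F)
    (hA : Poly fun a => (A a).toks) (hu : Poly u) :
    Poly fun a => (IRM.stepsAnns (compileUpdate (F a) (u a)) (A a)).map Assn.toks := by
  refine stepsAnns (updateSops hF hu) hA ?_ ?_
  · intro a i hi v
    have : ∀ F (e : CExpr), ∀ i ∈ e.compile F, ∀ v, i ≠ .ghost v := by
      intro F e
      induction e with
      | _ => simp_all [CExpr.compile, or_imp]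
    simp only [compileUpdate, List.mem_append, List.mem_flatMap, List.mem_map] at hi
    rcases hi with ⟨p, -, hi⟩ | ⟨p, -, rfl⟩
    · exact this _ _ i hi v
    · simp
  · obtain ⟨q, hq⟩ := (substUpdate hF hA hu).size_le
    refine ⟨q, fun a => le_trans ?_ ((length_le_sizeOfEnc _).trans (hq a))⟩
    rw [stepsWp_compileUpdate]

theorem clausesWp {F : α → Frame} {D : α → Assn} {l : α → List Clause} (hF : Poly F)
    (hD : Poly fun a => (D a).toks) (hl : Poly l) :
    Poly fun a => (clausesWp (F a) (D a) (l a)).toks := by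
  have h : Poly fun p : α × Clause => ((D p.1).subst (updateSubst (F p.1) p.2.update)).toks :=
    substUpdate (by fun_prop) (hD.comp (fst id)) (by fun_prop)
  have h' : Poly fun p : α × Clause × List Tok =>
      ((D p.1).subst (updateSubst (F p.1) p.2.1.update)).toks :=
    h.comp (f := fun p : α × Clause × List Tok => (p.1, p.2.1)) (by fun_prop)
  have : Poly fun a => (l a).foldr (fun cl r => IRM.iteToks
      (IRM.eqZeroToks (cl.guard.locToks (F a))) r
      ((D a).subst (updateSubst (F a) cl.update)).toks) Assn.tt.toks := by
    have hs : Poly fun p : α × Clause × List Tok => IRM.iteToks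
        (IRM.eqZeroToks (p.2.1.guard.locToks (F p.1))) p.2.2
        ((D p.1).subst (updateSubst (F p.1) p.2.1.update)).toks :=
      iteToks (by fun_prop) (by fun_prop) h'
    exact foldr_of_nil (g := fun a cl r => IRM.iteToks
      (IRM.eqZeroToks (cl.guard.locToks (F a))) r
      ((D a).subst (updateSubst (F a) cl.update)).toks) hs hl (const _)
      fun _ _ _ => sizeOfEnc_iteToks _ _ _
  convert this using 2 with a
  induction l a with
  | nil => rfl
  | cons cl r ih =>
    rw [IRM.clausesWp, Assn.toks_ite, ih, toks_eqZero]
    rfl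

theorem clausesAnns {F : α → Frame} {D : α → Assn} {l : α → List Clause} (hF : Poly F)
    (hD : Poly fun a => (D a).toks) (hl : Poly l) :
    Poly fun a => (clausesAnns (F a) (D a) (l a)).map Assn.toks := by
  have hD' : Poly fun p : (α × List Clause) × Clause × List Clause => (D p.1.1).toks :=
    hD.comp (fst (fst id))
  have h1 : Poly fun p : (α × List Clause) × Clause × List Clause =>
      (IRM.ifeqWp (IRM.clausesWp (F p.1.1) (D p.1.1) p.2.2)
        ((D p.1.1).subst (updateSubst (F p.1.1) p.2.1.update))).toks :=
    ifeqWp (clausesWp (by fun_prop) hD' (by fun_prop))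
      (substUpdate (by fun_prop) hD' (by fun_prop))
  have h2 : Poly fun p : (α × List Clause) × Clause × List Clause =>
      (IRM.stepsAnns (p.2.1.guard.compile (F p.1.1)) (IRM.ifeqWp
        (IRM.clausesWp (F p.1.1) (D p.1.1) p.2.2)
        ((D p.1.1).subst (updateSubst (F p.1.1) p.2.1.update)))).map Assn.toks :=
    compileAnns (by fun_prop) h1 (by fun_prop)
  have h3 : Poly fun p : (α × List Clause) × Clause × List Clause =>
      (IRM.stepsAnns (compileUpdate (F p.1.1) p.2.1.update) (D p.1.1)).map Assn.toks :=
    updateAnns (by fun_prop) hD' (by fun_prop)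
  let body : α → List Clause → List (List Tok) := fun a s =>
    listCases s [Assn.tt.toks, Assn.tt.toks] fun cl r =>
      (IRM.stepsAnns (cl.guard.compile (F a)) (IRM.ifeqWp (IRM.clausesWp (F a) (D a) r)
        ((D a).subst (updateSubst (F a) cl.update)))).map Assn.toks ++
      (IRM.ifeqWp (IRM.clausesWp (F a) (D a) r)
        ((D a).subst (updateSubst (F a) cl.update))).toks ::
      ((IRM.stepsAnns (compileUpdate (F a) cl.update) (D a)).map Assn.toks ++ [(D a).toks])
  have h4 : Poly fun p : α × List Clause => body p.1 p.2 :=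
    listCases_poly (h2.append (h1.cons (h3.append (hD'.cons (const []))))) (const _) (snd id)
  have := flatMap (f := body) h4 (tails hl)
  convert this using 2 with a
  induction l a with
  | nil => rfl
  | cons cl r ih =>
    rw [IRM.clausesAnns, List.tails_cons, List.flatMap_cons, ← ih]
    simp [body, listCases]

theorem sectionWp {F : α → Frame} {D : α → Assn} {l : α → Option (List Clause)} (hF : Poly F)
    (hD : Poly fun a => (D a).toks) (hl : Poly l) :
    Poly fun a => (sectionWp (F a) (D a) (l a)).toks := by
  have h : Poly fun p : α × List Clause => (IRM.clausesWp (F p.1) (D p.1) p.2).toks :=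
    clausesWp (by fun_prop) (hD.comp (fst id)) (by fun_prop)
  convert optionElim (f := fun a cls => (IRM.clausesWp (F a) (D a) cls).toks) h hD hl using 2 with a
  cases l a <;> rfl

theorem sectionAnns {F : α → Frame} {D : α → Assn} {l : α → Option (List Clause)} (hF : Poly F)
    (hD : Poly fun a => (D a).toks) (hl : Poly l) :
    Poly fun a => (sectionAnns (F a) (D a) (l a)).map Assn.toks := by
  have h : Poly fun p : α × List Clause =>
      (IRM.clausesAnns (F p.1) (D p.1) p.2).map Assn.toks :=
    clausesAnns (by fun_prop) (hD.comp (fst id)) (by fun_prop)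
  convert optionElim (f := fun a cls => (IRM.clausesAnns (F a) (D a) cls).map Assn.toks) h
    (hD.cons (const [])) hl using 2 with a
  cases l a <;> rfl

end
end Poly
end IRM

namespace IRM

open Enc (enc)

/-- Postfix notation of a conjunction. -/
def conjToks (l : List (List Tok)) : List Tok :=
  l.foldr (fun a r => .push 1 :: a ++ r ++ [.mk, .mk]) Assn.tt.toks

theorem Assn.toks_conj (l : List Assn) : (Assn.conj l).toks = conjToks (l.map Assn.toks) := by
  induction l with
  | nil => rfl
  | cons a r ih => simp only [Assn.conj, Assn.toks, ih]; rfl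

def eqToks (a b : List Tok) : List Tok :=
  .push 0 :: .push RelSym.eq :: a ++ b ++ [.mk, .mk, .mk]

theorem Assn.toks_eq (a b : Expr) : (Assn.eq a b).toks = eqToks a.toks b.toks := rfl

/-- Postfix notation of the condition that the object in the local variable `r` is not in class `t`,
as it is tested by the inlined code. -/
def notInstToks (r t : ℕ) : List Tok :=
  eqZeroToks (.push 7 :: (.push 3 :: [.loc r] ++ [.push t, .mk, .mk]) ++ (Expr.int 1).toks ++
    (Expr.int 0).toks ++ [.mk, .mk, .mk])

/-- Postfix notation of a conditional expression on the class of the target. -/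
def condInstToks (t : ℕ) (a b : List Tok) : List Tok :=
  .push 7 :: (.push 3 :: [.ghost .tgt] ++ [.push t, .mk, .mk]) ++ a ++ b ++ [.mk, .mk, .mk]

/-- Postfix notation of a conditional expression on a guard. -/
def guardToks (g a b : List Tok) : List Tok :=
  .push 7 :: (.push 2 :: eqZeroToks g ++ [.mk]) ++ a ++ b ++ [.mk, .mk, .mk]

def clausesExprToks (x : ℕ) (l : List Clause) : List Tok := (clausesExpr x l).toks
def deltaToks (x : ℕ) (l : Option (List Clause)) : List Tok := (deltaExpr x l).toks
def dispatchToks (C : Contract) (ev : Event) (m : MethodId) (x : ℕ) (ds : List (Option ℕ × ℕ)) :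
    List Tok :=
  (ghostDispatch C ev m x ds).toks

theorem ghostSubst_update (T : Hierarchy) (C : Contract) (ev : Event) (k : InvokeKind) (c : ℕ)
    (m : MethodId) (A : Assn) : (ghostUpdate T C ev k c m).step A = A.subst { ghost := fun g =>
      match g with
      | .ms x => if x < C.init.length then ghostDispatch C ev m x (T.dispatch k c m)
          else .ghost (.ms x)
      | g => .ghost g } := by
  unfold ghostUpdate
  simp only [Instr.step, ghostSubst]
  congr 2
  funext g
  have key : ∀ (f : ℕ → Expr) (l : List ℕ) (g : GVar),
      (l.map fun x => (GVar.ms x, f x)).lookup g =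
        match g with
        | .ms x => if x ∈ l then some (f x) else none
        | _ => none := by
    intro f l g
    induction l with
    | nil => cases g <;> simp
    | cons y r ih =>
      rw [List.map_cons, List.lookup_cons, ih]
      cases g with
      | ms x =>
        by_cases h : x = y
        · subst h; simp
        · have : (GVar.ms x == GVar.ms y) = false := by simpa using h
          simp [this, h]
      | tgt => rfl
      | arg i => rfl
  rw [key]
  cases g with
  | ms x =>
    simp only [List.mem_range]
    split_ifs <;> rfl
  | tgt => rfl
  | arg i => rfl

/-- The substitution that stores the operands of a call in the ghost temporaries. -/
def argsSubst (k : InvokeKind) (m : MethodId) : Subst where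
  ghost := fun g => match g with
    | .ms x => .ghost (.ms x)
    | .tgt => if k.hasTarget then .stack m.arity else .ghost .tgt
    | .arg i => if i < m.arity then .stack (m.arity - 1 - i) else .ghost (.arg i)

theorem ghostSubst_args (k : InvokeKind) (m : MethodId) (A : Assn) :
    (ghostArgs k m).step A = A.subst (argsSubst k m) := by
  unfold ghostArgs
  simp only [Instr.step, ghostSubst, argsSubst]
  congr 2
  funext g
  have key : ∀ (f : ℕ → Expr) (l : List ℕ) (g : GVar),
      (l.map fun x => (GVar.arg x, f x)).lookup g =
        match g with
        | .arg x => if x ∈ l then some (f x) else none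
        | _ => none := by
    intro f l g
    induction l with
    | nil => cases g <;> simp
    | cons y r ih =>
      rw [List.map_cons, List.lookup_cons, ih]
      cases g with
      | arg x =>
        by_cases h : x = y
        · subst h; simp
        · have : (GVar.arg x == GVar.arg y) = false := by simpa using h
          simp [this, h]
      | tgt => rfl
      | ms i => rfl
  cases hk : k.hasTarget
  · simp only [Bool.false_eq_true, if_false, List.nil_append]
    rw [key]
    cases g with
    | arg x =>
      simp only [List.mem_range]
      split_ifs <;> rfl
    | tgt => rfl
    | ms i => rfl
  · simp only [if_true, List.cons_append, List.nil_append, List.lookup_cons]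
    rw [key]
    cases g with
    | arg x =>
      have : (GVar.arg x == GVar.tgt) = false := rfl
      simp only [this, List.mem_range]
      split_ifs <;> rfl
    | tgt => rfl
    | ms i => rfl

attribute [irreducible] eqToks

namespace Poly
section
variable {α β γ τ σ T : Type} [Enc α] [Enc β] [Enc γ] [Enc τ] [Enc σ] [Enc T]

@[fun_prop]
theorem eqToks {f g : α → List Tok} (hf : Poly f) (hg : Poly g) :
    Poly (fun a => eqToks (f a) (g a)) := by
  unfold IRM.eqToks
  fun_prop

@[fun_prop]
theorem conjToks {f : α → List (List Tok)} (hf : Poly f) : Poly (fun a => conjToks (f a)) := by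
  refine foldr_of_nil (g := fun (_ : α) a r => Tok.push 1 :: a ++ r ++ [.mk, .mk])
    (by fun_prop) hf (const _) fun a x b => ?_
  simp only [sizeOfEnc_list, List.map_append, List.sum_append, List.map_cons, List.sum_cons,
    List.map_nil, List.sum_nil, List.cons_append]
  omega

@[fun_prop]
theorem notInstToks {f g : α → ℕ} (hf : Poly f) (hg : Poly g) :
    Poly (fun a => notInstToks (f a) (g a)) := by
  unfold IRM.notInstToks
  fun_prop

@[fun_prop]
theorem condInstToks {t : α → ℕ} {f g : α → List Tok} (ht : Poly t) (hf : Poly f) (hg : Poly g) :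
    Poly (fun a => condInstToks (t a) (f a) (g a)) := by
  unfold IRM.condInstToks
  fun_prop

@[fun_prop]
theorem guardToks {f g h : α → List Tok} (hf : Poly f) (hg : Poly g) (hh : Poly h) :
    Poly (fun a => guardToks (f a) (g a) (h a)) := by
  unfold IRM.guardToks
  fun_prop

theorem contractInv {C : α → Contract} (hC : Poly C) : Poly fun a => (C a).inv.toks := by
  have : Poly fun a => IRM.conjToks ((List.range (C a).init.length).map fun x =>
      IRM.eqToks [.stat (.sec x)] [.ghost (.ms x)]) := by fun_prop
  convert this using 2 with a
  simp [Contract.inv, Assn.toks_conj, Function.comp_def, Assn.toks_eq, Expr.toks]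

theorem frameAssn {base : α → ℕ} {k : α → InvokeKind} {m : α → MethodId} (hb : Poly base)
    (hk : Poly k) (hm : Poly m) :
    Poly fun a => (callFrame (base a) (k a) (m a)).assn.toks := by
  have : Poly fun a => IRM.conjToks ((if (k a).hasTarget = true then
      [IRM.eqToks [.loc (base a)] [.ghost .tgt]] else []) ++
      (List.range (m a).2.length).map fun i =>
        IRM.eqToks [.loc (base a + 1 + i)] [.ghost (.arg i)]) := by
    have : Poly fun a => decide ((k a).hasTarget = true) := by
      simpa using kindHasTarget hk
    fun_prop
  convert this using 2 with a
  rw [Frame.assn, Assn.toks_conj, List.map_append, List.map_map]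
  cases h : (k a).hasTarget <;>
    simp [callFrame, h, MethodId.arity, Function.comp_def, Assn.toks_eq, Expr.toks, Frame.argReg]

@[fun_prop]
theorem frameCall {base : α → ℕ} {k : α → InvokeKind} {m : α → MethodId} (hb : Poly base)
    (hk : Poly k) (hm : Poly m) : Poly fun a => callFrame (base a) (k a) (m a) := by
  have : Poly fun a => (base a, (m a).2.length, (k a).hasTarget) := by fun_prop
  exact of_enc_eq this fun _ => rfl

@[fun_prop]
theorem clausesExprToks {x : α → ℕ} {l : α → List Clause} (hx : Poly x) (hl : Poly l) :
    Poly fun a => clausesExprToks (x a) (l a) := by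
  have : Poly fun a => (l a).foldr (fun cl r => IRM.guardToks cl.guard.ghostToks
      ((cl.update.lookup (x a)).elim [.ghost (.ms (x a))] fun e => e.ghostToks) r)
      Expr.bot.toks := by
    refine foldr_of_nil (g := fun a cl r => IRM.guardToks cl.guard.ghostToks
      ((cl.update.lookup (x a)).elim [.ghost (.ms (x a))] fun e => e.ghostToks) r)
      (by fun_prop) hl (const _) fun a y b => ?_
    unfold IRM.guardToks
    simp only [sizeOfEnc_list, List.map_append, List.sum_append, List.map_cons, List.sum_cons,
      List.map_nil, List.sum_nil, List.cons_append]
    omega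
  convert this using 2 with a
  unfold IRM.clausesExprToks
  induction l a with
  | nil => rfl
  | cons cl r ih =>
    rw [clausesExpr, Expr.toks, Assn.toks, toks_eqZero, ih, List.foldr_cons]
    cases cl.update.lookup (x a) <;> simp [IRM.guardToks, CExpr.ghostToks, Expr.toks]

@[fun_prop]
theorem deltaToks {x : α → ℕ} {l : α → Option (List Clause)} (hx : Poly x) (hl : Poly l) :
    Poly fun a => deltaToks (x a) (l a) := by
  have : Poly fun a => (l a).elim [.ghost (.ms (x a))] fun cls => .push 7 ::
      IRM.eqToks [.ghost (.ms (x a))] Expr.bot.toks ++ Expr.bot.toks ++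
        IRM.clausesExprToks (x a) cls ++ [.mk, .mk, .mk] := by fun_prop
  convert this using 2 with a
  unfold IRM.deltaToks
  cases l a with
  | none => rfl
  | some cls => rw [deltaExpr, Expr.toks, Assn.toks_eq]; rfl

@[fun_prop]
theorem dispatchToks {C : α → Contract} {ev : Event} {m : α → MethodId} {x : α → ℕ}
    {ds : α → List (Option ℕ × ℕ)} (hC : Poly C) (hm : Poly m) (hx : Poly x) (hd : Poly ds) :
    Poly fun a => dispatchToks (C a) ev (m a) (x a) (ds a) := by
  have : Poly fun a => (ds a).foldr (fun p r => p.1.elim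
      (IRM.deltaToks (x a) ((C a).clauses ev p.2 (m a))) fun t => IRM.condInstToks t
        (IRM.deltaToks (x a) ((C a).clauses ev p.2 (m a))) r) [.ghost (.ms (x a))] := by
    have hb : Poly fun a => [Tok.ghost (.ms (x a))] := by fun_prop
    refine foldr_of_nil (g := fun a p r => p.1.elim
      (IRM.deltaToks (x a) ((C a).clauses ev p.2 (m a))) fun t => IRM.condInstToks t
        (IRM.deltaToks (x a) ((C a).clauses ev p.2 (m a))) r)
      (by fun_prop) hd hb fun a y b => ?_
    rcases y with ⟨_ | t, d⟩
    · simp only [Option.elim]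
      omega
    · simp only [Option.elim]
      unfold IRM.condInstToks
      simp only [sizeOfEnc_list, List.map_append, List.sum_append, List.map_cons, List.sum_cons,
        List.map_nil, List.sum_nil, List.cons_append]
      omega
  convert this using 2 with a
  unfold IRM.dispatchToks
  induction ds a with
  | nil => rfl
  | cons p r ih =>
    rcases p with ⟨_ | t, d⟩
    · rfl
    · rw [ghostDispatch, Expr.toks, ih]
      rfl

theorem stepUpdate {T : α → Hierarchy} {C : α → Contract} {ev : Event} {k : α → InvokeKind}
    {c : α → ℕ} {m : α → MethodId} {A : α → Assn} (hT : Poly T) (hC : Poly C) (hk : Poly k)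
    (hc : Poly c) (hm : Poly m) (hA : Poly fun a => (A a).toks) :
    Poly fun a => ((ghostUpdate (T a) (C a) ev (k a) (c a) (m a)).step (A a)).toks := by
  have : Poly fun a => IRM.substToks (fun i => [.stack i]) (fun i => [.loc i]) (fun x => [.stat x])
      (fun g => g.elim (fun x => if x < (C a).init.length then IRM.dispatchToks (C a) ev (m a) x
        ((T a).dispatch (k a) (c a) (m a)) else [.ghost (.ms x)]) [.ghost .tgt]
        fun i => [.ghost (.arg i)]) (A a).toks := by fun_prop
  convert this using 2 with a
  rw [ghostSubst_update, Assn.toks_subst]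
  congr 1
  funext g
  cases g with
  | ms x =>
    simp only [GVar.elim]
    split_ifs <;> rfl
  | _ => rfl

theorem stepArgs {k : α → InvokeKind} {m : α → MethodId} {A : α → Assn} (hk : Poly k)
    (hm : Poly m) (hA : Poly fun a => (A a).toks) :
    Poly fun a => ((ghostArgs (k a) (m a)).step (A a)).toks := by
  have : Poly fun a => IRM.substToks (fun i => [.stack i]) (fun i => [.loc i]) (fun x => [.stat x])
      (fun g => g.elim (fun x => [.ghost (.ms x)])
        (bif (k a).hasTarget then [.stack (m a).2.length] else [.ghost .tgt])
        fun i => if i < (m a).2.length then [.stack ((m a).2.length - 1 - i)]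
          else [.ghost (.arg i)]) (A a).toks := by fun_prop
  convert this using 2 with a
  rw [ghostSubst_args, Assn.toks_subst]
  congr 1
  funext g
  cases g with
  | ms x => rfl
  | tgt =>
    simp only [GVar.elim, IRM.argsSubst]
    cases (k a).hasTarget <;> rfl
  | arg i =>
    by_cases h : i < (m a).2.length <;>
      simp [GVar.elim, IRM.argsSubst, MethodId.arity, h, Expr.toks]

theorem checksWp {C : α → Contract} {ev : Event} {m : α → MethodId} {F : α → Frame} {D : α → Assn}
    {ds : α → List (Option ℕ × ℕ)} (hC : Poly C) (hm : Poly m) (hF : Poly F)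
    (hD : Poly fun a => (D a).toks) (hd : Poly ds) :
    Poly fun a => (checksWp (C a) ev (m a) (F a) (D a) (ds a)).toks := by
  have h : Poly fun p : α × (Option ℕ × ℕ) =>
      (IRM.sectionWp (F p.1) (D p.1) ((C p.1).clauses ev p.2.2 (m p.1))).toks :=
    sectionWp (by fun_prop) (hD.comp (fst id)) (by fun_prop)
  have h1 : Poly fun p : α × (Option ℕ × ℕ) × List Tok =>
      (IRM.sectionWp (F p.1) (D p.1) ((C p.1).clauses ev p.2.1.2 (m p.1))).toks :=
    h.comp (f := fun p : α × (Option ℕ × ℕ) × List Tok => (p.1, p.2.1)) (by fun_prop)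
  have h2 : Poly fun p : (α × (Option ℕ × ℕ) × List Tok) × ℕ =>
      (IRM.sectionWp (F p.1.1) (D p.1.1) ((C p.1.1).clauses ev p.1.2.1.2 (m p.1.1))).toks :=
    h1.comp (fst id)
  let g : α → Option ℕ × ℕ → List Tok → List Tok := fun a p r => p.1.elim
    (IRM.sectionWp (F a) (D a) ((C a).clauses ev p.2 (m a))).toks fun t =>
      IRM.iteToks (IRM.notInstToks (F a).base t) r
        (IRM.sectionWp (F a) (D a) ((C a).clauses ev p.2 (m a))).toks
  have hg : Poly fun p : α × (Option ℕ × ℕ) × List Tok => g p.1 p.2.1 p.2.2 :=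
    optionElim (f := fun (p : α × (Option ℕ × ℕ) × List Tok) t =>
      IRM.iteToks (IRM.notInstToks (F p.1).base t) p.2.2
        (IRM.sectionWp (F p.1) (D p.1) ((C p.1).clauses ev p.2.1.2 (m p.1))).toks)
      (iteToks (by fun_prop) (by fun_prop) h2) h1 (by fun_prop)
  have : Poly fun a => (ds a).foldr (g a) (D a).toks := by
    refine foldr_of_nil hg hd hD fun a y b => ?_
    rcases y with ⟨_ | t, d⟩
    · simp only [g, Option.elim]
      omega
    · exact sizeOfEnc_iteToks _ _ _
  convert this using 2 with a
  induction ds a with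
  | nil => rfl
  | cons p r ih =>
    rcases p with ⟨_ | t, d⟩
    · rfl
    · rw [IRM.checksWp, Assn.toks_ite, ih, toks_eqZero]
      rfl

theorem checksAnns {C : α → Contract} {ev : Event} {m : α → MethodId} {F : α → Frame}
    {D : α → Assn} {ds : α → List (Option ℕ × ℕ)} (hC : Poly C) (hm : Poly m) (hF : Poly F)
    (hD : Poly fun a => (D a).toks) (hd : Poly ds) :
    Poly fun a => (checksAnns (C a) ev (m a) (F a) (D a) (ds a)).map Assn.toks := by
  have h1 : Poly fun p : (α × List (Option ℕ × ℕ)) × (Option ℕ × ℕ) × List (Option ℕ × ℕ) =>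
      (IRM.sectionAnns (F p.1.1) (D p.1.1) ((C p.1.1).clauses ev p.2.1.2 (m p.1.1))).map
        Assn.toks :=
    sectionAnns (by fun_prop) (hD.comp (fst (fst id))) (by fun_prop)
  have h2 : Poly fun p : ((α × List (Option ℕ × ℕ)) × (Option ℕ × ℕ) × List (Option ℕ × ℕ)) × ℕ =>
      (IRM.sectionAnns (F p.1.1.1) (D p.1.1.1) ((C p.1.1.1).clauses ev p.1.2.1.2 (m p.1.1.1))).map
        Assn.toks := h1.comp (fst id)
  have h3 : Poly fun p : ((α × List (Option ℕ × ℕ)) × (Option ℕ × ℕ) × List (Option ℕ × ℕ)) × ℕ =>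
      (IRM.ifeqWp (IRM.checksWp (C p.1.1.1) ev (m p.1.1.1) (F p.1.1.1) (D p.1.1.1) p.1.2.2)
        (IRM.sectionWp (F p.1.1.1) (D p.1.1.1)
          ((C p.1.1.1).clauses ev p.1.2.1.2 (m p.1.1.1)))).toks :=
    ifeqWp (checksWp (by fun_prop) (by fun_prop) (by fun_prop) (hD.comp (fst (fst (fst id))))
      (by fun_prop)) (sectionWp (by fun_prop) (hD.comp (fst (fst (fst id)))) (by fun_prop))
  have h4 : Poly fun p : ((α × List (Option ℕ × ℕ)) × (Option ℕ × ℕ) × List (Option ℕ × ℕ)) × ℕ =>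
      (IRM.stepsAnns [.aload (F p.1.1.1).base, .instanceof p.2]
        (IRM.ifeqWp (IRM.checksWp (C p.1.1.1) ev (m p.1.1.1) (F p.1.1.1) (D p.1.1.1) p.1.2.2)
        (IRM.sectionWp (F p.1.1.1) (D p.1.1.1)
          ((C p.1.1.1).clauses ev p.1.2.1.2 (m p.1.1.1))))).map Assn.toks := by
    have key : ∀ (b t : ℕ) (J : Assn), (IRM.stepsAnns [.aload b, .instanceof t] J).map Assn.toks =
        [IRM.sopToks (Instr.sop (.aload b)) (IRM.sopToks (Instr.sop (.instanceof t)) J.toks),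
          IRM.sopToks (Instr.sop (.instanceof t)) J.toks] := by
      intro b t J
      rw [← Instr.toks_step (.instanceof t) J (fun _ => nofun),
        ← Instr.toks_step (.aload b) _ (fun _ => nofun)]
      rfl
    simp only [key, Instr.sop, Expr.toks, Assn.toks, Expr.int]
    have h5 := sopToks (o := fun p : ((α × List (Option ℕ × ℕ)) × (Option ℕ × ℕ) ×
      List (Option ℕ × ℕ)) × ℕ => Instr.sop (.instanceof p.2))
      (by simp only [Instr.sop, Expr.toks, Assn.toks, Expr.int]; fun_prop) h3
    simp only [Instr.sop, Expr.toks, Assn.toks, Expr.int] at h5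
    exact (sopToks (by fun_prop) h5).cons (h5.cons (const []))
  let body : α → List (Option ℕ × ℕ) → List (List Tok) := fun a s =>
    listCases s [] fun p r => p.1.elim
      ((IRM.sectionAnns (F a) (D a) ((C a).clauses ev p.2 (m a))).map Assn.toks) fun t =>
        (IRM.stepsAnns [.aload (F a).base, .instanceof t]
          (IRM.ifeqWp (IRM.checksWp (C a) ev (m a) (F a) (D a) r)
          (IRM.sectionWp (F a) (D a) ((C a).clauses ev p.2 (m a))))).map Assn.toks ++
        (IRM.ifeqWp (IRM.checksWp (C a) ev (m a) (F a) (D a) r)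
          (IRM.sectionWp (F a) (D a) ((C a).clauses ev p.2 (m a)))).toks ::
        (IRM.sectionAnns (F a) (D a) ((C a).clauses ev p.2 (m a))).map Assn.toks
  have hbody : Poly fun p : α × List (Option ℕ × ℕ) => body p.1 p.2 :=
    listCases_poly (optionElim (h4.append (h3.cons h2)) h1 (by fun_prop)) (const _) (snd id)
  have := flatMap (f := body) hbody (tails hd)
  convert this using 2 with a
  induction ds a with
  | nil => rfl
  | cons p r ih =>
    rw [List.tails_cons, List.flatMap_cons, ← ih]
    rcases p with ⟨_ | t, d⟩
    · simp [IRM.checksAnns, body, listCases]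
    · simp [IRM.checksAnns, body, listCases]

end
end Poly
end IRM

namespace IRM

open Enc (enc)

namespace Poly
section
variable {α β γ τ σ T : Type} [Enc α] [Enc β] [Enc γ] [Enc τ] [Enc σ] [Enc T]

theorem saveAnns {base : α → ℕ} {k : α → InvokeKind} {m : α → MethodId} {A : α → Assn}
    (hb : Poly base) (hk : Poly k) (hm : Poly m) (hA : Poly fun a => (A a).toks) :
    Poly fun a =>
      (IRM.stepsAnns (saveCode (callFrame (base a) (k a) (m a))) (A a)).map Assn.toks := by
  refine stepsAnns ?_ hA ?_ ?_
  · have : Poly fun a => ((List.range (m a).2.length).reverse.map fun i =>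
          (Sum.inr (Sum.inl (base a + 1 + i)) : SOp)) ++
        ((bif (k a).hasTarget then
          [(Sum.inr (Sum.inl (base a)) : SOp), (Sum.inl ([.loc (base a)], 0) : SOp)] else []) ++
        (List.range (m a).2.length).map fun i =>
          (Sum.inl ([.loc (base a + 1 + i)], 0) : SOp)) := by fun_prop
    convert this using 2 with a
    cases h : (k a).hasTarget <;> simp [saveCode, callFrame, Frame.argReg, MethodId.arity, h,
      Function.comp_def, Instr.sop]
  · intro a i hi u
    simp only [saveCode, List.mem_append, List.mem_map] at hi
    rcases hi with (⟨j, -, rfl⟩ | hi) | ⟨j, -, rfl⟩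
    · simp
    · split_ifs at hi <;> simp at hi
      rcases hi with rfl | rfl <;> simp
    · simp
  · have : Poly fun a => IRM.substToks (fun i => [.stack i])
        (fun v => if base a < v ∧ v ≤ base a + (m a).2.length then
            [.stack ((m a).2.length - (v - base a))]
          else bif (k a).hasTarget && decide (v = base a) then [.stack (m a).2.length]
          else [.loc v])
        (fun x => [.stat x]) (fun g => [.ghost g]) (A a).toks := by fun_prop
    obtain ⟨q, hq⟩ := this.size_le
    refine ⟨q, fun a => le_trans ?_ ((length_le_sizeOfEnc _).trans (hq a))⟩
    rw [stepsWp_saveCode, Assn.toks_subst]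
    apply le_of_eq
    congr 2
    funext v
    have key : ∀ b n t, ((saveSubst ⟨b, n, t⟩).loc v).toks =
        if b < v ∧ v ≤ b + n then [.stack (n - (v - b))]
        else bif t && decide (v = b) then [.stack n] else [.loc v] := by
      intro b n t
      simp only [saveSubst]
      cases t <;> split_ifs <;> simp_all [Expr.toks]
    exact key _ _ _

theorem blockAnns {T : α → Hierarchy} {C : α → Contract} {base : α → ℕ} {k : α → InvokeKind}
    {c : α → ℕ} {m : α → MethodId} (hT : Poly T) (hC : Poly C) (hb : Poly base) (hk : Poly k)
    (hc : Poly c) (hm : Poly m) :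
    Poly fun a => (blockAnns (T a) (C a) (base a) (k a) (c a) (m a)).map Assn.toks := by
  have hF := frameCall hb hk hm
  have hd := hierarchyDispatch hT hk hc hm
  have hi := contractInv hC
  have hcall : Poly fun a => ((C a).inv.and (callFrame (base a) (k a) (m a)).assn).toks := by
    have := ((const (α := α) (Tok.push 1)).cons hi).append
      ((frameAssn hb hk hm).append (const (α := α) [Tok.mk, Tok.mk]))
    convert this using 2 with a
    simp [Assn.toks]
  have hbef := stepUpdate (ev := .before) hT hC hk hc hm hcall
  have hargs := stepArgs hk hm hbef
  have haft := checksWp (ev := .after) hC hm hF hi hd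
  have hres : Poly fun a => (IRM.stepsAnns [.astore (callFrame (base a) (k a) (m a)).resReg,
      .aload (callFrame (base a) (k a) (m a)).resReg] (IRM.checksWp (C a) .after (m a)
        (callFrame (base a) (k a) (m a)) (C a).inv ((T a).dispatch (k a) (c a) (m a)))).map
          Assn.toks := by
    have h1 := sopToks (o := fun a => Instr.sop (.aload (callFrame (base a) (k a) (m a)).resReg))
      (by simp only [Instr.sop]; fun_prop) haft
    have h2 := sopToks (o := fun a => Instr.sop (.astore (callFrame (base a) (k a) (m a)).resReg))
      (by simp only [Instr.sop]; fun_prop) h1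
    convert h2.cons (h1.cons (const [])) using 2 with a
    rw [← Instr.toks_step (.aload _) _ (fun _ => nofun),
      ← Instr.toks_step (.astore _) _ (fun _ => nofun)]
    rfl
  have hfirst := ((saveAnns hb hk hm (checksWp (ev := .before) hC hm hF hargs hd)).append
    (checksAnns (ev := .before) hC hm hF hargs hd)).append (hargs.cons (const []))
  have htail := listCases_poly (f := fun _ _ r => r) (b := fun _ => ([] : List (List Tok)))
    (snd (snd id)) (const _) hfirst
  have := (hi.cons htail).append ((hbef.cons (hcall.cons (hcall.cons (const [])))).append
    (hres.append ((haft.cons (hcall.cons (const []))).append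
    ((checksAnns (ev := .exceptional) hC hm hF hi hd).append
      (hi.cons (checksAnns (ev := .after) hC hm hF hi hd))))))
  convert this using 2 with a
  have htl : ∀ l : List (List Tok), listCases l [] (fun _ r => r) = l.tail := by
    intro l
    cases l <;> rfl
  rw [htl]
  simp [IRM.blockAnns]

end
end Poly

/-- The assertions for one method, one instruction of the original method after the other. -/
def methodAnns (T : Hierarchy) (C : Contract) (M : MethodDef) : List Assn :=
  M.code.flatMap fun i => i.asInvoke.elim [C.inv] fun p => blockAnns T C M.maxLocals p.1 p.2.1 p.2.2

namespace Poly

theorem instrAnns {α : Type} [Enc α] {T : α → Hierarchy} {C : α → Contract} {M : α → MethodDef}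
    (hT : Poly T) (hC : Poly C) (hM : Poly M) :
    Poly fun p : (α × Instr) × (InvokeKind × ℕ × MethodId) => (IRM.blockAnns (T p.1.1) (C p.1.1)
      (M p.1.1).maxLocals p.2.1 p.2.2.1 p.2.2.2).map Assn.toks :=
  blockAnns (by fun_prop) (by fun_prop) (by fun_prop) (by fun_prop) (by fun_prop) (by fun_prop)

theorem chunkAnns {α : Type} [Enc α] {T : α → Hierarchy} {C : α → Contract} {M : α → MethodDef}
    (hT : Poly T) (hC : Poly C) (hM : Poly M) :
    Poly fun p : α × Instr => p.2.asInvoke.elim [(C p.1).inv.toks] fun q =>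
      (IRM.blockAnns (T p.1) (C p.1) (M p.1).maxLocals q.1 q.2.1 q.2.2).map Assn.toks := by
  have h : Poly fun p : α × Instr => [(C p.1).inv.toks] :=
    (contractInv (hC.comp (fst id))).cons (const [])
  exact optionElim (instrAnns hT hC hM) h (by fun_prop)

theorem methodAnns {α : Type} [Enc α] {T : α → Hierarchy} {C : α → Contract} {M : α → MethodDef}
    (hT : Poly T) (hC : Poly C) (hM : Poly M) :
    Poly fun a => IRM.methodAnns (T a) (C a) (M a) := by
  have h : Poly fun a => (M a).code.flatMap fun i => i.asInvoke.elim [(C a).inv.toks] fun q =>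
      (IRM.blockAnns (T a) (C a) (M a).maxLocals q.1 q.2.1 q.2.2).map Assn.toks :=
    flatMap (chunkAnns hT hC hM) (methodCode hM)
  refine assnList_of_toks ?_
  convert h using 2 with a
  rw [IRM.methodAnns, List.map_flatMap]
  congr 1
  funext i
  cases i.asInvoke <;> rfl

theorem programMethodAnns (api : Api) :
    Poly fun p : ((Program × Contract) × ClassDef) × (MethodId × MethodDef) =>
      IRM.methodAnns (p.1.1.1.hierarchy api) p.1.1.2 p.2.2 :=
  methodAnns (by fun_prop) (by fun_prop) (by fun_prop)

theorem programClassAnns (api : Api) :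
    Poly fun p : (Program × Contract) × ClassDef => p.2.methods.map fun m =>
      IRM.methodAnns (p.1.1.hierarchy api) p.1.2 m.2 :=
  map (programMethodAnns api) (classMethods (snd id))

/-- The assertion arrays of all methods of a program can be computed in polynomial time. -/
theorem programAnns (api : Api) : Poly fun p : Program × Contract =>
    p.1.classes.map fun cd => cd.methods.map fun m => IRM.methodAnns (p.1.hierarchy api) p.2 m.2 :=
  map (programClassAnns api) (programClasses (fst id))

end Poly
end IRM

namespace IRM

/- ## Inlined code and ghost updates have the same effect -/

section
variable (I : Interp) (T : Hierarchy)

theorem Expr.eval_cond_pos {ρ : Env} {a : Assn} (e₁ e₂ : Expr) (h : a.holds I T ρ) :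
    (Expr.cond a e₁ e₂).eval I T ρ = e₁.eval I T ρ := by simp [Expr.eval, h]

theorem Expr.eval_cond_neg {ρ : Env} {a : Assn} (e₁ e₂ : Expr) (h : ¬ a.holds I T ρ) :
    (Expr.cond a e₁ e₂).eval I T ρ = e₂.eval I T ρ := by simp [Expr.eval, h]

theorem Expr.eval_cond_congr {ρ η : Env} {a b : Assn} {e₁ e₂ f₁ f₂ : Expr}
    (h : a.holds I T ρ ↔ b.holds I T η) (h₁ : e₁.eval I T ρ = f₁.eval I T η)
    (h₂ : e₂.eval I T ρ = f₂.eval I T η) :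
    (Expr.cond a e₁ e₂).eval I T ρ = (Expr.cond b f₁ f₂).eval I T η := by
  by_cases ha : a.holds I T ρ
  · rw [Expr.eval_cond_pos I T _ _ ha, Expr.eval_cond_pos I T _ _ (h.1 ha), h₁]
  · rw [Expr.eval_cond_neg I T _ _ ha, Expr.eval_cond_neg I T _ _ fun hb => ha (h.2 hb), h₂]

/-- Ghost expressions of a contract do not depend on the security state class. -/
theorem CExpr.eval_toGhost_congr {η : Env} {s : SField → Option DVal}
    (hs : ∀ c f, s (.user c f) = η.stat (.user c f)) (e : CExpr) :
    e.toGhost.eval I T { η with stat := s } = e.toGhost.eval I T η := by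
  induction e with
  | static c f => simp [CExpr.toGhost, Expr.eval, hs]
  | rel r a b iha ihb =>
    exact Expr.eval_cond_congr I T (by simp [Assn.holds, iha, ihb]) (by simp [Expr.int, Expr.eval])
      (by simp [Expr.int, Expr.eval])
  | _ => simp_all [CExpr.toGhost, Expr.eval]

theorem eval_clausesExpr_congr {η : Env} {s : SField → Option DVal}
    (hs : ∀ c f, s (.user c f) = η.stat (.user c f)) (x : ℕ) (l : List Clause) :
    (clausesExpr x l).eval I T { η with stat := s } = (clausesExpr x l).eval I T η := by
  induction l with
  | nil => simp [clausesExpr, Expr.eval]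
  | cons cl r ih =>
    have h : ∀ o : Option CExpr,
        ((o.map CExpr.toGhost).getD (.ghost (.ms x))).eval I T { η with stat := s } =
          ((o.map CExpr.toGhost).getD (.ghost (.ms x))).eval I T η := by
      rintro (_ | e)
      · simp [Expr.eval]
      · simp [CExpr.eval_toGhost_congr I T hs]
    exact Expr.eval_cond_congr I T (by
      simp [Assn.holds, Assn.eq, Expr.int, Expr.eval, CExpr.eval_toGhost_congr I T hs]) (h _) ih

theorem eval_deltaExpr_congr {η : Env} {s : SField → Option DVal}
    (hs : ∀ c f, s (.user c f) = η.stat (.user c f)) (x : ℕ) (l : Option (List Clause)) :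
    (deltaExpr x l).eval I T { η with stat := s } = (deltaExpr x l).eval I T η := by
  cases l with
  | none => simp [deltaExpr, Expr.eval]
  | some l =>
    exact Expr.eval_cond_congr I T (by simp [Assn.holds_eq, Expr.eval]) (by simp [Expr.eval])
      (eval_clausesExpr_congr I T hs x l)

theorem eval_ghostDispatch_congr {η : Env} {s : SField → Option DVal}
    (hs : ∀ c f, s (.user c f) = η.stat (.user c f)) (C : Contract) (ev : Event) (m : MethodId)
    (x : ℕ) (ds : List (Option ℕ × ℕ)) :
    (ghostDispatch C ev m x ds).eval I T { η with stat := s } =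
      (ghostDispatch C ev m x ds).eval I T η := by
  induction ds with
  | nil => simp [ghostDispatch, Expr.eval]
  | cons p r ih =>
    rcases p with ⟨_ | t, d⟩
    · simp only [ghostDispatch, eval_deltaExpr_congr I T hs]
    · exact Expr.eval_cond_congr I T (by simp [Assn.holds, Expr.eval])
        (eval_deltaExpr_congr I T hs _ _) ih

/-- The variables of the inlined code in `ρ` have the values of the ghost variables in `η`. -/
structure Agree (F : Frame) (k n : ℕ) (res : Prop) (ρ η : Env) : Prop where
  heap : ρ.heap = η.heap
  user : ∀ c f, ρ.stat (.user c f) = η.stat (.user c f)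
  state : ∀ x < k, ρ.stat (.sec x) = η.ghost (.ms x)
  param : ∀ i < n, ρ.loc (F.argReg i) = η.ghost (.arg i)
  target : F.hasTarget = true → ρ.loc F.base = η.ghost .tgt
  result : res → ρ.loc F.resReg = η.stack 0

variable {F : Frame} {k n : ℕ} {res : Prop} {ρ η : Env}

theorem Agree.eval (h : Agree F k n res ρ η) (e : CExpr) (he : e.WellFormed k n res) :
    (e.toLoc F).eval I T ρ = e.toGhost.eval I T η := by
  unfold CExpr.toLoc
  induction e with
  | state x => simpa [CExpr.toGhost, Expr.subst, Expr.eval, locSubst] using h.state x he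
  | param i => simpa [CExpr.toGhost, Expr.subst, Expr.eval, locSubst] using h.param i he
  | result => simpa [CExpr.toGhost, Expr.subst, Expr.eval, locSubst] using h.result he
  | lit l => simp [CExpr.toGhost, Expr.subst, Expr.eval]
  | static c f => simpa [CExpr.toGhost, Expr.subst, Expr.eval, locSubst] using h.user c f
  | field e f ih => simp [CExpr.toGhost, Expr.subst, Expr.eval, ih he, h.heap]
  | op o a b iha ihb => simp [CExpr.toGhost, Expr.subst, Expr.eval, iha he.1, ihb he.2]
  | rel r a b iha ihb =>
    exact Expr.eval_cond_congr I T (by simp [Assn.subst, Assn.holds, iha he.1, ihb he.2])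
      (by simp [Expr.int, Expr.subst, Expr.eval]) (by simp [Expr.int, Expr.subst, Expr.eval])

def Clause.WellFormed (k n : ℕ) (res : Prop) (cl : Clause) : Prop :=
  cl.guard.WellFormed k n res ∧ ∀ u ∈ cl.update, u.1 < k ∧ u.2.WellFormed k n res

theorem Contract.WellFormed.clauses {C : Contract} (hC : C.WellFormed) {ev : Event} {d : ℕ}
    {m : MethodId} {l : List Clause} (h : C.clauses ev d m = some l) :
    ∀ cl ∈ l, cl.WellFormed C.init.length m.arity (ev = .after) := by
  unfold Contract.clauses at h
  obtain ⟨r, hr, rfl⟩ := Option.map_eq_some_iff.1 h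
  have hp := List.find?_some hr
  simp only [decide_eq_true_eq] at hp
  obtain ⟨rfl, rfl, rfl⟩ := hp
  intro cl hcl
  obtain ⟨h1, -, h2⟩ := hC r (List.mem_of_find?_eq_some hr) cl hcl
  exact ⟨h1, h2⟩

/-- Replacing the values of the static fields. -/
theorem Agree.clauses (h : Agree F k n res ρ η) {D : Assn} {l : List Clause}
    (hl : ∀ cl ∈ l, cl.WellFormed k n res)
    (hD : ∀ s : SField → Option DVal, (∀ c f, s (.user c f) = ρ.stat (.user c f)) →
      (∀ x < k, s (.sec x) = (clausesExpr x l).eval I T η) →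
      D.holds I T { ρ with stat := s }) :
    (clausesWp F D l).holds I T ρ := by
  induction l with
  | nil => simp [clausesWp, Assn.holds]
  | cons cl r ih =>
    obtain ⟨hg, hu⟩ := hl cl List.mem_cons_self
    rw [clausesWp, Assn.holds_ite, Assn.holds_eq, h.eval I T _ hg]
    have hz : (Expr.int 0).eval I T ρ = (Expr.int 0).eval I T η := by simp [Expr.int, Expr.eval]
    rw [hz]
    constructor
    · intro h0
      refine ih (fun c hc => hl c (List.mem_cons_of_mem _ hc)) fun s hs hx => hD s hs fun x hk => ?_
      rw [clausesExpr, Expr.eval_cond_neg I T _ _ (by simpa [Assn.holds, Assn.holds_eq] using h0)]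
      exact hx x hk
    · intro h0
      rw [Assn.holds_subst]
      refine hD _ (fun c f => by simp [updateSubst, Expr.eval]) fun x hk => ?_
      rw [clausesExpr, Expr.eval_cond_pos I T _ _ (by simpa [Assn.holds, Assn.holds_eq] using h0)]
      simp only [updateSubst]
      rcases hx : cl.update.lookup x with _ | e
      · simpa [Expr.eval] using h.state x hk
      · have : (x, e) ∈ cl.update := by
          rw [List.lookup_eq_some_iff] at hx
          obtain ⟨l₁, l₂, h₁, -⟩ := hx
          simp [h₁]
        simpa using h.eval I T e (hu _ this).2

theorem Agree.section (h : Agree F k n res ρ η) {D : Assn} {o : Option (List Clause)}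
    (hl : ∀ l, o = some l → ∀ cl ∈ l, cl.WellFormed k n res)
    (hb : ∀ x < k, η.ghost (.ms x) ≠ some .bot)
    (hD : ∀ s : SField → Option DVal, (∀ c f, s (.user c f) = ρ.stat (.user c f)) →
      (∀ x < k, s (.sec x) = (deltaExpr x o).eval I T η) → D.holds I T { ρ with stat := s }) :
    (sectionWp F D o).holds I T ρ := by
  cases o with
  | none =>
    refine hD ρ.stat (fun _ _ => rfl) fun x hx => ?_
    simpa [deltaExpr, Expr.eval] using h.state x hx
  | some l =>
    refine h.clauses I T (hl l rfl) fun s hs hx => hD s hs fun x hk => ?_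
    rw [deltaExpr, Expr.eval_cond_neg I T _ _ (by simpa [Assn.holds_eq, Expr.eval] using hb x hk)]
    exact hx x hk

/-- If `D` holds after the update by the transition function of the contract, then its weakest
precondition under the inlined checks holds. -/
theorem Agree.checks {C : Contract} (hC : C.WellFormed) {ev : Event} {m : MethodId}
    (h : Agree F C.init.length m.arity (ev = .after) ρ η) {D : Assn} {ds : List (Option ℕ × ℕ)}
    (hds : F.hasTarget = true ∨ ∀ p ∈ ds, p.1 = none)
    (hb : ∀ x < C.init.length, η.ghost (.ms x) ≠ some .bot)
    (hD : ∀ s : SField → Option DVal, (∀ c f, s (.user c f) = ρ.stat (.user c f)) →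
      (∀ x < C.init.length, s (.sec x) = (ghostDispatch C ev m x ds).eval I T η) →
      D.holds I T { ρ with stat := s }) :
    (checksWp C ev m F D ds).holds I T ρ := by
  induction ds with
  | nil =>
    refine hD ρ.stat (fun _ _ => rfl) fun x hx => ?_
    simpa [ghostDispatch, Expr.eval] using h.state x hx
  | cons p r ih =>
    rcases p with ⟨_ | t, d⟩
    · exact h.section I T (fun l hl => hC.clauses hl) hb hD
    · have ht : ρ.loc F.base = η.ghost .tgt := by
        refine h.target (hds.resolve_right fun h' => ?_)
        simpa using h' _ List.mem_cons_self
      have hi : (Assn.inst (.loc F.base) t).holds I T ρ ↔ (Assn.inst (.ghost .tgt) t).holds I T η := by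
        simp [Assn.holds, Expr.eval, ht, h.heap]
      rw [checksWp, Assn.holds_ite, Assn.holds_eq]
      constructor
      · intro h0
        have hn : ¬ (Assn.inst (.loc F.base) t).holds I T ρ := fun hn => by
          rw [Expr.eval_cond_pos I T _ _ hn] at h0
          simp [Expr.int, Expr.eval] at h0
        refine ih (hds.imp_right fun h' p hp => h' p (List.mem_cons_of_mem _ hp))
          fun s hs hx => hD s hs fun x hk => ?_
        rw [ghostDispatch, Expr.eval_cond_neg I T _ _ (mt hi.2 hn)]
        exact hx x hk
      · intro h0
        have hn : (Assn.inst (.loc F.base) t).holds I T ρ := by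
          by_contra hn
          rw [Expr.eval_cond_neg I T _ _ hn] at h0
          exact h0 rfl
        refine h.section I T (fun l hl => hC.clauses hl) hb fun s hs hx => hD s hs fun x hk => ?_
        rw [ghostDispatch, Expr.eval_cond_pos I T _ _ (hi.1 hn)]
        exact hx x hk

theorem Hierarchy.dispatch_target (T : Hierarchy) (kd : InvokeKind) (c : ℕ) (m : MethodId)
    (base : ℕ) : (callFrame base kd m).hasTarget = true ∨ ∀ p ∈ T.dispatch kd c m, p.1 = none := by
  cases kd with
  | virtual => exact .inl rfl
  | special => exact .inl rfl
  | static =>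
    refine .inr fun p hp => ?_
    simp only [Hierarchy.dispatch] at hp
    split at hp
    · simp at hp
    · split_ifs at hp <;> simp at hp
      simp [hp]

theorem Contract.holds_inv (C : Contract) (ρ : Env) :
    C.inv.holds I T ρ ↔ ∀ x < C.init.length, ρ.stat (.sec x) = ρ.ghost (.ms x) := by
  rw [Contract.inv, Assn.holds_conj]
  simp [Assn.holds_eq, Expr.eval]

theorem Frame.holds_assn (F : Frame) (ρ : Env) : F.assn.holds I T ρ ↔
    (F.hasTarget = true → ρ.loc F.base = ρ.ghost .tgt) ∧
      ∀ i < F.nargs, ρ.loc (F.argReg i) = ρ.ghost (.arg i) := by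
  rw [Frame.assn, Assn.holds_conj]
  cases h : F.hasTarget <;> simp [Assn.holds_eq, Expr.eval]

end

section
variable {I : Interp} {T : Hierarchy} {C : Contract} {σ : Config} {base : ℕ} {kd : InvokeKind}
  {c : ℕ} {m : MethodId}

theorem Config.ghost_ne_bot (hσ : σ.Sat I T C.inv) :
    ∀ x < C.init.length, σ.toEnv.ghost (.ms x) ≠ some .bot := by
  intro x hx
  rw [← (C.holds_inv I T _).1 hσ x hx]
  simp [Config.toEnv]

/-- The monitor invariant is a precondition of the code that precedes a call. -/
theorem Config.sat_before (hC : C.WellFormed) (hσ : σ.Sat I T C.inv) :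
    σ.Sat I T (stepsWp (saveCode (callFrame base kd m)) (checksWp C .before m
      (callFrame base kd m) ((ghostArgs kd m).step ((ghostUpdate T C .before kd c m).step
        (C.inv.and (callFrame base kd m).assn))) (T.dispatch kd c m))) := by
  have hb := Config.ghost_ne_bot hσ
  have hi := (C.holds_inv I T _).1 hσ
  unfold Config.Sat
  rw [stepsWp_saveCode, Assn.holds_subst, ghostSubst_args, ghostSubst_update]
  set F := callFrame base kd m with hF
  set ρ := σ.toEnv.subst I T (saveSubst F) with hρ
  set θ : Subst := argsSubst kd m with hθ
  have htgt : F.hasTarget = true → ρ.loc F.base = (ρ.subst I T θ).ghost .tgt := by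
    intro h
    have h' : kd.hasTarget = true := h
    simp [hρ, hθ, argsSubst, Env.subst, saveSubst, h', Expr.eval, hF, callFrame]
  have harg : ∀ i < m.arity, ρ.loc (F.argReg i) = (ρ.subst I T θ).ghost (.arg i) := by
    intro i h
    have h1 : F.base < F.argReg i ∧ F.argReg i ≤ F.base + F.nargs := by
      simp only [Frame.argReg, hF, callFrame]
      omega
    simp only [hρ, hθ, argsSubst, Env.subst, saveSubst, h, h1, and_self, if_true, Expr.eval]
    congr 1
    simp only [Frame.argReg, hF, callFrame]
    omega
  have hag : Agree F C.init.length m.arity (Event.before = .after) ρ (ρ.subst I T θ) :=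
    { heap := rfl
      user := fun _ _ => by simp [Env.subst, hθ, argsSubst, Expr.eval]
      state := fun x hx => by
        simpa [Env.subst, hθ, argsSubst, hρ, saveSubst, Expr.eval] using hi x hx
      param := harg
      target := htgt
      result := fun h => by simp at h }
  refine hag.checks I T hC (T.dispatch_target kd c m base) (fun x hx => ?_) fun s hs hx => ?_
  · simpa [Env.subst, hθ, argsSubst, hρ, saveSubst, Expr.eval] using hb x hx
  · rw [Assn.holds_subst, Assn.holds_subst]
    have hη : ({ ρ with stat := s } : Env).subst I T θ = { ρ.subst I T θ with stat := s } := by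
      simp only [Env.subst, Env.mk.injEq, true_and]
      refine ⟨?_, ?_, ?_, ?_⟩ <;> funext y
      · simp [hθ, argsSubst, Expr.eval]
      · simp [hθ, argsSubst, Expr.eval]
      · simp [hθ, argsSubst, Expr.eval]
      · cases y <;> simp only [hθ, argsSubst]
        · simp [Expr.eval]
        · split_ifs <;> simp [Expr.eval]
        · split_ifs <;> simp [Expr.eval]
    rw [hη]
    refine ⟨?_, ?_⟩
    · rw [Contract.holds_inv]
      intro x hk
      have he := eval_ghostDispatch_congr I T (η := ρ.subst I T θ) (s := s)
        (fun c f => (hs c f).trans (hag.user c f)) C .before m x (T.dispatch kd c m)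
      simp only [Env.subst, hk, if_true, Expr.eval] at he ⊢
      rw [he]
      exact hx x hk
    · rw [Frame.holds_assn]
      refine ⟨fun h => ?_, fun i h => ?_⟩
      · exact htgt h
      · exact harg i h

/-- The precondition of the ghost update at the start of the exception handler. -/
theorem Config.sat_exceptional (hC : C.WellFormed)
    (hσ : σ.Sat I T (C.inv.and (callFrame base kd m).assn)) :
    σ.Sat I T ((ghostUpdate T C .exceptional kd c m).step (checksWp C .exceptional m
      (callFrame base kd m) C.inv (T.dispatch kd c m))) := by
  obtain ⟨hσ, hF⟩ := hσ
  have hb := Config.ghost_ne_bot hσ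
  have hi := (C.holds_inv I T _).1 hσ
  have hf := (Frame.holds_assn I T _ _).1 hF
  unfold Config.Sat
  rw [ghostSubst_update, Assn.holds_subst]
  refine Agree.checks I T (η := σ.toEnv) hC ?_ (T.dispatch_target kd c m base) hb
    fun s hs hx => ?_
  · exact
    { heap := rfl
      user := fun _ _ => rfl
      state := fun x hx => by simpa [Env.subst, Expr.eval] using hi x hx
      param := fun i h => by simpa [Env.subst, Expr.eval] using hf.2 i h
      target := fun h => by simpa [Env.subst, Expr.eval] using hf.1 h
      result := fun h => by simp at h }
  · rw [Contract.holds_inv]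
    intro x hk
    simp only [Env.subst, hk, if_true]
    exact hx x hk

/-- The precondition of the ghost update after a call. -/
theorem Config.sat_after (hC : C.WellFormed)
    (hσ : σ.Sat I T (C.inv.and (callFrame base kd m).assn)) :
    σ.Sat I T ((ghostUpdate T C .after kd c m).step
      (stepsWp [.astore (callFrame base kd m).resReg, .aload (callFrame base kd m).resReg]
        (checksWp C .after m (callFrame base kd m) C.inv (T.dispatch kd c m)))) := by
  obtain ⟨hσ, hF⟩ := hσ
  have hb := Config.ghost_ne_bot hσ
  have hi := (C.holds_inv I T _).1 hσ
  have hf := (Frame.holds_assn I T _ _).1 hF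
  unfold Config.Sat
  rw [ghostSubst_update, Assn.holds_subst]
  simp only [stepsWp, List.foldr_cons, List.foldr_nil, Instr.step, Assn.shift, Assn.push]
  rw [Assn.holds_subst, Assn.holds_subst, Assn.holds_subst]
  refine Agree.checks I T (η := σ.toEnv) hC ?_ (T.dispatch_target kd c m base) hb
    fun s hs hx => ?_
  · exact
    { heap := rfl
      user := fun _ _ => rfl
      state := fun x hx => by simpa [Env.subst, Expr.eval] using hi x hx
      param := fun i h => by
        have : (callFrame base kd m).argReg i ≠ (callFrame base kd m).resReg := by
          simp only [Frame.argReg, Frame.resReg, callFrame]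
          omega
        simpa [Env.subst, Expr.eval, this] using hf.2 i h
      target := fun h => by
        have : (callFrame base kd m).base ≠ (callFrame base kd m).resReg := by
          simp only [Frame.resReg, callFrame]
          omega
        simpa [Env.subst, Expr.eval, this] using hf.1 h
      result := fun _ => by simp [Env.subst, Expr.eval] }
  · rw [Contract.holds_inv]
    intro x hk
    simp only [Env.subst, Expr.eval, hk, if_true]
    exact hx x hk

end
end IRM

namespace IRM

/- ## The traversal computes the assertions that satisfy its equations -/

/-- Instructions that the traversal annotates with their weakest preconditions. -/
def Instr.Inner : Instr → Prop
  | .athrow | .dup | .ificmpeq _ | .invoke _ _ _ | .ret | .other _ _ _ => False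
  | _ => True

/-- The weakest precondition in terms of the assertions at jump targets and at the next label. -/
def Instr.wpAt (J : ℕ → Assn) (nxt : Assn) : Instr → Assn
  | .goto t => J t
  | .ifeq t => ifeqWp (J t) nxt
  | .exit => .tt
  | i => i.step nxt

/-- The successors of an instruction at label `p`. -/
def Instr.succsAt (p : ℕ) : Instr → List ℕ
  | .goto t => [t]
  | .ifeq t => [t, p + 1]
  | .exit => []
  | _ => [p + 1]

theorem wp_of_inner {M : MethodDef} {L : ℕ} {i : Instr} (h : M.code[L]? = some i) (hi : i.Inner)
    (A : List Assn) (pre post : Assn) :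
    wp M A pre post L = i.wpAt (asgn A) (asgn A (L + 1)) := by
  cases i <;> first | exact hi.elim | simp only [wp, h, Instr.wpAt, Instr.step, ifeqWp]

theorem succs_of_inner {M : MethodDef} {L : ℕ} {i : Instr} (h : M.code[L]? = some i)
    (hi : i.Inner) : M.succs L = i.succsAt L := by
  cases i <;> first | exact hi.elim | simp only [MethodDef.succs, h, Instr.succsAt]

theorem Instr.wpAt_congr {J J' : ℕ → Assn} {p : ℕ} (i : Instr)
    (h : ∀ s ∈ i.succsAt p, J s = J' s) : i.wpAt J (J (p + 1)) = i.wpAt J' (J' (p + 1)) := by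
  cases i <;> simp_all [Instr.succsAt, Instr.wpAt]

/-- The array `B` satisfies the equations of the traversal, which has no cycles. -/
structure Solves (inv : Assn) (M : MethodDef) (tags : List Tag) (B : List Assn) : Prop where
  length : B.length = M.code.length
  tags_length : tags.length = M.code.length
  eq : ∀ L < M.code.length, asgn B L = ((tags.getD L .client).fixed inv).getD (wp M B inv inv L)
  inner : ∀ L < M.code.length, (tags.getD L .client).fixed inv = none →
    ∃ i, M.code[L]? = some i ∧ i.Inner ∧ ∀ s ∈ i.succsAt L, L < s ∧ s < M.code.length

theorem Solves.annotatedByWp {inv : Assn} {M : MethodDef} {tags : List Tag} {B : List Assn}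
    (h : Solves inv M tags B) : AnnotatedByWp inv M tags B := by
  refine ⟨h.length, h.tags_length, fun L hL => ?_⟩
  rw [← h.eq L hL, asgn, List.getD_eq_getElem?_getD, List.getElem?_eq_getElem (h.length ▸ hL)]
  rfl

theorem Solves.iterate {inv : Assn} {M : MethodDef} {tags : List Tag} {B : List Assn}
    (h : Solves inv M tags B) (j : ℕ) :
    ∀ A, A = (annotateLevel inv M tags)^[j] (List.replicate M.code.length none) →
      A.length = M.code.length ∧ ∀ L < M.code.length,
        (∀ a, A.getD L none = some a → a = asgn B L) ∧
        (M.code.length ≤ L + j → (A.getD L none).isSome) := by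
  induction j with
  | zero =>
    rintro A rfl
    refine ⟨by simp, fun L hL => ⟨fun a ha => ?_, fun h' => absurd h' (by omega)⟩⟩
    simp at ha
  | succ j ih =>
    rintro _ rfl
    rw [Function.iterate_succ_apply']
    obtain ⟨hlen, hA⟩ := ih _ rfl
    generalize (annotateLevel inv M tags)^[j] (List.replicate M.code.length none) = A at hlen hA
    refine ⟨by simp [annotateLevel], fun L hL => ?_⟩
    obtain ⟨hA₁, hA₂⟩ := hA L hL
    have hget : (annotateLevel inv M tags A).getD L none =
        match A.getD L none, (tags.getD L .client).fixed inv with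
        | some a, _ => some a
        | none, some a => some a
        | none, none =>
            if (M.succs L).all fun s => (A.getD s none).isSome then
              some (wp M (A.map fun a => a.getD .ff) inv inv L)
            else none := by
      unfold annotateLevel
      rw [List.getD_eq_getElem?_getD, List.getElem?_map, List.getElem?_range hL]
      rfl
    have heq := h.eq L hL
    rw [hget]
    rcases hAL : A.getD L none with _ | a
    · rcases hf : (tags.getD L .client).fixed inv with _ | b
      · obtain ⟨i, hi, hin, hs⟩ := h.inner L hL hf
        rw [hf, Option.getD_none, wp_of_inner hi hin] at heq
        dsimp only
        rw [succs_of_inner hi hin, wp_of_inner hi hin]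
        refine ⟨fun a ha => ?_, fun hj => ?_⟩
        · split_ifs at ha with hall
          rw [Option.some.injEq] at ha
          rw [← ha, heq]
          refine Instr.wpAt_congr i fun s hsi => ?_
          have hso := List.all_eq_true.1 hall s hsi
          obtain ⟨b, hb⟩ := Option.isSome_iff_exists.1 hso
          rw [← (hA s (hs s hsi).2).1 b hb]
          have hlt : s < A.length := hlen ▸ (hs s hsi).2
          simp only [List.getD_eq_getElem?_getD, List.getElem?_eq_getElem hlt,
            Option.getD_some] at hb
          simp [asgn, List.getD_eq_getElem?_getD, List.getElem?_eq_getElem hlt, hb]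
        · rw [if_pos]
          · rfl
          · refine List.all_eq_true.2 fun s hsi => ?_
            have := hs s hsi
            exact (hA s this.2).2 (by omega)
      · rw [hf] at heq
        exact ⟨fun a ha => by simp_all, fun _ => rfl⟩
    · exact ⟨fun b hb => hA₁ b (hAL.trans hb), fun _ => rfl⟩

theorem Solves.annotate {inv : Assn} {M : MethodDef} {tags : List Tag} {B : List Assn}
    (h : Solves inv M tags B) : annotate inv M tags = B := by
  obtain ⟨hlen, hA⟩ := h.iterate M.code.length _ rfl
  unfold IRM.annotate
  generalize (annotateLevel inv M tags)^[M.code.length] (List.replicate M.code.length none) = A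
    at hlen hA ⊢
  refine List.ext_getElem (by simp [hlen, h.length]) fun L h₁ h₂ => ?_
  have hL : L < M.code.length := h.length ▸ h₂
  obtain ⟨b, hb⟩ := Option.isSome_iff_exists.1 ((hA L hL).2 (Nat.le_add_left _ _))
  have hB := (hA L hL).1 b hb
  have hlt : L < A.length := hlen ▸ hL
  simp only [List.getD_eq_getElem?_getD, List.getElem?_eq_getElem hlt, Option.getD_some] at hb
  rw [asgn, List.getD_eq_getElem?_getD, List.getElem?_eq_getElem h₂] at hB
  simp [hb, hB]

/- ## Annotated segments of code -/

/-- The relation `R` holds for every instruction of a segment at address `p`, its address, its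
assertion, and the assertion at the next label, which is `D` at the end. -/
inductive Seg {ι : Type} (R : ℕ → ι → Assn → Assn → Prop) (D : Assn) :
    ℕ → List ι → List Assn → Prop where
  | nil (p : ℕ) : Seg R D p [] []
  | cons {p : ℕ} {i : ι} {a : Assn} {l : List ι} {as : List Assn} (h : R p i a (as.headD D))
      (ht : Seg R D (p + 1) l as) : Seg R D p (i :: l) (a :: as)

section
variable {ι : Type} {R : ℕ → ι → Assn → Assn → Prop} {D : Assn} {p : ℕ} {l l' : List ι}
  {as bs : List Assn}

theorem Seg.length_eq (h : Seg R D p l as) : as.length = l.length := by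
  induction h with
  | nil => rfl
  | cons _ _ ih => simp [ih]

theorem Seg.append (h : Seg R (bs.headD D) p l as) (h' : Seg R D (p + l.length) l' bs) :
    Seg R D p (l ++ l') (as ++ bs) := by
  induction h with
  | nil => simpa using h'
  | @cons p i a l as hR _ ih =>
    refine .cons ?_ (ih ?_)
    · cases as <;> simpa using hR
    · rwa [List.length_cons, Nat.add_comm l.length, ← Nat.add_assoc] at h'

theorem Seg.singleton {i : ι} {a : Assn} (h : R p i a D) : Seg R D p [i] [a] := .cons h (.nil _)

theorem Seg.get (h : Seg R D p l as) {j : ℕ} {i : ι} (hj : l[j]? = some i) :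
    ∃ a, as[j]? = some a ∧ R (p + j) i a (as.getD (j + 1) D) := by
  induction h generalizing j with
  | nil => simp at hj
  | @cons p i' a l as hR _ ih =>
    cases j with
    | zero =>
      simp only [List.getElem?_cons_zero, Option.some.injEq] at hj
      subst hj
      refine ⟨a, rfl, ?_⟩
      cases as <;> simpa using hR
    | succ j =>
      rw [List.getElem?_cons_succ] at hj
      obtain ⟨b, hb, hR'⟩ := ih hj
      refine ⟨b, by simpa using hb, ?_⟩
      rw [Nat.add_right_comm, Nat.add_assoc] at hR'
      simpa using hR'

end

/-- The labels from `p` on carry the assertions `as`. -/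
def Carries (J : ℕ → Assn) (p : ℕ) (as : List Assn) : Prop := ∀ j a, as[j]? = some a → J (p + j) = a

/-- The labels after `p` carry the assertions `as` except the first. -/
def CarriesTail (J : ℕ → Assn) (p : ℕ) (as : List Assn) : Prop :=
  ∀ j a, 0 < j → as[j]? = some a → J (p + j) = a

section
variable {J : ℕ → Assn} {p : ℕ} {as bs : List Assn}

theorem Carries.left (h : Carries J p (as ++ bs)) : Carries J p as := by
  intro j a ha
  have hj : j < as.length := (List.getElem?_eq_some_iff.1 ha).1
  exact h j a (by rwa [List.getElem?_append_left hj])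

theorem Carries.right (h : Carries J p (as ++ bs)) : Carries J (p + as.length) bs := by
  intro j a ha
  rw [Nat.add_assoc]
  exact h _ a (by rwa [List.getElem?_append_right (Nat.le_add_right _ _), Nat.add_sub_cancel_left])

theorem Carries.headD {D : Assn} (h : Carries J p as) (hD : J (p + as.length) = D) :
    J p = as.headD D := by
  cases as with
  | nil => exact hD
  | cons b r => exact h 0 b rfl

theorem Carries.toTail (h : Carries J p as) : CarriesTail J p as := fun j a _ ha => h j a ha

theorem CarriesTail.left (h : CarriesTail J p (as ++ bs)) : CarriesTail J p as := by
  intro j a h0 ha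
  have hj : j < as.length := (List.getElem?_eq_some_iff.1 ha).1
  exact h j a h0 (by rwa [List.getElem?_append_left hj])

theorem CarriesTail.right (h : CarriesTail J p (as ++ bs)) :
    CarriesTail J (p + as.length) bs := by
  intro j a h0 ha
  rw [Nat.add_assoc]
  exact h _ a (Nat.add_pos_right _ h0)
    (by rwa [List.getElem?_append_right (Nat.le_add_right _ _), Nat.add_sub_cancel_left])

theorem CarriesTail.tail {a : Assn} (h : CarriesTail J p (a :: as)) : Carries J (p + 1) as := by
  intro j b hb
  rw [Nat.add_right_comm]
  exact h (j + 1) b j.succ_pos hb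

theorem Carries.tail {a : Assn} (h : Carries J p (a :: as)) : Carries J (p + 1) as :=
  h.toTail.tail

end

/-- What is required of an instruction with a tag: fixed assertions satisfy `V`, all others are
weakest preconditions, and their successors are ahead. -/
structure Checked (inv : Assn) (J : ℕ → Assn) (n : ℕ) (V : ℕ → Instr → Assn → Assn → Prop) (p : ℕ)
    (x : Instr × Tag) (a nxt : Assn) : Prop where
  fixed : ∀ b, x.2.fixed inv = some b → a = b ∧ V p x.1 a nxt
  inner : x.2.fixed inv = none →
    x.1.Inner ∧ (∀ s ∈ x.1.succsAt p, p < s ∧ s < n) ∧ a = x.1.wpAt J nxt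

/-- Instructions whose only successor is the next one. -/
def Instr.Straight : Instr → Prop
  | .goto _ | .ifeq _ | .exit => False
  | i => i.Inner

section
variable {inv D X : Assn} {J : ℕ → Assn} {n p : ℕ} {V : ℕ → Instr → Assn → Assn → Prop}

theorem Checked.of_inner {i : Instr} {a nxt : Assn} (hi : i.Inner)
    (hs : ∀ s ∈ i.succsAt p, p < s ∧ s < n) (ha : a = i.wpAt J nxt) :
    Checked inv J n V p (i, .inner) a nxt :=
  ⟨fun _ h => by simp [Tag.fixed] at h, fun _ => ⟨hi, hs, ha⟩⟩

theorem Checked.of_fixed {i : Instr} {t : Tag} {a nxt : Assn} (ht : t.fixed inv = some a)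
    (hV : V p i a nxt) : Checked inv J n V p (i, t) a nxt :=
  ⟨fun b hb => ⟨by simpa [ht] using hb, hV⟩, fun h => by simp [ht] at h⟩

theorem headD_stepsAnns_append (is : List Instr) (A : Assn) (as : List Assn) (h : as.headD D = A) :
    (stepsAnns is A ++ as).headD D = stepsWp is A := by
  cases is with
  | nil => simpa [stepsAnns, stepsWp] using h
  | cons i r => rfl

theorem Seg.steps {is : List Instr} (hs : ∀ i ∈ is, i.Straight) (hp : p + is.length < n) :
    Seg (Checked inv J n V) D p (is.map fun i => (i, .inner)) (stepsAnns is D) := by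
  induction is generalizing p with
  | nil => exact .nil _
  | cons i r ih =>
    rw [List.length_cons] at hp
    have hi := hs i List.mem_cons_self
    refine .cons (.of_inner ?_ ?_ ?_)
      (ih (fun j hj => hs j (List.mem_cons_of_mem _ hj)) (by omega))
    · cases i <;> first | exact hi | exact hi.elim
    · have : i.succsAt p = [p + 1] := by cases i <;> first | rfl | exact hi.elim
      simp only [this, List.mem_singleton]
      omega
    · have h := headD_stepsAnns_append (D := D) r D [] rfl
      rw [List.append_nil] at h
      rw [h]
      cases i <;> first | rfl | exact hi.elim

theorem CExpr.compile_straight (F : Frame) (e : CExpr) : ∀ i ∈ e.compile F, i.Straight := by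
  induction e with
  | _ => simp_all [CExpr.compile, or_imp, Instr.Straight, Instr.Inner]

theorem compileUpdate_straight (F : Frame) (u : List (ℕ × CExpr)) :
    ∀ i ∈ compileUpdate F u, i.Straight := by
  intro i hi
  simp only [compileUpdate, List.mem_append, List.mem_flatMap, List.mem_map] at hi
  rcases hi with ⟨q, -, hi⟩ | ⟨q, -, rfl⟩
  · exact CExpr.compile_straight F _ i hi
  · trivial

theorem saveCode_straight (F : Frame) : ∀ i ∈ saveCode F, i.Straight := by
  intro i hi
  simp only [saveCode, List.mem_append, List.mem_map] at hi
  rcases hi with (⟨q, -, rfl⟩ | hi) | ⟨q, -, rfl⟩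
  · trivial
  · split_ifs at hi <;> simp at hi
    rcases hi with rfl | rfl <;> trivial
  · trivial

/-- Code relabelled by `f`, all of whose instructions are inner ones. -/
def innerCode (f : ℕ → ℕ) (is : List Instr) : List (Instr × Tag) :=
  is.map fun i => (i.relabel f, .inner)

theorem innerCode_straight (f : ℕ → ℕ) {is : List Instr} (h : ∀ i ∈ is, i.Straight) :
    innerCode f is = is.map fun i => (i, .inner) := by
  refine List.map_congr_left fun i hi => ?_
  have := h i hi
  cases i <;> first | rfl | exact this.elim

theorem innerCode_append (f : ℕ → ℕ) (l l' : List Instr) :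
    innerCode f (l ++ l') = innerCode f l ++ innerCode f l' := List.map_append

theorem innerCode_cons (f : ℕ → ℕ) (i : Instr) (l : List Instr) :
    innerCode f (i :: l) = (i.relabel f, .inner) :: innerCode f l := rfl

theorem length_innerCode (f : ℕ → ℕ) (l : List Instr) : (innerCode f l).length = l.length :=
  List.length_map ..

theorem headD_clausesAnns (F : Frame) (l : List Clause) :
    (clausesAnns F D l).headD X = clausesWp F D l := by
  cases l with
  | nil => rfl
  | cons cl r =>
    rw [clausesAnns, clausesWp, List.append_assoc, headD_stepsAnns_append _ _ _ (by rfl),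
      stepsWp_compile, push_ifeqWp]

theorem clausesAnns_ne_nil (F : Frame) (D : Assn) (l : List Clause) : clausesAnns F D l ≠ [] := by
  cases l <;> simp [clausesAnns]

theorem length_clausesCode (F : Frame) (D : Assn) (done st : ℕ) (l : List Clause) :
    (clausesCode F done st l).length = (clausesAnns F D l).length := by
  induction l generalizing st with
  | nil => rfl
  | cons cl r ih => simp [clausesCode, clausesAnns, length_stepsAnns, ih]

theorem Seg.clauses {f : ℕ → ℕ} {F : Frame} {done : ℕ} (hD : J (f done) = D) (hn : f done < n)
    (l : List Clause) {st : ℕ} (hst : ∀ j, 0 < j → j ≤ (clausesAnns F D l).length →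
      f (st + j) = p + j)
    (hdone : p + (clausesAnns F D l).length ≤ f done) (hJ : CarriesTail J p (clausesAnns F D l)) :
    Seg (Checked inv J n V) X p (innerCode f (clausesCode F done st l)) (clausesAnns F D l) := by
  induction l generalizing p st with
  | nil =>
    simp only [clausesAnns, List.length_cons, List.length_nil] at hdone
    refine .cons (.of_inner trivial ?_ rfl) (.singleton (.of_inner trivial ?_ rfl))
    · intro s hs
      simp only [Instr.succsAt, Instr.relabel, List.mem_singleton] at hs
      omega
    · simp [Instr.succsAt, Instr.relabel]
  | cons cl r ih =>
    set u := compileUpdate F cl.update with hu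
    set g := cl.guard.compile F with hg
    set j := ifeqWp (clausesWp F D r) (D.subst (updateSubst F cl.update)) with hj
    have hanns : clausesAnns F D (cl :: r) =
        stepsAnns g j ++ (j :: (stepsAnns u D ++ (D :: clausesAnns F D r))) := by
      rw [clausesAnns]
      simp [hu, hg, hj]
    have hlen : (clausesAnns F D (cl :: r)).length =
        g.length + (1 + u.length + 1 + (clausesAnns F D r).length) := by
      rw [hanns]
      simp [length_stepsAnns]
      omega
    have hpos := List.length_pos_iff.2 (clausesAnns_ne_nil F D r)
    have hgs : ∀ i ∈ g, i.Straight := CExpr.compile_straight F _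
    have hus : ∀ i ∈ u, i.Straight := compileUpdate_straight F _
    rw [hlen] at hst hdone
    have hnext := hst (g.length + 1 + u.length + 1) (by omega) (by omega)
    rw [hanns] at hJ ⊢
    have hJr := hJ.right.tail.right.tail
    simp only [length_stepsAnns] at hJr
    have hcode : innerCode f (clausesCode F done st (cl :: r)) =
        (g.map fun i => (i, .inner)) ++ ((.ifeq (p + (g.length + 1 + u.length + 1)), .inner) ::
          ((u.map fun i => (i, .inner)) ++ ((.goto (f done), .inner) ::
            innerCode f (clausesCode F done (st + g.length + 1 + u.length + 1) r)))) := by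
      rw [clausesCode, ← hnext]
      simp only [innerCode_append, innerCode_cons, innerCode_straight f hgs,
        innerCode_straight f hus, ← hg, ← hu, List.append_assoc, List.cons_append, List.nil_append,
        Nat.add_assoc, Instr.relabel]
    rw [hcode]
    refine Seg.append ?_ (.cons (.of_inner trivial ?_ ?_) (Seg.append ?_ (.cons
      (.of_inner trivial ?_ ?_) ?_)))
    · exact Seg.steps hgs (by omega)
    · simp only [Instr.succsAt, List.length_map, List.mem_cons, List.not_mem_nil, or_false]
      omega
    · rw [headD_stepsAnns_append _ _ _ (by rfl), stepsWp_compileUpdate, hj, Instr.wpAt]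
      congr 1
      rw [← headD_clausesAnns (X := J _), ← hJr.headD rfl]
      congr 1
      omega
    · refine Seg.steps hus ?_
      simp only [List.length_map]
      omega
    · simp only [Instr.succsAt, List.length_map, List.mem_singleton]
      omega
    · exact hD.symm
    · refine ih ?_ ?_ ?_
      · intro i hi hil
        rw [show st + g.length + 1 + u.length + 1 + i = st + (g.length + 1 + u.length + 1 + i) by
          omega, hst _ (by omega) (by omega)]
        simp only [List.length_map]
        omega
      · simp only [List.length_map]
        omega
      · simpa only [List.length_map] using hJr.toTail

theorem headD_sectionAnns (F : Frame) (l : Option (List Clause)) :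
    (sectionAnns F D l).headD X = sectionWp F D l := by
  cases l with
  | none => rfl
  | some l => exact headD_clausesAnns F l

theorem sectionAnns_ne_nil (F : Frame) (D : Assn) (l : Option (List Clause)) :
    sectionAnns F D l ≠ [] := by
  cases l with
  | none => simp [sectionAnns]
  | some l => exact clausesAnns_ne_nil F D l

theorem length_sectionCode (F : Frame) (D : Assn) (done st : ℕ) (l : Option (List Clause)) :
    (sectionCode F done st l).length = (sectionAnns F D l).length := by
  cases l with
  | none => rfl
  | some l => exact length_clausesCode F D done st l

theorem Seg.section {f : ℕ → ℕ} {F : Frame} {done : ℕ} (hD : J (f done) = D) (hn : f done < n)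
    (l : Option (List Clause)) {st : ℕ} (hst : ∀ j, 0 < j → j ≤ (sectionAnns F D l).length →
      f (st + j) = p + j)
    (hdone : p + (sectionAnns F D l).length ≤ f done) (hJ : CarriesTail J p (sectionAnns F D l)) :
    Seg (Checked inv J n V) X p (innerCode f (sectionCode F done st l)) (sectionAnns F D l) := by
  cases l with
  | none =>
    refine .singleton (.of_inner trivial ?_ hD.symm)
    simp only [Instr.relabel, Instr.succsAt, List.mem_singleton]
    simp only [sectionAnns, List.length_singleton] at hdone
    omega
  | some l => exact Seg.clauses hD hn l hst hdone hJ

theorem headD_checksAnns (C : Contract) (ev : Event) (m : MethodId) (F : Frame)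
    (ds : List (Option ℕ × ℕ)) {as : List Assn} (has : as.headD X = D) :
    (checksAnns C ev m F D ds ++ as).headD X = checksWp C ev m F D ds := by
  rcases ds with _ | ⟨⟨_ | t, d⟩, r⟩
  · exact has
  · rw [checksAnns, checksWp]
    rw [← headD_sectionAnns (X := X)]
    have := sectionAnns_ne_nil F D (C.clauses ev d m)
    cases h : sectionAnns F D (C.clauses ev d m) with
    | nil => exact absurd h this
    | cons a r => rfl
  · rw [checksAnns, checksWp, List.append_assoc, List.append_assoc,
      headD_stepsAnns_append _ _ _ (by rfl)]
    simp only [stepsWp, List.foldr_cons, List.foldr_nil, Instr.step]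
    rw [← push_ifeqWp]
    unfold Assn.push Assn.setTop
    rw [Assn.subst_subst]
    congr 1
    refine Subst.ext' (fun i => ?_) (fun _ => rfl) (fun _ => rfl) fun _ => rfl
    cases i <;> rfl

theorem length_checksCode (C : Contract) (ev : Event) (m : MethodId) (F : Frame) (D : Assn)
    (done st : ℕ) (ds : List (Option ℕ × ℕ)) :
    (checksCode C ev m F done st ds).length = (checksAnns C ev m F D ds).length := by
  induction ds generalizing st with
  | nil => rfl
  | cons p r ih =>
    rcases p with ⟨_ | t, d⟩
    · simp [checksCode, checksAnns, length_sectionCode F D, ih]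
    · simp [checksCode, checksAnns, length_sectionCode F D, ih, length_stepsAnns]
      omega

theorem Seg.checks {f : ℕ → ℕ} {C : Contract} {ev : Event} {m : MethodId} {F : Frame} {done : ℕ}
    (ds : List (Option ℕ × ℕ)) {st : ℕ}
    (hst : ∀ j, 0 < j → j ≤ (checksAnns C ev m F D ds).length → f (st + j) = p + j)
    (hdone : done = st + (checksAnns C ev m F D ds).length)
    (hn : p + (checksAnns C ev m F D ds).length < n)
    (hD : J (p + (checksAnns C ev m F D ds).length) = D)
    (hJ : CarriesTail J p (checksAnns C ev m F D ds)) :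
    Seg (Checked inv J n V) X p (innerCode f (checksCode C ev m F done st ds))
      (checksAnns C ev m F D ds) := by
  induction ds generalizing p st with
  | nil => exact .nil _
  | cons q r ih =>
    rcases q with ⟨_ | t, d⟩
    · set s := C.clauses ev d m with hs
      have hpos := List.length_pos_iff.2 (sectionAnns_ne_nil F D s)
      have hlen : (checksAnns C ev m F D ((none, d) :: r)).length =
          (sectionAnns F D s).length + (checksAnns C ev m F D r).length := by
        simp [checksAnns, hs]
      rw [hlen] at hst hdone hn hD
      have hfd : f done = p + ((sectionAnns F D s).length + (checksAnns C ev m F D r).length) := by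
        rw [hdone]
        exact hst _ (by omega) (by omega)
      rw [checksAnns] at hJ ⊢
      rw [checksCode, innerCode_append]
      refine Seg.append (Seg.section (D := D) (by rw [hfd, hD]) (by omega) _ (fun j h1 h2 => hst j h1 ?_) ?_ hJ.left)
        (ih ?_ ?_ ?_ ?_ ?_)
      · exact le_trans h2 (Nat.le_add_right _ _)
      · rw [hfd, ← hs]
        omega
      · intro j h1 h2
        rw [length_innerCode, length_sectionCode F D, ← hs, Nat.add_assoc, Nat.add_assoc]
        exact hst _ (by omega) (by omega)
      · rw [length_sectionCode F D, ← hs]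
        omega
      · rw [length_innerCode, length_sectionCode F D, ← hs]
        omega
      · rw [length_innerCode, length_sectionCode F D, ← hs, Nat.add_assoc]
        exact hD
      · rw [length_innerCode, length_sectionCode F D]
        exact hJ.right
    · set s := C.clauses ev d m with hs
      set k := ifeqWp (checksWp C ev m F D r) (sectionWp F D s) with hk
      have hanns : checksAnns C ev m F D ((some t, d) :: r) =
          stepsAnns [.aload F.base, .instanceof t] k ++ (k :: (sectionAnns F D s ++
            checksAnns C ev m F D r)) := by
        rw [checksAnns]
        simp [hs, hk]
      have hlen : (checksAnns C ev m F D ((some t, d) :: r)).length =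
          3 + (sectionAnns F D s).length + (checksAnns C ev m F D r).length := by
        rw [hanns]
        simp [length_stepsAnns]
        omega
      rw [hlen] at hst hdone hn hD
      rw [hanns] at hJ ⊢
      have hJs := hJ.right.tail
      rw [length_stepsAnns] at hJs
      have hJr := hJs.right
      have hfd : f done = p + (3 + (sectionAnns F D s).length + (checksAnns C ev m F D r).length) := by
        rw [hdone]
        exact hst _ (by omega) le_rfl
      have hnext := hst (3 + (sectionAnns F D s).length) (by omega) (by omega)
      have hcode : innerCode f (checksCode C ev m F done st ((some t, d) :: r)) =
          (([.aload F.base, .instanceof t] : List Instr).map fun i => (i, .inner)) ++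
            ((.ifeq (p + (3 + (sectionAnns F D s).length)), .inner) ::
              (innerCode f (sectionCode F done (st + 3) s) ++ innerCode f (checksCode C ev m F done
                (st + 3 + (sectionAnns F D s).length) r))) := by
        rw [checksCode, ← hnext]
        simp only [innerCode_append, innerCode_cons, List.map_cons, List.map_nil,
          List.cons_append, List.nil_append, Nat.add_assoc, Instr.relabel, length_sectionCode F D,
          ← hs]
      rw [hcode]
      have hJn : J (p + (3 + (sectionAnns F D s).length)) = checksWp C ev m F D r := by
        have hhead := headD_checksAnns (X := D) (D := D) C ev m F r (as := []) rfl
        rw [List.append_nil] at hhead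
        rw [← hhead]
        rw [← hJr.headD (by
          simp only [List.length_cons, List.length_nil]
          exact (congrArg J (by omega)).trans hD)]
        congr 1
        simp only [List.length_cons, List.length_nil]
        omega
      refine Seg.append (Seg.steps ?_ ?_) (.cons (.of_inner trivial ?_ ?_)
        (Seg.append (Seg.section (D := D) (by rw [hfd, hD]) (by omega) _ ?_ ?_ ?_) (ih ?_ ?_ ?_ ?_ ?_)))
      · simp [Instr.Straight, Instr.Inner]
      · simp only [List.length_cons, List.length_nil]
        omega
      · simp only [Instr.succsAt, List.length_map, List.mem_cons, List.not_mem_nil, or_false,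
          List.length_cons, List.length_nil]
        omega
      · rw [Instr.wpAt, hJn, hk]
        congr 1
        rw [← headD_sectionAnns (X := X)]
        have := sectionAnns_ne_nil F D s
        cases h : sectionAnns F D s with
        | nil => exact absurd h this
        | cons a r => rfl
      · intro j h1 h2
        simp only [List.length_map, List.length_cons, List.length_nil]
        rw [Nat.add_assoc, hst _ (by omega) (by omega)]
        omega
      · simp only [List.length_map, List.length_cons, List.length_nil]
        omega
      · exact hJs.left.toTail
      · intro j h1 h2
        simp only [List.length_map, List.length_cons, List.length_nil, length_innerCode,
          length_sectionCode F D]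
        rw [Nat.add_assoc, Nat.add_assoc, hst _ (by omega) (by omega)]
        omega
      · omega
      · simp only [List.length_map, List.length_cons, List.length_nil, length_innerCode,
          length_sectionCode F D]
        omega
      · simp only [List.length_map, List.length_cons, List.length_nil, length_innerCode,
          length_sectionCode F D]
        exact (congrArg J (by omega)).trans hD
      · simpa only [List.length_map, List.length_cons, List.length_nil, length_innerCode,
          length_sectionCode F D] using hJr.toTail

end
end IRM

namespace IRM

/- ## The code with embedded ghost updates -/

/-- The ghost update at the start of the handler for the call `o`. -/
def excUpdate (T : Hierarchy) (C : Contract) (o : Option Instr) (μ : Mark) : List (Instr × Tag) :=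
  match o with
  | some (.invoke k c m) => [(ghostUpdate T C .exceptional k c m, μ.callTag)]
  | _ => []

/-- An instruction with the ghost updates around it. -/
def ghostMain (T : Hierarchy) (C : Contract) (i : Instr) (μ : Mark) : List (Instr × Tag) :=
  match i with
  | .invoke k c m =>
      [(ghostArgs k m, μ.tag), (ghostUpdate T C .before k c m, .inner),
        (.invoke k c m, μ.callTag), (ghostUpdate T C .after k c m, μ.callTag)]
  | _ => [(i, μ.tag)]

/-- Embedding of ghost updates into code whose handlers for calls start four instructions after
the calls; `back` is the preceding code in reverse order. -/
def ghostWalk (T : Hierarchy) (C : Contract) (f : ℕ → ℕ) :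
    List Instr → List (Instr × Mark) → List (Instr × Tag)
  | _, [] => []
  | back, x :: r =>
      ((excUpdate T C back[3]? x.2 ++ ghostMain T C x.1 x.2).map fun y => (y.1.relabel f, y.2)) ++
        ghostWalk T C f (x.1 :: back) r

/-- The length of code with ghost updates. -/
def walkLen : List Instr → List Instr → ℕ
  | _, [] => 0
  | back, i :: r =>
      ((back[3]?.bind Instr.asInvoke).elim 0 fun _ => 1) + (i.asInvoke.elim 1 fun _ => 4) +
        walkLen (i :: back) r

section
variable {T : Hierarchy} {C : Contract} {f : ℕ → ℕ} {back : List Instr}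

theorem ghostWalk_append (l l' : List (Instr × Mark)) : ghostWalk T C f back (l ++ l') =
    ghostWalk T C f back l ++ ghostWalk T C f ((l.map Prod.fst).reverse ++ back) l' := by
  induction l generalizing back with
  | nil => rfl
  | cons x r ih => simp [ghostWalk, ih]

theorem walkLen_append (l l' : List Instr) :
    walkLen back (l ++ l') = walkLen back l + walkLen (l.reverse ++ back) l' := by
  induction l generalizing back with
  | nil => simp [walkLen]
  | cons x r ih => simp [walkLen, ih, Nat.add_assoc]

theorem length_excUpdate (o : Option Instr) (μ : Mark) :
    (excUpdate T C o μ).length = (o.bind Instr.asInvoke).elim 0 fun _ => 1 := by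
  cases o with
  | none => rfl
  | some i => cases i <;> rfl

theorem length_ghostMain (i : Instr) (μ : Mark) :
    (ghostMain T C i μ).length = i.asInvoke.elim 1 fun _ => 4 := by
  cases i <;> rfl

/-- None of the last four instructions is a call. -/
def Calm (back : List Instr) : Prop := ∀ j < 4, back[j]?.bind Instr.asInvoke = none

theorem Calm.cons (h : Calm back) {i : Instr} (hi : i.asInvoke = none) : Calm (i :: back) := by
  intro j hj
  cases j with
  | zero => exact hi
  | succ j => exact h j (by omega)

theorem calm_append {l : List Instr} (hl : ∀ i ∈ l, i.asInvoke = none)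
    (h : 4 ≤ l.length ∨ Calm back) : Calm (l ++ back) := by
  intro j hj
  rcases Nat.lt_or_ge j l.length with hlt | hge
  · rw [List.getElem?_append_left hlt, List.getElem?_eq_getElem hlt]
    exact hl _ (List.getElem_mem hlt)
  · rw [List.getElem?_append_right hge]
    exact (h.resolve_left (by omega)) _ (by omega)

theorem excUpdate_eq_nil {o : Option Instr} (ho : o.bind Instr.asInvoke = none) (μ : Mark) :
    excUpdate T C o μ = [] := by
  rw [← List.length_eq_zero_iff, length_excUpdate, ho]
  rfl

theorem ghostMain_eq {i : Instr} (hi : i.asInvoke = none) (μ : Mark) :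
    ghostMain T C i μ = [(i, μ.tag)] := by
  cases i <;> first | rfl | simp [Instr.asInvoke] at hi

theorem ghostWalk_calm (hb : Calm back) (l : List (Instr × Mark))
    (hl : ∀ x ∈ l, x.1.asInvoke = none) :
    ghostWalk T C f back l = l.map fun x => (x.1.relabel f, x.2.tag) := by
  induction l generalizing back with
  | nil => rfl
  | cons x r ih =>
    have hx := hl x List.mem_cons_self
    rw [ghostWalk, excUpdate_eq_nil (hb 3 (by omega)), ghostMain_eq hx,
      ih (hb.cons hx) fun y hy => hl y (List.mem_cons_of_mem _ hy)]
    rfl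

theorem walkLen_calm (hb : Calm back) (l : List Instr) (hl : ∀ x ∈ l, x.asInvoke = none) :
    walkLen back l = l.length := by
  induction l generalizing back with
  | nil => rfl
  | cons x r ih =>
    have hx := hl x List.mem_cons_self
    rw [walkLen, hb 3 (by omega), hx, ih (hb.cons hx) fun y hy => hl y (List.mem_cons_of_mem _ hy)]
    simp only [Option.elim, List.length_cons]
    omega

theorem ghostWalk_markInner (hb : Calm back) (is : List Instr)
    (hl : ∀ i ∈ is, i.asInvoke = none) :
    ghostWalk T C f back (markInner is) = innerCode f is := by
  rw [ghostWalk_calm hb]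
  · simp [markInner, innerCode]
  · simpa [markInner] using hl

end

theorem filterMap_zipIdx_eq {α β : Type} (g : α → Option β) (l : List α) (k n : ℕ) :
    ((l.zipIdx k).filterMap fun x => if x.2 = n then g x.1 else none) =
      if k ≤ n then (l[n - k]?.bind g).toList else [] := by
  induction l generalizing k with
  | nil => simp
  | cons a r ih =>
    rw [List.zipIdx_cons, List.filterMap_cons, ih]
    rcases Nat.lt_trichotomy k n with h | rfl | h
    · obtain ⟨d, rfl⟩ := Nat.exists_eq_add_of_lt h
      have h1 : k ≠ k + d + 1 := by omega
      have h2 : k + d + 1 - k = d + 1 := by omega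
      have h3 : k + d + 1 - (k + 1) = d := by omega
      simp [h1, h2, h3, show k ≤ k + d + 1 by omega, show k + 1 ≤ k + d + 1 by omega]
    · simp only [if_true, le_refl, Nat.sub_self, List.getElem?_cons_zero, Option.bind_some]
      rw [if_neg (by omega)]
      cases g a <;> rfl
    · have h1 : k ≠ n := by omega
      have h2 : ¬ k + 1 ≤ n := by omega
      have h3 : ¬ k ≤ n := by omega
      simp [h1, h2, h3]

section
variable (T : Hierarchy) (C : Contract) {N : MethodDef}

/-- Every call is covered by a handler that starts four instructions later. -/
def MethodDef.HandlersAhead (N : MethodDef) : Prop :=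
  ∀ x k c m, N.code[x]? = some (.invoke k c m) → N.excTarget x = some (x + 4)

theorem ghostChunk_eq (hN : N.HandlersAhead) {pre : List Instr} {i : Instr} {suf : List Instr}
    (h : N.code = pre ++ i :: suf) (μ : Mark) : ghostChunk T C N pre.length i μ =
      excUpdate T C pre.reverse[3]? μ ++ ghostMain T C i μ := by
  unfold ghostChunk
  congr 1
  let g : Instr → Option (Instr × Tag) := fun j => match j with
    | .invoke k c m => some (ghostUpdate T C .exceptional k c m, μ.callTag)
    | _ => none
  have hg : ∀ o : Option Instr, (o.bind g).toList = excUpdate T C o μ := by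
    rintro (_ | j)
    · rfl
    · cases j <;> rfl
  have key : (N.code.zipIdx.filterMap fun (j, L') =>
      match j with
      | .invoke k c m =>
          if N.excTarget L' = some pre.length then
            some (ghostUpdate T C .exceptional k c m, μ.callTag)
          else none
      | _ => none) =
      if 4 ≤ pre.length then (N.code[pre.length - 4]?.bind g).toList else [] := by
    by_cases h4 : 4 ≤ pre.length
    · rw [if_pos h4]
      have := filterMap_zipIdx_eq g N.code 0 (pre.length - 4)
      rw [if_pos (Nat.zero_le _), Nat.sub_zero] at this
      rw [← this]
      refine List.filterMap_congr fun x hx => ?_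
      obtain ⟨j, x⟩ := x
      have hx' := List.mk_mem_zipIdx_iff_getElem?.1 hx
      cases j with
      | invoke k c m =>
        simp only [hN x k c m hx', g, Option.some.injEq]
        by_cases hxe : x = pre.length - 4
        · rw [if_pos hxe, if_pos (by omega)]
        · rw [if_neg hxe, if_neg (by omega)]
      | _ => simp [g]
    · rw [if_neg h4]
      refine List.filterMap_eq_nil_iff.2 fun x hx => ?_
      obtain ⟨j, x⟩ := x
      have hx' := List.mk_mem_zipIdx_iff_getElem?.1 hx
      cases j with
      | invoke k c m =>
        simp only [hN x k c m hx', Option.some.injEq]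
        rw [if_neg (by omega)]
      | _ => rfl
  refine key.trans ?_
  by_cases h4 : 4 ≤ pre.length
  · rw [if_pos h4, hg, h, List.getElem?_append_left (by omega), List.getElem?_reverse (by omega)]
    congr 2
  · rw [if_neg h4, List.getElem?_eq_none (by simp; omega)]
    rfl

theorem ghostCode_eq (hN : N.HandlersAhead) {code : List (Instr × Mark)}
    (hc : N.code = code.map Prod.fst) : ghostCode T C N (code.map Prod.snd) =
      ghostWalk T C (ghostOffset T C N) [] code := by
  have key : ∀ l pre : List (Instr × Mark), code = pre ++ l →
      (((l.map Prod.fst).zipIdx pre.length).flatMap fun (i, L) =>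
        (ghostChunk T C N L i (markAt (code.map Prod.snd) L)).map fun (j, t) =>
          (j.relabel (ghostOffset T C N), t)) =
      ghostWalk T C (ghostOffset T C N) (pre.map Prod.fst).reverse l := by
    intro l
    induction l with
    | nil => intro pre _; rfl
    | cons x r ih =>
      intro pre h
      have ih' := ih (pre ++ [x]) (by simp [h])
      rw [List.length_append, List.length_singleton] at ih'
      rw [List.map_cons, List.zipIdx_cons, List.flatMap_cons, ih']
      have hm : markAt (code.map Prod.snd) pre.length = x.2 := by
        simp [markAt, h, List.getD_eq_getElem?_getD]
      have hch := ghostChunk_eq T C hN (pre := pre.map Prod.fst) (i := x.1)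
        (suf := r.map Prod.fst) (by simp [hc, h]) x.2
      rw [List.length_map] at hch
      dsimp only
      rw [hm, hch, ghostWalk]
      simp
  rw [ghostCode, hc]
  exact key code [] rfl

theorem ghostOffset_eq (hN : N.HandlersAhead) {x : ℕ} :
    ghostOffset T C N x = walkLen [] (N.code.take x) := by
  have key : ∀ l pre suf : List Instr, N.code = pre ++ (l ++ suf) →
      ((l.zipIdx pre.length).map fun (i, L') =>
        (ghostChunk T C N L' i (markAt [] L')).length).sum = walkLen pre.reverse l := by
    intro l
    induction l with
    | nil => intro pre _ _; rfl
    | cons i r ih =>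
      intro pre suf h
      have ih' := ih (pre ++ [i]) suf (by simp [h])
      rw [List.length_append, List.length_singleton] at ih'
      rw [List.zipIdx_cons, List.map_cons, List.sum_cons, ih']
      dsimp only
      rw [ghostChunk_eq T C hN (pre := pre) (i := i) (suf := r ++ suf) (by simp [h])]
      simp [walkLen, length_excUpdate, length_ghostMain]
  rw [ghostOffset]
  have := key (N.code.take x) [] (N.code.drop x) (by simp)
  rw [List.length_nil, List.reverse_nil] at this
  have htake : N.code.zipIdx.take x = (N.code.take x).zipIdx := by
    conv_lhs => rw [← List.take_append_drop x N.code, List.zipIdx_append]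
    rw [List.take_append, List.take_of_length_le (by simp)]
    rcases Nat.le_total x N.code.length with h | h
    · simp [h]
    · simp [List.drop_eq_nil_of_le h]
  rw [htake]
  exact this

theorem ghostOffset_append (hN : N.HandlersAhead) {pre q suf : List Instr}
    (h : N.code = pre ++ (q ++ suf)) : ghostOffset T C N (pre.length + q.length) =
      ghostOffset T C N pre.length + walkLen pre.reverse q := by
  rw [ghostOffset_eq T C hN, ghostOffset_eq T C hN, h, List.take_left, ← List.append_assoc,
    ← List.length_append, List.take_left, walkLen_append]
  simp

theorem ghostOffset_mono (hN : N.HandlersAhead) {x y : ℕ} (h : x ≤ y) :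
    ghostOffset T C N x ≤ ghostOffset T C N y := by
  rw [ghostOffset_eq T C hN, ghostOffset_eq T C hN]
  obtain ⟨d, rfl⟩ := Nat.exists_eq_add_of_le h
  rw [List.take_add, walkLen_append]
  exact Nat.le_add_right _ _

end

/- ### Blocks -/

section
variable {T : Hierarchy} {C : Contract} {f : ℕ → ℕ} {back : List Instr}

theorem asInvoke_of_inner {i : Instr} (h : i.Inner) : i.asInvoke = none := by
  cases i <;> first | rfl | exact h.elim

theorem inner_of_straight {i : Instr} (h : i.Straight) : i.Inner := by
  cases i <;> first | exact h | exact h.elim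

theorem clausesCode_inner (F : Frame) (done st : ℕ) (l : List Clause) :
    ∀ i ∈ clausesCode F done st l, i.Inner := by
  induction l generalizing st with
  | nil => simp [clausesCode, Instr.Inner]
  | cons cl r ih =>
    intro i hi
    simp only [clausesCode, List.mem_append, List.mem_singleton] at hi
    rcases hi with (((hi | rfl) | hi) | rfl) | hi
    · exact inner_of_straight (CExpr.compile_straight _ _ i hi)
    · trivial
    · exact inner_of_straight (compileUpdate_straight _ _ i hi)
    · trivial
    · exact ih _ i hi

theorem sectionCode_inner (F : Frame) (done st : ℕ) (l : Option (List Clause)) :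
    ∀ i ∈ sectionCode F done st l, i.Inner := by
  cases l with
  | none => simp [sectionCode, Instr.Inner]
  | some l => exact clausesCode_inner F done st l

theorem checksCode_inner (C : Contract) (ev : Event) (m : MethodId) (F : Frame) (done st : ℕ)
    (ds : List (Option ℕ × ℕ)) : ∀ i ∈ checksCode C ev m F done st ds, i.Inner := by
  induction ds generalizing st with
  | nil => simp [checksCode]
  | cons p r ih =>
    intro i hi
    rcases p with ⟨_ | t, d⟩
    · simp only [checksCode, List.mem_append] at hi
      exact hi.elim (sectionCode_inner _ _ _ _ i) (ih _ i)
    · simp only [checksCode, List.mem_append, List.mem_cons, List.not_mem_nil, or_false] at hi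
      rcases hi with ((rfl | rfl | rfl) | hi) | hi
      · trivial
      · trivial
      · trivial
      · exact sectionCode_inner _ _ _ _ i hi
      · exact ih _ i hi

/-- The first instruction of a nonempty list gets the given tag. -/
def setFirst (t : Tag) : List (Instr × Tag) → List (Instr × Tag)
  | [] => []
  | x :: r => (x.1, t) :: r

theorem ghostWalk_setTag (hb : Calm back) (t : Tag) (l : List (Instr × Mark)) :
    ghostWalk T C f back (setTag t l) = setFirst t (ghostWalk T C f back l) := by
  cases l with
  | nil => rfl
  | cons x r =>
    obtain ⟨i, μ⟩ := x
    rw [setTag, ghostWalk, ghostWalk, excUpdate_eq_nil (hb 3 (by omega)),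
      excUpdate_eq_nil (hb 3 (by omega))]
    cases i <;> rfl

theorem fst_setTag (t : Tag) (l : List (Instr × Mark)) :
    (setTag t l).map Prod.fst = l.map Prod.fst := by
  cases l <;> rfl

theorem fst_setFrame (F : Frame) (l : List (Instr × Mark)) :
    (setFrame F l).map Prod.fst = l.map Prod.fst := by
  cases l <;> rfl

theorem fst_markInner (l : List Instr) : (markInner l).map Prod.fst = l := by
  simp [markInner, Function.comp_def]

/-- Ghost updates in the code after a call, from its handler on. -/
theorem ghostWalk_handler {F : Frame} {k : InvokeKind} {c : ℕ} {m : MethodId}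
    (hb : back[3]? = some (.invoke k c m)) (hb' : Calm (back.take 3)) {l : List (Instr × Mark)}
    (hne : l ≠ []) (hl : ∀ x ∈ l, x.1.asInvoke = none) :
    ghostWalk T C f back (setFrame F l) =
      (ghostUpdate T C .exceptional k c m, .call F) ::
        l.map fun x => (x.1.relabel f, x.2.tag) := by
  cases l with
  | nil => exact absurd rfl hne
  | cons x r =>
    obtain ⟨i, μ⟩ := x
    have hi := hl _ List.mem_cons_self
    rw [setFrame, ghostWalk, hb, ghostMain_eq hi, ghostWalk_calm]
    · rfl
    · intro j hj
      cases j with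
      | zero => exact hi
      | succ j =>
        have := hb' j (by omega)
        rwa [List.getElem?_take_of_lt (by omega)] at this
    · exact fun y hy => hl y (List.mem_cons_of_mem _ hy)

end

theorem length_eventCode (T : Hierarchy) (C : Contract) (ev : Event) (k : InvokeKind) (c : ℕ)
    (m : MethodId) (F : Frame) (D : Assn) (start : ℕ) :
    (eventCode T C ev k c m F start).length =
      (checksAnns C ev m F D (T.dispatch k c m)).length := by
  rw [eventCode, length_checksCode _ _ _ _ D]

theorem eventCode_inner (T : Hierarchy) (C : Contract) (ev : Event) (k : InvokeKind) (c : ℕ)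
    (m : MethodId) (F : Frame) (start : ℕ) : ∀ i ∈ eventCode T C ev k c m F start, i.Inner :=
  checksCode_inner _ _ _ _ _ _ _

section
variable (T : Hierarchy) (C : Contract) (base start : ℕ) (k : InvokeKind) (c : ℕ) (m : MethodId)

/-- The part of a block before the call. -/
def blockBefore : List Instr :=
  saveCode (callFrame base k m) ++
    eventCode T C .before k c m (callFrame base k m) (start + (saveCode (callFrame base k m)).length)

def blockHandler : ℕ := start + callPos T C base k c m + 4

def blockExc : List Instr :=
  eventCode T C .exceptional k c m (callFrame base k m) (blockHandler T C base start k c m)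

def blockNormal : ℕ :=
  blockHandler T C base start k c m + (blockExc T C base start k c m).length + 1

def blockAfter : List Instr :=
  eventCode T C .after k c m (callFrame base k m) (blockNormal T C base start k c m)

/-- The part of a block from the handler on. -/
def blockRest : List Instr :=
  blockExc T C base start k c m ++ .athrow :: blockAfter T C base start k c m

theorem length_blockBefore :
    (blockBefore T C base start k c m).length = callPos T C base k c m := by
  rw [blockBefore, callPos, List.length_append, length_eventCode _ _ _ _ _ _ _ .tt,
    length_eventCode _ _ _ _ _ _ _ .tt]

theorem blockCode_eq : blockCode T C base start k c m =
    setTag .inv (markInner (blockBefore T C base start k c m) ++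
      ((.invoke k c m, { tag := .inner, frame := some (callFrame base k m) }) ::
        (markInner [.astore (callFrame base k m).resReg, .aload (callFrame base k m).resReg,
            .goto (blockNormal T C base start k c m)] ++
          setFrame (callFrame base k m) (markInner (blockExc T C base start k c m) ++
            (.athrow, { tag := .inv, frame := none }) ::
              markInner (blockAfter T C base start k c m))))) := by
  have h : ∀ F (l l' : List (Instr × Mark)) x,
      setFrame F (l ++ x :: l') = setFrame F (l ++ [x]) ++ l' := by
    intro F l l' x
    cases l <;> simp [setFrame]
  rw [h]
  simp [blockCode, blockBefore, blockExc, blockAfter, blockNormal, blockHandler]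

theorem fst_blockCode : (blockCode T C base start k c m).map Prod.fst =
    blockBefore T C base start k c m ++ (.invoke k c m :: ([.astore (callFrame base k m).resReg,
      .aload (callFrame base k m).resReg, .goto (blockNormal T C base start k c m)] ++
        blockRest T C base start k c m)) := by
  rw [blockCode_eq, fst_setTag]
  simp only [List.map_append, List.map_cons, fst_markInner, fst_setFrame, blockRest]

theorem blockBefore_noCall : ∀ i ∈ blockBefore T C base start k c m, i.asInvoke = none := by
  intro i hi
  rw [blockBefore, List.mem_append] at hi
  exact hi.elim (fun h => asInvoke_of_inner (inner_of_straight (saveCode_straight _ i h)))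
    fun h => asInvoke_of_inner (eventCode_inner _ _ _ _ _ _ _ _ i h)

theorem blockRest_noCall : ∀ i ∈ blockRest T C base start k c m, i.asInvoke = none := by
  intro i hi
  rw [blockRest, List.mem_append, List.mem_cons] at hi
  rcases hi with h | rfl | h
  · exact asInvoke_of_inner (eventCode_inner _ _ _ _ _ _ _ _ i h)
  · rfl
  · exact asInvoke_of_inner (eventCode_inner _ _ _ _ _ _ _ _ i h)

/-- A block with its ghost updates, but for the tag of the first instruction. -/
def blockGhost (f : ℕ → ℕ) : List (Instr × Tag) :=
  innerCode f (saveCode (callFrame base k m)) ++ (innerCode f (eventCode T C .before k c m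
      (callFrame base k m) (start + (saveCode (callFrame base k m)).length)) ++
    ((ghostArgs k m, .inner) :: (ghostUpdate T C .before k c m, .inner) ::
      (.invoke k c m, .call (callFrame base k m)) ::
      (ghostUpdate T C .after k c m, .call (callFrame base k m)) ::
      ([Instr.astore (callFrame base k m).resReg, .aload (callFrame base k m).resReg].map
          (fun i => (i, Tag.inner)) ++
        ((.goto (f (blockNormal T C base start k c m)), .inner) ::
          (ghostUpdate T C .exceptional k c m, .call (callFrame base k m)) ::
          (innerCode f (blockExc T C base start k c m) ++
            ((.athrow, .inv) :: innerCode f (blockAfter T C base start k c m)))))))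

theorem ghostWalk_block {back : List Instr} (hb : Calm back) (f : ℕ → ℕ) :
    ghostWalk T C f back (blockCode T C base start k c m) =
      setFirst .inv (blockGhost T C base start k c m f) := by
  rw [blockCode_eq, ghostWalk_setTag hb, ghostWalk_append, fst_markInner,
    ghostWalk_markInner hb _ (blockBefore_noCall T C base start k c m)]
  congr 1
  have hb' : Calm ((blockBefore T C base start k c m).reverse ++ back) :=
    calm_append (by simpa using blockBefore_noCall T C base start k c m) (.inr hb)
  generalize (blockBefore T C base start k c m).reverse ++ back = b at hb'
  rw [ghostWalk, excUpdate_eq_nil (hb' 3 (by omega)), ghostWalk_append, fst_markInner,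
    ghostWalk_handler (k := k) (c := c) (m := m)]
  · have h0 := hb' 0 (by omega)
    have h1 := hb' 1 (by omega)
    have h2 := hb' 2 (by omega)
    simp only [markInner, List.map_cons, List.map_nil, ghostWalk, List.getElem?_cons_succ]
    rw [excUpdate_eq_nil h2, excUpdate_eq_nil h1, excUpdate_eq_nil h0]
    simp [ghostMain, blockGhost, blockBefore, innerCode, Instr.relabel, ghostArgs, ghostUpdate,
      Mark.callTag]
    rfl
  · rfl
  · intro j hj
    rcases j with _ | _ | _ | j <;> rfl
  · simp
  · intro x hx
    have := blockRest_noCall T C base start k c m x.1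
    simp only [List.mem_append, List.mem_cons, markInner, List.mem_map] at hx
    simp only [blockRest, List.mem_append, List.mem_cons] at this
    rcases hx with ⟨i, h, rfl⟩ | rfl | ⟨i, h, rfl⟩
    · exact this (.inl h)
    · rfl
    · exact this (.inr (.inr h))

end
end IRM

namespace IRM

/- ### Positions in a block -/

section
variable {T : Hierarchy} {C : Contract} {base : ℕ} {k : InvokeKind} {c : ℕ} {m : MethodId}
  {N : MethodDef} {pre suf : List Instr}

theorem walkLen_call {back : List Instr} (hb : Calm back) (l : List Instr) :
    walkLen back (.invoke k c m :: l) = 4 + walkLen (.invoke k c m :: back) l := by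
  rw [walkLen, hb 3 (by omega)]
  simp [Instr.asInvoke]

theorem walkLen_afterCall {back : List Instr} (hb : Calm back) {x y z : Instr}
    (hx : x.asInvoke = none) (hy : y.asInvoke = none) (hz : z.asInvoke = none) (l : List Instr) :
    walkLen (.invoke k c m :: back) (x :: y :: z :: l) =
      3 + walkLen (z :: y :: x :: .invoke k c m :: back) l := by
  have h0 := hb 0 (by omega)
  have h1 := hb 1 (by omega)
  have h2 := hb 2 (by omega)
  simp only [walkLen, List.getElem?_cons_succ, h0, h1, h2, hx, hy, hz, Option.elim]
  omega

theorem walkLen_handler {b : List Instr} {x y z : Instr} (hx : x.asInvoke = none)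
    (hy : y.asInvoke = none) (hz : z.asInvoke = none) {l : List Instr} (hl : l ≠ [])
    (hl' : ∀ i ∈ l, i.asInvoke = none) :
    walkLen (z :: y :: x :: .invoke k c m :: b) l = 1 + l.length := by
  cases l with
  | nil => exact absurd rfl hl
  | cons i r =>
    have hi := hl' i List.mem_cons_self
    rw [walkLen, walkLen_calm, hi]
    · simp only [List.getElem?_cons_succ, List.getElem?_cons_zero, Option.bind_some,
        Instr.asInvoke, Option.elim, List.length_cons]
      omega
    · exact calm_append (l := [i, z, y, x]) (by simp [hi, hx, hy, hz]) (.inl (by simp))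
    · exact fun j hj => hl' j (List.mem_cons_of_mem _ hj)

theorem offset_before (T' : Hierarchy) (C' : Contract) (hN : N.HandlersAhead)
    (hb : Calm pre.reverse)
    (h : N.code = pre ++ ((blockCode T C base pre.length k c m).map Prod.fst ++ suf)) {j : ℕ}
    (hj : j ≤ callPos T C base k c m) :
    ghostOffset T' C' N (pre.length + j) = ghostOffset T' C' N pre.length + j := by
  rw [← length_blockBefore T C base pre.length k c m] at hj
  rw [fst_blockCode, List.append_assoc, ← List.take_append_drop j (blockBefore ..),
    List.append_assoc] at h
  have := ghostOffset_append T' C' hN h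
  rw [walkLen_calm hb _ fun i hi => blockBefore_noCall T C base pre.length k c m i
    (List.mem_of_mem_take hi), List.length_take, min_eq_left hj] at this
  exact this

theorem offset_call (T' : Hierarchy) (C' : Contract) (hN : N.HandlersAhead)
    (hb : Calm pre.reverse)
    (h : N.code = pre ++ ((blockCode T C base pre.length k c m).map Prod.fst ++ suf)) :
    ghostOffset T' C' N (pre.length + (callPos T C base k c m + 1)) =
      ghostOffset T' C' N pre.length + callPos T C base k c m + 4 := by
  have hl := length_blockBefore T C base pre.length k c m
  have hc := blockBefore_noCall T C base pre.length k c m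
  rw [fst_blockCode] at h
  generalize blockBefore T C base pre.length k c m = S at h hl hc
  have := ghostOffset_append T' C' hN (pre := pre) (q := S ++ [.invoke k c m])
    (suf := [.astore (callFrame base k m).resReg, .aload (callFrame base k m).resReg,
      .goto (blockNormal T C base pre.length k c m)] ++
        (blockRest T C base pre.length k c m ++ suf)) (by
    rw [h]
    simp only [List.append_assoc, List.cons_append, List.nil_append])
  rw [walkLen_append, walkLen_calm hb S hc,
    walkLen_call (calm_append (by simpa using hc) (.inr hb)), List.length_append, hl] at this
  simpa [walkLen, Nat.add_assoc] using this

theorem offset_handler (T' : Hierarchy) (C' : Contract) (hN : N.HandlersAhead)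
    (hb : Calm pre.reverse)
    (h : N.code = pre ++ ((blockCode T C base pre.length k c m).map Prod.fst ++ suf)) :
    ghostOffset T' C' N (pre.length + (callPos T C base k c m + 4)) =
      ghostOffset T' C' N pre.length + callPos T C base k c m + 7 := by
  have hl := length_blockBefore T C base pre.length k c m
  have hc := blockBefore_noCall T C base pre.length k c m
  rw [fst_blockCode] at h
  generalize blockBefore T C base pre.length k c m = S at h hl hc
  have := ghostOffset_append T' C' hN (pre := pre) (q := S ++ (.invoke k c m ::
      [.astore (callFrame base k m).resReg, .aload (callFrame base k m).resReg,
        .goto (blockNormal T C base pre.length k c m)]))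
    (suf := blockRest T C base pre.length k c m ++ suf) (by
    rw [h]
    simp only [List.append_assoc, List.cons_append, List.nil_append])
  have hS : Calm (S.reverse ++ pre.reverse) := calm_append (by simpa using hc) (.inr hb)
  rw [walkLen_append, walkLen_calm hb S hc, walkLen_call hS, walkLen_afterCall hS rfl rfl rfl,
    List.length_append, hl] at this
  simpa [walkLen, Nat.add_assoc] using this

theorem offset_rest (T' : Hierarchy) (C' : Contract) (hN : N.HandlersAhead)
    (hb : Calm pre.reverse)
    (h : N.code = pre ++ ((blockCode T C base pre.length k c m).map Prod.fst ++ suf)) {j : ℕ}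
    (hj₀ : 0 < j) (hj : j ≤ (blockRest T C base pre.length k c m).length) :
    ghostOffset T' C' N (pre.length + (callPos T C base k c m + 4 + j)) =
      ghostOffset T' C' N pre.length + callPos T C base k c m + 8 + j := by
  have hl := length_blockBefore T C base pre.length k c m
  have hc := blockBefore_noCall T C base pre.length k c m
  have hr := blockRest_noCall T C base pre.length k c m
  rw [fst_blockCode] at h
  generalize blockBefore T C base pre.length k c m = S at h hl hc
  generalize blockRest T C base pre.length k c m = R at h hr hj
  have := ghostOffset_append T' C' hN (pre := pre) (q := S ++ (.invoke k c m ::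
      [.astore (callFrame base k m).resReg, .aload (callFrame base k m).resReg,
        .goto (blockNormal T C base pre.length k c m)] ++ R.take j)) (suf := R.drop j ++ suf) (by
    rw [h]
    simp only [List.append_assoc, List.cons_append, List.nil_append]
    simp only [← List.append_assoc, List.take_append_drop])
  have hS : Calm (S.reverse ++ pre.reverse) := calm_append (by simpa using hc) (.inr hb)
  have hlen : (R.take j).length = j := by simpa using hj
  rw [walkLen_append, walkLen_calm hb S hc, List.cons_append, walkLen_call hS, List.cons_append,
    List.cons_append, List.cons_append, List.nil_append,
    walkLen_afterCall hS rfl rfl rfl, walkLen_handler rfl rfl rfl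
      (by rw [← List.length_pos_iff]; omega) (fun i hi => hr i (List.mem_of_mem_take hi)),
    List.length_append, hl, hlen] at this
  simp only [List.length_cons, hlen] at this
  rw [show pre.length + (callPos T C base k c m + 4 + j) =
    pre.length + (callPos T C base k c m + (j + 1 + 1 + 1 + 1)) by omega, this]
  omega

end

/- ### The assertions at a block -/

/-- Local validity of an instruction with the assertion `a` at its label and `nxt` at the next. -/
def Valid (T : Hierarchy) (G : MethodDef) (B : List Assn) (inv : Assn) (p : ℕ) (i : Instr)
    (a nxt : Assn) : Prop :=
  ∀ (I : Interp) (σ : Config), G.code[p]? = some i → asgn B (p + 1) = nxt → σ.Sat I T a →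
    σ.Sat I T (wp G B inv inv p) ∧ FlowCondition I T G B inv p σ

theorem Valid.of_inner {T : Hierarchy} {G : MethodDef} {B : List Assn} {inv : Assn} {p : ℕ}
    {i : Instr} {a nxt : Assn} (hi : i.Inner)
    (h : ∀ (I : Interp) (σ : Config), σ.Sat I T a → σ.Sat I T (i.wpAt (asgn B) nxt)) :
    Valid T G B inv p i a nxt := by
  intro I σ hp hnxt hσ
  refine ⟨?_, ?_⟩
  · rw [wp_of_inner hp hi, hnxt]
    exact h I σ hσ
  · unfold FlowCondition
    rw [hp]
    cases i <;> trivial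

section
variable {T : Hierarchy} {C : Contract} {base start : ℕ} {k : InvokeKind} {c : ℕ} {m : MethodId}
  {G : MethodDef} {B : List Assn} {n p : ℕ} {f : ℕ → ℕ}

theorem Seg.setFirst {D : Assn} {l : List (Instr × Tag)} {as : List Assn}
    (h : Seg (Checked C.inv (asgn B) n (Valid T G B C.inv)) D p l as) (hne : l ≠ [])
    (ht : ∀ x ∈ l.head?, x.2.fixed C.inv = none)
    (hv : ∀ (I : Interp) (σ : Config), σ.Sat I T C.inv → σ.Sat I T (as.headD D)) :
    Seg (Checked C.inv (asgn B) n (Valid T G B C.inv)) D p (setFirst .inv l) (C.inv :: as.tail) := by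
  cases h with
  | nil => exact absurd rfl hne
  | @cons _ x a l as hx hr =>
    have := ht x (by simp)
    obtain ⟨h1, -, h3⟩ := hx.inner this
    refine .cons (.of_fixed rfl (.of_inner h1 fun I σ hσ => ?_)) hr
    have := hv I σ hσ
    simp only [List.headD_cons] at this
    rwa [h3] at this

variable (T C base k c m) in
/-- The assertions at a block, but for the first one. -/
def blockAnnsFull : List Assn :=
  let F := callFrame base k m
  let ds := T.dispatch k c m
  let call := C.inv.and F.assn
  let bef := (ghostUpdate T C .before k c m).step call
  let args := (ghostArgs k m).step bef
  let aft := checksWp C .after m F C.inv ds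
  stepsAnns (saveCode F) (checksWp C .before m F args ds) ++
    (checksAnns C .before m F args ds ++ (args :: bef :: call :: call ::
      (stepsAnns [.astore F.resReg, .aload F.resReg] aft ++ (aft :: call ::
        (checksAnns C .exceptional m F C.inv ds ++ (C.inv :: checksAnns C .after m F C.inv ds))))))

theorem blockAnns_eq : blockAnns T C base k c m = C.inv :: (blockAnnsFull T C base k c m).tail := by
  have h : ∀ (l l' : List Assn) (a : Assn) (r : List Assn),
      (l ++ (l' ++ a :: r)).tail = (l ++ (l' ++ [a])).tail ++ r := by
    intro l l' a r
    cases l <;> cases l' <;> simp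
  unfold blockAnns blockAnnsFull
  dsimp only
  rw [h]
  simp only [List.append_assoc, List.cons_append, List.nil_append]

theorem Carries.blockAnnsFull {J : ℕ → Assn} (h : Carries J p (blockAnns T C base k c m)) :
    CarriesTail J p (blockAnnsFull T C base k c m) := by
  rw [blockAnns_eq] at h
  intro j a hj ha
  refine h j a ?_
  cases j with
  | zero => exact absurd rfl hj.ne
  | succ j =>
    rw [List.getElem?_cons_succ, List.getElem?_tail]
    exact ha


theorem eventCode_eq (ev : Event) (F : Frame) (D : Assn) : eventCode T C ev k c m F start =
    checksCode C ev m F (start + (checksAnns C ev m F D (T.dispatch k c m)).length) start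
      (T.dispatch k c m) := by
  rw [eventCode, length_checksCode _ _ _ _ D]

/-- The assertions at a block, but for those at its first and its fixed labels, are the weakest
preconditions. -/
theorem Seg.blockFull (hC : C.WellFormed)
    (hf : ∀ j ≤ callPos T C base k c m, f (start + j) = p + j)
    (hf' : ∀ j, 0 < j → j ≤ (blockRest T C base start k c m).length →
      f (start + (callPos T C base k c m + 4 + j)) = p + callPos T C base k c m + 8 + j)
    (hJ : Carries (asgn B) p (blockAnns T C base k c m))
    (hnext : asgn B (p + (blockAnnsFull T C base k c m).length) = C.inv)
    (hn : p + (blockAnnsFull T C base k c m).length < n)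
    (hinv : Valid T G B C.inv (p + callPos T C base k c m + 2) (.invoke k c m)
      (C.inv.and (callFrame base k m).assn) (C.inv.and (callFrame base k m).assn))
    (hthr : ∀ nxt, Valid T G B C.inv
      (p + callPos T C base k c m + 8 + (blockExc T C base start k c m).length) .athrow C.inv nxt) :
    Seg (Checked C.inv (asgn B) n (Valid T G B C.inv)) C.inv p
      (blockGhost T C base start k c m f) (blockAnnsFull T C base k c m) := by
  have hJ := hJ.blockAnnsFull
  unfold blockAnnsFull at hJ hnext hn ⊢
  unfold blockGhost
  have hcall : callPos T C base k c m = (saveCode (callFrame base k m)).length +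
      (checksAnns C .before m (callFrame base k m) ((ghostArgs k m).step
        ((ghostUpdate T C .before k c m).step (C.inv.and (callFrame base k m).assn)))
          (T.dispatch k c m)).length := by
    rw [callPos, length_eventCode]
  have hexc : (blockExc T C base start k c m).length = (checksAnns C .exceptional m
      (callFrame base k m) C.inv (T.dispatch k c m)).length := by
    rw [blockExc, length_eventCode]
  have haft : (blockAfter T C base start k c m).length = (checksAnns C .after m
      (callFrame base k m) C.inv (T.dispatch k c m)).length := by
    rw [blockAfter, length_eventCode]
  have hrest : (blockRest T C base start k c m).length = (blockExc T C base start k c m).length +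
      1 + (blockAfter T C base start k c m).length := by
    simp [blockRest]
    omega
  rw [hexc] at hthr
  rw [hrest, hexc, haft] at hf'
  rw [blockExc, blockAfter, blockNormal, hexc, blockHandler]
  rw [hcall] at hf hf' hinv hthr ⊢
  dsimp only at hJ hnext hn ⊢
  set F := callFrame base k m with hF
  set ds := T.dispatch k c m with hds
  set call := C.inv.and F.assn with hcl
  set bef := (ghostUpdate T C .before k c m).step call with hbef
  set args := (ghostArgs k m).step bef with hargs
  set s := (saveCode F).length with hs
  have hheada := headD_checksAnns (X := C.inv) (D := C.inv) C .after m F ds (as := []) rfl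
  rw [List.append_nil] at hheada
  rw [eventCode_eq .before F args, eventCode_eq .exceptional F C.inv, eventCode_eq .after F C.inv,
    ← hds]
  generalize hb : (checksAnns C .before m F args ds).length = b at *
  generalize he : (checksAnns C .exceptional m F C.inv ds).length = e at *
  generalize ha : (checksAnns C .after m F C.inv ds).length = a at *
  simp only [List.length_append, List.length_cons, length_stepsAnns, List.length_nil, hb, he, ha,
    ← hs] at hnext hn
  have hJb := hJ.right
  rw [length_stepsAnns, ← hs] at hJb
  have hJe := hJb.right.tail.tail.tail.tail.right.tail.tail
  rw [length_stepsAnns, hb] at hJe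
  have hJa := hJe.right.tail
  rw [he] at hJa
  have hbad : (checksAnns C .before m F args ds ++ (args :: bef :: call :: call ::
      (stepsAnns [.astore F.resReg, .aload F.resReg] (checksWp C .after m F C.inv ds) ++
        (checksWp C .after m F C.inv ds :: call :: (checksAnns C .exceptional m F C.inv ds ++
          (C.inv :: checksAnns C .after m F C.inv ds)))))).headD C.inv =
      checksWp C .before m F args ds := headD_checksAnns _ _ _ _ _ rfl
  have hls : (innerCode f (saveCode F)).length = s := by rw [length_innerCode, hs]
  have hlb : ∀ d st, (innerCode f (checksCode C .before m F d st ds)).length = b := by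
    intro d st
    rw [length_innerCode, length_checksCode _ _ _ _ args, hb]
  have hle : ∀ d st, (innerCode f (checksCode C .exceptional m F d st ds)).length = e := by
    intro d st
    rw [length_innerCode, length_checksCode _ _ _ _ C.inv, he]
  have hnorm := hf' (e + 1) (by omega) (by omega)
  refine Seg.append ?_ (Seg.append ?_ (.cons ?_ (.cons ?_ (.cons ?_ (.cons ?_ (Seg.append ?_
    (.cons ?_ (.cons ?_ (Seg.append ?_ (.cons ?_ ?_))))))))))
  · rw [hbad, innerCode_straight _ (saveCode_straight F)]
    exact Seg.steps (saveCode_straight F) (by omega)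
  · rw [hls]
    rcases Nat.eq_zero_or_pos b with rfl | hpos
    · rw [List.length_eq_zero_iff] at hb
      have : ds = [] := by
        rcases ds with _ | ⟨⟨_ | t, d⟩, r⟩
        · rfl
        · simp [checksAnns, sectionAnns_ne_nil] at hb
        · simp [checksAnns] at hb
      rw [this]
      exact .nil _
    · refine Seg.checks (D := args) ds ?_ ?_ ?_ ?_ ?_
      · intro j h0 hj
        rw [hb] at hj
        rw [Nat.add_assoc, hf _ (by omega), Nat.add_assoc]
      · rw [hb]
      · omega
      · rw [hb]
        exact hJb b args hpos (by rw [List.getElem?_append_right hb.le, hb, Nat.sub_self]; rfl)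
      · exact hJb.left
  all_goals rw [hls, hlb]
  all_goals try simp only [List.length_map, List.length_cons, List.length_nil, List.headD_cons, hle]
  · refine .of_inner trivial ?_ rfl
    simp only [ghostArgs, Instr.succsAt, List.mem_singleton]
    omega
  · refine .of_inner trivial ?_ rfl
    simp only [ghostUpdate, Instr.succsAt, List.mem_singleton]
    omega
  · exact .of_fixed rfl (by
      rwa [show p + s + b + 1 + 1 = p + (s + b) + 2 by omega])
  · refine .of_fixed rfl (.of_inner trivial fun I σ hσ => ?_)
    exact Config.sat_after hC hσ
  · refine Seg.steps ?_ ?_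
    · simp [Instr.Straight, Instr.Inner]
    · simp only [List.length_cons, List.length_nil]
      omega
  · refine .of_inner trivial ?_ ?_
    · simp only [Instr.succsAt, List.mem_singleton]
      intro t ht
      rw [ht, show start + (s + b) + 4 + e + 1 = start + (s + b + 4 + (e + 1)) by omega, hnorm]
      omega
    · rw [Instr.wpAt, show start + (s + b) + 4 + e + 1 = start + (s + b + 4 + (e + 1)) by omega,
        hnorm, ← hheada, ← hJa.headD]
      · congr 1
        simp only [List.length_cons, List.length_nil]
        omega
      · rw [ha, ← hnext]
        congr 1
        simp only [List.length_cons, List.length_nil]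
        omega
  · refine .of_fixed rfl (.of_inner trivial fun I σ hσ => ?_)
    rw [headD_checksAnns (D := C.inv) _ _ _ _ _ rfl]
    exact Config.sat_exceptional hC hσ
  · refine Seg.checks ds ?_ ?_ ?_ ?_ ?_
    · intro j h0 hj
      rw [he] at hj
      rw [show start + (s + b) + 4 + j = start + (s + b + 4 + j) by omega, hf' _ h0 (by omega)]
      omega
    · rw [he]
    · omega
    · rw [he, ← hJe.right 0 C.inv rfl, he]
      congr 1
    · convert hJe.left.toTail using 1
      simp only [List.length_cons, List.length_nil]
  · refine .of_fixed rfl ?_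
    convert hthr _ using 1
    omega
  · refine Seg.checks ds ?_ ?_ ?_ ?_ ?_
    · intro j h0 hj
      rw [ha] at hj
      rw [show start + (s + b) + 4 + e + 1 + j = start + (s + b + 4 + (e + 1 + j)) by omega,
        hf' _ (by omega) (by omega)]
      omega
    · rw [ha]
    · omega
    · rw [ha, ← hnext]
      congr 1
      omega
    · convert hJa.toTail using 1
      simp only [List.length_cons, List.length_nil]

/-- The assertions at a block. -/
theorem Seg.block (hC : C.WellFormed)
    (hf : ∀ j ≤ callPos T C base k c m, f (start + j) = p + j)
    (hf' : ∀ j, 0 < j → j ≤ (blockRest T C base start k c m).length →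
      f (start + (callPos T C base k c m + 4 + j)) = p + callPos T C base k c m + 8 + j)
    (hJ : Carries (asgn B) p (blockAnns T C base k c m))
    (hnext : asgn B (p + (blockAnns T C base k c m).length) = C.inv)
    (hn : p + (blockAnns T C base k c m).length < n)
    (hinv : Valid T G B C.inv (p + callPos T C base k c m + 2) (.invoke k c m)
      (C.inv.and (callFrame base k m).assn) (C.inv.and (callFrame base k m).assn))
    (hthr : ∀ nxt, Valid T G B C.inv
      (p + callPos T C base k c m + 8 + (blockExc T C base start k c m).length) .athrow C.inv nxt) :
    Seg (Checked C.inv (asgn B) n (Valid T G B C.inv)) C.inv p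
      (IRM.setFirst .inv (blockGhost T C base start k c m f)) (blockAnns T C base k c m) := by
  have hne : blockAnnsFull T C base k c m ≠ [] := by simp [blockAnnsFull]
  have hlen : (blockAnns T C base k c m).length = (blockAnnsFull T C base k c m).length := by
    rw [blockAnns_eq, List.length_cons, List.length_tail]
    have := List.length_pos_iff.2 hne
    omega
  rw [hlen] at hnext hn
  have h := Seg.blockFull hC hf hf' hJ hnext hn hinv hthr
  rw [blockAnns_eq]
  refine h.setFirst ?_ ?_ ?_
  · simp [blockGhost]
  · intro x hx
    have key : ∀ (l l' : List Instr) (r : List (Instr × Tag)) (i : Instr),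
        ∀ x ∈ (innerCode f l ++ (innerCode f l' ++ ((i, .inner) :: r))).head?,
          x.2.fixed C.inv = none := by
      intro l l' r i x hx
      cases l with
      | cons j l =>
        simp [innerCode] at hx
        subst hx
        rfl
      | nil =>
        cases l' with
        | cons j l' =>
          simp [innerCode] at hx
          subst hx
          rfl
        | nil =>
          simp [innerCode] at hx
          subst hx
          rfl
    exact key _ _ _ _ x hx
  · intro I σ hσ
    have := Config.sat_before (base := base) (kd := k) (c := c) (m := m) hC hσ
    unfold blockAnnsFull
    dsimp only
    rwa [headD_stepsAnns_append _ _ _ (headD_checksAnns (D := (ghostArgs k m).step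
      ((ghostUpdate T C .before k c m).step (C.inv.and (callFrame base k m).assn))) _ _ _ _ _ rfl)]

end
end IRM

namespace IRM

/- ## The structure of inlined code -/

theorem length_blockRest (T : Hierarchy) (C : Contract) (base start : ℕ) (k : InvokeKind) (c : ℕ)
    (m : MethodId) : (blockRest T C base start k c m).length =
      (checksAnns C .exceptional m (callFrame base k m) C.inv (T.dispatch k c m)).length + 1 +
        (checksAnns C .after m (callFrame base k m) C.inv (T.dispatch k c m)).length := by
  rw [blockRest, List.length_append, List.length_cons, blockExc, blockAfter,
    length_eventCode _ _ _ _ _ _ _ C.inv, length_eventCode _ _ _ _ _ _ _ C.inv]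
  omega

theorem length_blockCode (T : Hierarchy) (C : Contract) (base start : ℕ) (k : InvokeKind) (c : ℕ)
    (m : MethodId) : (blockCode T C base start k c m).length =
      callPos T C base k c m + 4 + (blockRest T C base start k c m).length := by
  rw [← List.length_map (f := Prod.fst), fst_blockCode, List.length_append, List.length_cons,
    List.length_append, length_blockBefore]
  simp only [List.length_cons, List.length_nil]
  omega

theorem length_blockAnns (T : Hierarchy) (C : Contract) (base start : ℕ) (k : InvokeKind) (c : ℕ)
    (m : MethodId) : (blockAnns T C base k c m).length =
      callPos T C base k c m + 8 + (blockRest T C base start k c m).length := by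
  rw [length_blockRest, callPos, length_eventCode _ _ _ _ _ _ _ ((ghostArgs k m).step
    ((ghostUpdate T C .before k c m).step (C.inv.and (callFrame base k m).assn))), blockAnns_eq]
  simp only [blockAnnsFull, List.length_cons, List.length_tail, List.length_append,
    length_stepsAnns, List.length_nil]
  omega

theorem Instr.asInvoke_relabel (f : ℕ → ℕ) (i : Instr) : (i.relabel f).asInvoke = i.asInvoke := by
  cases i <;> rfl

theorem Instr.eq_of_asInvoke {i : Instr} {k : InvokeKind} {c : ℕ} {m : MethodId}
    (h : i.asInvoke = some (k, c, m)) : i = .invoke k c m := by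
  cases i <;> simp_all [Instr.asInvoke]

theorem inlineChunk_client {i : Instr} (h : i.asInvoke = none) (T : Hierarchy) (C : Contract)
    (base start : ℕ) (loc : ℕ → ℕ) : inlineChunk T C base start loc i =
      [(i.relabel loc, { tag := .client, frame := none })] := by
  cases i <;> first | rfl | simp [Instr.asInvoke] at h

theorem length_inlineChunk (T : Hierarchy) (C : Contract) (base start : ℕ) (loc : ℕ → ℕ)
    (i : Instr) : (inlineChunk T C base start loc i).length =
      (inlineChunk T C base 0 id i).length := by
  cases i with
  | invoke k c m =>
    simp only [inlineChunk, length_blockCode, length_blockRest]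
  | _ => rfl

section
variable (T : Hierarchy) (C : Contract) (M : MethodDef)

/-- The inlined code for a part of the method that starts at label `L`. -/
def inlinePart (L : ℕ) (l : List Instr) : List (Instr × Mark) :=
  (l.zipIdx L).flatMap fun (i, L) =>
    inlineChunk T C M.maxLocals (inlineOffset T C M L) (inlineOffset T C M) i

theorem inlinePart_cons (L : ℕ) (i : Instr) (l : List Instr) : inlinePart T C M L (i :: l) =
    inlineChunk T C M.maxLocals (inlineOffset T C M L) (inlineOffset T C M) i ++
      inlinePart T C M (L + 1) l := by
  rw [inlinePart, List.zipIdx_cons, List.flatMap_cons]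
  rfl

theorem inlinePart_append (L : ℕ) (l l' : List Instr) : inlinePart T C M L (l ++ l') =
    inlinePart T C M L l ++ inlinePart T C M (L + l.length) l' := by
  rw [inlinePart, List.zipIdx_append, List.flatMap_append]
  rfl

theorem length_inlinePart (L : ℕ) (l : List Instr) : (inlinePart T C M L l).length =
    (l.map fun i => (inlineChunk T C M.maxLocals 0 id i).length).sum := by
  induction l generalizing L with
  | nil => rfl
  | cons i r ih =>
    rw [inlinePart_cons, List.length_append, ih, length_inlineChunk, List.map_cons, List.sum_cons]

variable {T C M}

theorem length_inlinePart_prefix {pre suf : List Instr} (h : M.code = pre ++ suf) :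
    (inlinePart T C M 0 pre).length = inlineOffset T C M pre.length := by
  rw [length_inlinePart, inlineOffset, h, List.take_left]

theorem inlineOffset_succ {pre suf : List Instr} {i : Instr} (h : M.code = pre ++ i :: suf) :
    inlineOffset T C M (pre.length + 1) = inlineOffset T C M pre.length +
      (inlineChunk T C M.maxLocals 0 id i).length := by
  have h' : M.code = (pre ++ [i]) ++ suf := by simp [h]
  have := length_inlinePart_prefix (T := T) (C := C) h'
  rw [inlinePart_append, List.length_append, length_inlinePart_prefix h, List.length_append,
    length_inlinePart] at this
  simpa using this.symm

theorem inlineCode_split {pre suf : List Instr} {i : Instr} (h : M.code = pre ++ i :: suf) :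
    (inlineMethod T C M).code = (inlinePart T C M 0 pre).map Prod.fst ++
      ((inlineChunk T C M.maxLocals (inlineOffset T C M pre.length) (inlineOffset T C M) i).map
        Prod.fst ++ (inlinePart T C M (pre.length + 1) suf).map Prod.fst) := by
  have : inlineCode T C M = inlinePart T C M 0 M.code := rfl
  rw [inlineMethod, this, h, inlinePart_append, inlinePart_cons, Nat.zero_add]
  simp

theorem calm_inlineChunk {back : List Instr} (hb : Calm back) (base start : ℕ) (loc : ℕ → ℕ)
    (i : Instr) : Calm (((inlineChunk T C base start loc i).map Prod.fst).reverse ++ back) := by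
  rcases hi : i.asInvoke with _ | ⟨k, c, m⟩
  · rw [inlineChunk_client hi]
    exact hb.cons ((i.asInvoke_relabel loc).trans hi)
  · rw [Instr.eq_of_asInvoke hi, inlineChunk, fst_blockCode, List.reverse_append,
      List.reverse_cons, List.append_assoc, List.append_assoc]
    refine calm_append ?_ (.inl ?_)
    · intro j hj
      rw [List.mem_reverse, List.mem_append] at hj
      rcases hj with hj | hj
      · simp only [List.mem_cons, List.not_mem_nil, or_false] at hj
        rcases hj with rfl | rfl | rfl <;> rfl
      · exact blockRest_noCall _ _ _ _ _ _ _ j hj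
    · simp [blockRest]
      omega

theorem calm_inlinePart {back : List Instr} (hb : Calm back) (L : ℕ) (l : List Instr) :
    Calm (((inlinePart T C M L l).map Prod.fst).reverse ++ back) := by
  induction l generalizing L back with
  | nil => exact hb
  | cons i r ih =>
    rw [inlinePart_cons, List.map_append, List.reverse_append, List.append_assoc]
    exact ih (calm_inlineChunk hb _ _ _ i) _

theorem calm_inlinePrefix (pre : List Instr) :
    Calm ((inlinePart T C M 0 pre).map Prod.fst).reverse := by
  have := calm_inlinePart (T := T) (C := C) (M := M) (back := []) (fun j _ => rfl) 0 pre
  rwa [List.append_nil] at this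

theorem blockCode_call {base start x : ℕ} {k k' : InvokeKind} {c c' : ℕ} {m m' : MethodId}
    (h : ((blockCode T C base start k c m).map Prod.fst)[x]? = some (.invoke k' c' m')) :
    x = callPos T C base k c m := by
  rw [fst_blockCode, ← length_blockBefore T C base start] at *
  rcases Nat.lt_trichotomy x (blockBefore T C base start k c m).length with hx | hx | hx
  · rw [List.getElem?_append_left hx] at h
    have := blockBefore_noCall T C base start k c m _ (List.mem_of_getElem? h)
    simp [Instr.asInvoke] at this
  · exact hx
  · obtain ⟨d, rfl⟩ := Nat.exists_eq_add_of_lt hx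
    rw [List.getElem?_append_right (by omega), show
      (blockBefore T C base start k c m).length + d + 1 -
        (blockBefore T C base start k c m).length = d + 1 by omega, List.getElem?_cons_succ] at h
    have hm := List.mem_of_getElem? h
    rw [List.mem_append] at hm
    rcases hm with hm | hm
    · simp at hm
    · have := blockRest_noCall T C base start k c m _ hm
      simp [Instr.asInvoke] at this

theorem inlinePart_call {pre suf : List Instr} (hM : M.code = pre ++ suf) {x : ℕ} {k : InvokeKind}
    {c : ℕ} {m : MethodId}
    (h : ((inlinePart T C M pre.length suf).map Prod.fst)[x]? = some (.invoke k c m)) :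
    ∃ L k' c' m', M.code[L]? = some (.invoke k' c' m') ∧
      inlineOffset T C M pre.length + x =
        inlineOffset T C M L + callPos T C M.maxLocals k' c' m' := by
  induction suf generalizing pre x with
  | nil => simp [inlinePart] at h
  | cons i r ih =>
    rw [inlinePart_cons, List.map_append] at h
    rcases Nat.lt_or_ge x (((inlineChunk T C M.maxLocals (inlineOffset T C M pre.length)
      (inlineOffset T C M) i).map Prod.fst).length) with hx | hx
    · rw [List.getElem?_append_left hx] at h
      rcases hi : i.asInvoke with _ | ⟨k', c', m'⟩
      · rw [inlineChunk_client hi] at h hx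
        have hm := List.mem_of_getElem? h
        simp only [List.map_cons, List.map_nil, List.mem_singleton] at hm
        have := (i.asInvoke_relabel (inlineOffset T C M)).trans hi
        rw [← hm] at this
        simp [Instr.asInvoke] at this
      · have hi' := Instr.eq_of_asInvoke hi
        subst hi'
        refine ⟨pre.length, k', c', m', by simp [hM], ?_⟩
        rw [blockCode_call h]
    · rw [List.getElem?_append_right hx] at h
      rw [List.length_map, length_inlineChunk] at hx h
      obtain ⟨L, k', c', m', hL, heq⟩ := ih (pre := pre ++ [i]) (by simp [hM]) (x := x -
        (inlineChunk T C M.maxLocals 0 id i).length) (by simpa using h)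
      refine ⟨L, k', c', m', hL, ?_⟩
      rw [← heq, List.length_append, List.length_singleton, inlineOffset_succ hM]
      omega

theorem mem_inlineHandlers {h : Handler} : h ∈ inlineHandlers T C M ↔
    ∃ L k c m, M.code[L]? = some (.invoke k c m) ∧
      h = ⟨inlineOffset T C M L + callPos T C M.maxLocals k c m,
        inlineOffset T C M L + callPos T C M.maxLocals k c m + 1,
        inlineOffset T C M L + callPos T C M.maxLocals k c m + 4, none⟩ := by
  rw [inlineHandlers, List.mem_filterMap]
  constructor
  · rintro ⟨⟨i, L⟩, hL, h'⟩
    rw [List.mk_mem_zipIdx_iff_getElem?] at hL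
    cases i with
    | invoke k c m => exact ⟨L, k, c, m, hL, (Option.some.inj h').symm⟩
    | _ => simp at h'
  · rintro ⟨L, k, c, m, hL, rfl⟩
    exact ⟨(.invoke k c m, L), List.mk_mem_zipIdx_iff_getElem?.2 hL, rfl⟩

theorem inlineMethod_handlersAhead : (inlineMethod T C M).HandlersAhead := by
  intro x k c m hx
  have hx' : ((inlinePart T C M 0 M.code).map Prod.fst)[x]? = some (.invoke k c m) := hx
  obtain ⟨L, k', c', m', hL, heq⟩ := inlinePart_call (pre := []) (by simp) hx'
  have h0 : inlineOffset T C M 0 = 0 := by simp [inlineOffset]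
  rw [List.length_nil, h0, Nat.zero_add] at heq
  have hmem := (mem_inlineHandlers (T := T) (C := C)).2 ⟨L, k', c', m', hL, rfl⟩
  rw [← heq] at hmem
  unfold MethodDef.excTarget inlineMethod
  rw [List.find?_append]
  obtain ⟨h, hh⟩ : ∃ h, (inlineHandlers T C M).find? (fun h => decide (h.lo ≤ x ∧ x < h.hi)) =
      some h := by
    rw [← Option.isSome_iff_exists, List.find?_isSome]
    exact ⟨_, hmem, by simp⟩
  rw [hh, Option.some_or]
  have h1 := List.find?_some hh
  obtain ⟨L₁, k₁, c₁, m₁, -, rfl⟩ := mem_inlineHandlers.1 (List.mem_of_find?_eq_some hh)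
  simp only [decide_eq_true_eq] at h1
  have : inlineOffset T C M L₁ + callPos T C M.maxLocals k₁ c₁ m₁ = x := by omega
  simp [this]

theorem MethodDef.HandlersAhead.ghostReady {N : MethodDef} (h : N.HandlersAhead) :
    N.GhostReady := by
  intro L k c m hL
  rw [h L k c m hL]
  rfl

end
end IRM

namespace IRM

/- ## Labels of inlined code with ghost updates -/

section
variable {T : Hierarchy} {C : Contract} {M : MethodDef}

theorem inlineMethod_block {pre suf : List Instr} {k : InvokeKind} {c : ℕ} {m : MethodId}
    (h : M.code = pre ++ .invoke k c m :: suf) :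
    ∃ P S : List Instr, P.length = inlineOffset T C M pre.length ∧ Calm P.reverse ∧
      (inlineMethod T C M).code = P ++
        ((blockCode T C M.maxLocals P.length k c m).map Prod.fst ++ S) := by
  have hl : ((inlinePart T C M 0 pre).map Prod.fst).length = inlineOffset T C M pre.length := by
    rw [List.length_map, length_inlinePart_prefix h]
  refine ⟨_, (inlinePart T C M (pre.length + 1) suf).map Prod.fst, hl, calm_inlinePrefix pre, ?_⟩
  rw [hl]
  exact inlineCode_split h

variable (T C M) in
/-- The position of the instruction `L` after inlining and embedding the ghost updates. -/
def ghostLabel (L : ℕ) : ℕ := ghostOffset T C (inlineMethod T C M) (inlineOffset T C M L)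

theorem ghostLabel_mono {L L' : ℕ} (h : L ≤ L') : ghostLabel T C M L ≤ ghostLabel T C M L' := by
  refine ghostOffset_mono T C inlineMethod_handlersAhead ?_
  obtain ⟨d, rfl⟩ := Nat.exists_eq_add_of_le h
  rw [inlineOffset, inlineOffset, List.take_add, List.map_append, List.sum_append]
  exact Nat.le_add_right _ _

section
variable {pre suf : List Instr} {k : InvokeKind} {c : ℕ} {m : MethodId}

theorem ghostOffset_before (h : M.code = pre ++ .invoke k c m :: suf) {j : ℕ}
    (hj : j ≤ callPos T C M.maxLocals k c m) :
    ghostOffset T C (inlineMethod T C M) (inlineOffset T C M pre.length + j) =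
      ghostLabel T C M pre.length + j := by
  obtain ⟨P, S, hP, hb, hN⟩ := inlineMethod_block (T := T) (C := C) h
  have := offset_before T C inlineMethod_handlersAhead hb hN hj
  rwa [hP] at this

theorem ghostOffset_call (h : M.code = pre ++ .invoke k c m :: suf) :
    ghostOffset T C (inlineMethod T C M)
      (inlineOffset T C M pre.length + (callPos T C M.maxLocals k c m + 1)) =
        ghostLabel T C M pre.length + callPos T C M.maxLocals k c m + 4 := by
  obtain ⟨P, S, hP, hb, hN⟩ := inlineMethod_block (T := T) (C := C) h
  have := offset_call T C inlineMethod_handlersAhead hb hN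
  rwa [hP] at this

theorem ghostOffset_handler (h : M.code = pre ++ .invoke k c m :: suf) :
    ghostOffset T C (inlineMethod T C M)
      (inlineOffset T C M pre.length + (callPos T C M.maxLocals k c m + 4)) =
        ghostLabel T C M pre.length + callPos T C M.maxLocals k c m + 7 := by
  obtain ⟨P, S, hP, hb, hN⟩ := inlineMethod_block (T := T) (C := C) h
  have := offset_handler T C inlineMethod_handlersAhead hb hN
  rwa [hP] at this

theorem ghostOffset_rest (h : M.code = pre ++ .invoke k c m :: suf) (start : ℕ) {j : ℕ}
    (hj₀ : 0 < j) (hj : j ≤ (blockRest T C M.maxLocals start k c m).length) :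
    ghostOffset T C (inlineMethod T C M)
      (inlineOffset T C M pre.length + (callPos T C M.maxLocals k c m + 4 + j)) =
        ghostLabel T C M pre.length + callPos T C M.maxLocals k c m + 8 + j := by
  obtain ⟨P, S, hP, hb, hN⟩ := inlineMethod_block (T := T) (C := C) h
  have := offset_rest T C inlineMethod_handlersAhead hb hN hj₀
    (by rwa [length_blockRest] at hj ⊢)
  rwa [hP] at this

end

variable (T C M) in
/-- The assertions for one instruction. -/
def instrAnns (i : Instr) : List Assn :=
  i.asInvoke.elim [C.inv] fun p => blockAnns T C M.maxLocals p.1 p.2.1 p.2.2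

theorem methodAnns_eq : methodAnns T C M = M.code.flatMap (instrAnns T C M) := rfl

theorem instrAnns_eq_cons (i : Instr) : ∃ r, instrAnns T C M i = C.inv :: r := by
  rcases hi : i.asInvoke with _ | ⟨k, c, m⟩
  · exact ⟨[], by rw [instrAnns, hi]; rfl⟩
  · exact ⟨_, by rw [instrAnns, hi]; exact blockAnns_eq⟩

theorem ghostLabel_succ {pre suf : List Instr} {i : Instr} (h : M.code = pre ++ i :: suf) :
    ghostLabel T C M (pre.length + 1) =
      ghostLabel T C M pre.length + (instrAnns T C M i).length := by
  rcases hi : i.asInvoke with _ | ⟨k, c, m⟩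
  · have hs := inlineCode_split (T := T) (C := C) h
    rw [inlineChunk_client hi] at hs
    have hl : ((inlinePart T C M 0 pre).map Prod.fst).length = inlineOffset T C M pre.length := by
      rw [List.length_map, length_inlinePart_prefix h]
    have := ghostOffset_append T C inlineMethod_handlersAhead hs
    rw [walkLen_calm (calm_inlinePrefix pre), hl] at this
    · rw [ghostLabel, inlineOffset_succ h, inlineChunk_client hi, instrAnns, hi]
      exact this
    · simpa using (i.asInvoke_relabel (inlineOffset T C M)).trans hi
  · have hi' := Instr.eq_of_asInvoke hi
    subst hi'
    rw [ghostLabel, inlineOffset_succ h, inlineChunk, length_blockCode,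
      ghostOffset_rest h 0 (by rw [length_blockRest]; omega) le_rfl, instrAnns]
    simp only [Instr.asInvoke, Option.elim]
    rw [length_blockAnns T C _ 0]
    omega

theorem ghostLabel_eq {pre suf : List Instr} (h : M.code = pre ++ suf) :
    ghostLabel T C M pre.length = (pre.flatMap (instrAnns T C M)).length := by
  induction pre using List.reverseRecOn generalizing suf with
  | nil => simp [ghostLabel, inlineOffset, ghostOffset]
  | append_singleton pre i ih =>
    have h' : M.code = pre ++ i :: suf := by simp [h]
    rw [List.length_append, List.length_singleton, ghostLabel_succ h', ih h',
      List.flatMap_append, List.length_append]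
    simp

theorem ghostLabel_length :
    ghostLabel T C M M.code.length = (methodAnns T C M).length :=
  ghostLabel_eq (suf := []) (by simp)

theorem carries_methodAnns {pre suf : List Instr} {i : Instr} (h : M.code = pre ++ i :: suf) :
    Carries (asgn (methodAnns T C M)) (ghostLabel T C M pre.length) (instrAnns T C M i) := by
  intro j a hj
  have hlt : j < (instrAnns T C M i).length := (List.getElem?_eq_some_iff.1 hj).1
  rw [asgn, methodAnns_eq, h, List.flatMap_append, List.flatMap_cons, ghostLabel_eq h,
    List.getD_eq_getElem?_getD, List.getElem?_append_right (Nat.le_add_right _ _),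
    Nat.add_sub_cancel_left, List.getElem?_append_left hlt, hj, Option.getD_some]

theorem code_split {L : ℕ} (hL : L < M.code.length) : ∃ pre i suf,
    M.code = pre ++ i :: suf ∧ pre.length = L ∧ M.code[L]? = some i := by
  refine ⟨M.code.take L, M.code[L], M.code.drop (L + 1), ?_, ?_, ?_⟩
  · rw [List.getElem_cons_drop, List.take_append_drop]
  · simpa using hL.le
  · exact List.getElem?_eq_getElem hL

theorem asgn_ghostLabel {L : ℕ} (hL : L < M.code.length) :
    asgn (methodAnns T C M) (ghostLabel T C M L) = C.inv := by
  obtain ⟨pre, i, suf, h, rfl, -⟩ := code_split hL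
  obtain ⟨r, hr⟩ := instrAnns_eq_cons (T := T) (C := C) (M := M) i
  exact carries_methodAnns h 0 C.inv (by rw [hr]; rfl)

theorem ghostLabel_lt {L : ℕ} (hL : L < M.code.length) :
    ghostLabel T C M L < (methodAnns T C M).length := by
  obtain ⟨pre, i, suf, h, rfl, -⟩ := code_split hL
  obtain ⟨r, hr⟩ := instrAnns_eq_cons (T := T) (C := C) (M := M) i
  have h1 := ghostLabel_succ (T := T) (C := C) h
  have h2 := ghostLabel_mono (T := T) (C := C) (M := M) (Nat.succ_le_of_lt hL)
  rw [ghostLabel_length] at h2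
  rw [hr, List.length_cons] at h1
  simp only [Nat.succ_eq_add_one] at h2
  omega

theorem ghostMethod_code (ms : List Mark) (N : MethodDef) :
    (ghostMethod T C N).code = (ghostCode T C N ms).map Prod.fst := by
  have h : ∀ L i (μ ν : Mark), (ghostChunk T C N L i μ).map Prod.fst =
      (ghostChunk T C N L i ν).map Prod.fst := by
    intro L i μ ν
    unfold ghostChunk
    rw [List.map_append, List.map_append, List.map_filterMap, List.map_filterMap]
    congr 1
    · refine List.filterMap_congr fun x _ => ?_
      obtain ⟨j, x⟩ := x
      cases j with
      | invoke k c m =>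
        dsimp only
        split_ifs <;> rfl
      | _ => rfl
    · cases i <;> rfl
  unfold ghostMethod ghostCode
  simp only [List.map_flatMap, List.map_map]
  refine List.flatMap_congr fun x _ => ?_
  have := congrArg (List.map (Instr.relabel (ghostOffset T C N)))
    (h x.2 x.1 (markAt [] x.2) (markAt ms x.2))
  simp only [List.map_map] at this
  exact this

/-- The inlined code with ghost updates and tags. -/
theorem ghostCode_inline : ghostCode T C (inlineMethod T C M) ((inlineCode T C M).map Prod.snd) =
    ghostWalk T C (ghostOffset T C (inlineMethod T C M)) [] (inlinePart T C M 0 M.code) :=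
  ghostCode_eq T C inlineMethod_handlersAhead rfl

end
end IRM

namespace IRM

/- ## Local validity -/

section
variable {I : Interp} {T : Hierarchy} {C : Contract} {σ σ' : Config}

theorem Contract.holds_inv_subst (C : Contract) {θ : Subst} {ρ : Env}
    (hs : ∀ x, θ.stat (.sec x) = .stat (.sec x)) (hg : ∀ x, θ.ghost (.ms x) = .ghost (.ms x)) :
    (C.inv.subst θ).holds I T ρ ↔ C.inv.holds I T ρ := by
  rw [Assn.holds_subst, Contract.holds_inv, Contract.holds_inv]
  simp only [Env.subst, hs, hg, Expr.eval]

theorem Config.SameMonitor.sat_inv (h : σ.SameMonitor σ') (hσ : σ.Sat I T C.inv) :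
    σ'.Sat I T C.inv := by
  unfold Config.Sat at *
  rw [Contract.holds_inv] at *
  intro x hx
  have := hσ x hx
  simpa only [Config.toEnv, h.1, h.2] using this

theorem Config.CallFrame.sat_assn (h : σ.CallFrame σ') {F : Frame} (hσ : σ.Sat I T F.assn) :
    σ'.Sat I T F.assn := by
  unfold Config.Sat at *
  rw [Frame.holds_assn] at *
  simpa only [Config.toEnv, h.1, h.2.1, h.2.2] using hσ

theorem Config.sat_throwWp {H : List Handler} {A : List Assn} {post : Assn} {L : ℕ}
    (hpost : σ.Sat I T post)
    (h : ∀ d ∈ H, d.lo ≤ L → L < d.hi → σ.Sat I T (asgn A d.target)) :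
    σ.Sat I T (throwWp H A post L) := by
  induction H with
  | nil => exact hpost
  | cons d r ih =>
    have ih' := ih fun d' hd' => h d' (List.mem_cons_of_mem _ hd')
    refine ⟨?_, ?_⟩
    · rintro ⟨⟨-, hc⟩, hn⟩
      split_ifs at hc with hr
      · exact hn (h d List.mem_cons_self hr.1 hr.2)
      · exact hc
    · exact fun hn => hn.2 ih'

end

section
variable {T : Hierarchy} {C : Contract} {M : MethodDef}

/-- Handlers of inlined blocks cover the ghost updates and the call of a block, and nothing else. -/
theorem inlineHandler_covers {d : Handler} (hd : d ∈ inlineHandlers T C M)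
    {pre suf : List Instr} {i : Instr} (h : M.code = pre ++ i :: suf) {p : ℕ}
    (hp : ghostLabel T C M pre.length ≤ p) (hp' : p < ghostLabel T C M (pre.length + 1))
    (hlo : (d.relabel (ghostOffset T C (inlineMethod T C M))).lo ≤ p)
    (hhi : p < (d.relabel (ghostOffset T C (inlineMethod T C M))).hi) :
    ∃ k c m, i = .invoke k c m ∧
      p < ghostLabel T C M pre.length + callPos T C M.maxLocals k c m + 4 ∧
      (d.relabel (ghostOffset T C (inlineMethod T C M))).target =
        ghostLabel T C M pre.length + callPos T C M.maxLocals k c m + 7 := by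
  obtain ⟨L, k, c, m, hL, rfl⟩ := mem_inlineHandlers.1 hd
  obtain ⟨pre', i', suf', h', rfl, hi'⟩ := code_split (List.getElem?_eq_some_iff.1 hL).1
  rw [hL, Option.some.injEq] at hi'
  subst hi'
  have h1 := ghostOffset_before (T := T) (C := C) h' le_rfl
  have h2 := ghostOffset_call (T := T) (C := C) h'
  have h3 := ghostOffset_handler (T := T) (C := C) h'
  have h4 := ghostLabel_succ (T := T) (C := C) h'
  rw [← Nat.add_assoc] at h2 h3
  simp only [Handler.relabel] at hlo hhi ⊢
  rw [h1] at hlo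
  rw [h2] at hhi
  rw [h3]
  simp only [instrAnns, Instr.asInvoke, Option.elim] at h4
  rw [length_blockAnns T C _ 0] at h4
  rcases Nat.lt_trichotomy pre.length pre'.length with hlt | heq | hgt
  · have := ghostLabel_mono (T := T) (C := C) (M := M) (Nat.succ_le_of_lt hlt)
    simp only [Nat.succ_eq_add_one] at this
    omega
  · have hii : i = .invoke k c m := by
      have e1 : M.code[pre.length]? = some i := by simp [h]
      rw [heq, hL] at e1
      exact (Option.some.inj e1).symm
    exact ⟨k, c, m, hii, by rw [heq]; exact hhi, by rw [heq]⟩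
  · have := ghostLabel_mono (T := T) (C := C) (M := M) (Nat.succ_le_of_lt hgt)
    simp only [Nat.succ_eq_add_one] at this
    omega

/-- Raising an exception preserves the monitor invariant. -/
theorem sat_throwWp_ghostMethod {I : Interp} {σ : Config} (hM : M.WellFormed) {p : ℕ}
    (hσ : σ.Sat I T C.inv)
    (h : ∀ d ∈ inlineHandlers T C M,
      (d.relabel (ghostOffset T C (inlineMethod T C M))).lo ≤ p →
      p < (d.relabel (ghostOffset T C (inlineMethod T C M))).hi → σ.Sat I T
        (asgn (methodAnns T C M) (d.relabel (ghostOffset T C (inlineMethod T C M))).target)) :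
    σ.Sat I T (throwWp (ghostMethod T C (inlineMethod T C M)).handlers (methodAnns T C M)
      C.inv p) := by
  refine Config.sat_throwWp hσ fun d hd hlo hhi => ?_
  simp only [ghostMethod, inlineMethod, List.map_append, List.mem_append, List.mem_map] at hd
  rcases hd with ⟨d, hd, rfl⟩ | ⟨_, ⟨d, hd, rfl⟩, rfl⟩
  · exact h d hd hlo hhi
  · have := asgn_ghostLabel (T := T) (C := C) (hM.handlers d hd)
    rw [← this] at hσ
    exact hσ

theorem ghostLabel_next {pre suf : List Instr} {i : Instr} (h : M.code = pre ++ i :: suf)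
    (hi : i.asInvoke = none) : ghostLabel T C M (pre.length + 1) = ghostLabel T C M pre.length + 1 := by
  rw [ghostLabel_succ h, instrAnns, hi]
  rfl

/-- Instructions that are not inlined are locally valid. -/
theorem Valid.client (hM : M.WellFormed) {pre suf : List Instr} {i : Instr}
    (h : M.code = pre ++ i :: suf) (hi : i.asInvoke = none) (nxt : Assn) :
    Valid T (ghostMethod T C (inlineMethod T C M)) (methodAnns T C M) C.inv
      (ghostLabel T C M pre.length)
      ((i.relabel (inlineOffset T C M)).relabel (ghostOffset T C (inlineMethod T C M)))
      C.inv nxt := by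
  intro I σ hp _ hσ
  have hL : M.code[pre.length]? = some i := by simp [h]
  have hmem : i ∈ M.code := List.mem_of_getElem? hL
  have hc := hM.client i hmem
  have hnext : i.FallsThrough →
      asgn (methodAnns T C M) (ghostLabel T C M pre.length + 1) = C.inv := by
    intro hf
    rw [← ghostLabel_next h hi]
    exact asgn_ghostLabel (hM.next _ i hL hf)
  have htgt : ∀ t ∈ i.targets, asgn (methodAnns T C M)
      (ghostOffset T C (inlineMethod T C M) (inlineOffset T C M t)) = C.inv :=
    fun t ht => asgn_ghostLabel (hM.targets i hmem t ht)
  have hthr : ∀ σ' : Config, σ'.Sat I T C.inv → σ'.Sat I T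
      (throwWp (ghostMethod T C (inlineMethod T C M)).handlers (methodAnns T C M) C.inv
        (ghostLabel T C M pre.length)) := by
    intro σ' hσ'
    refine sat_throwWp_ghostMethod hM hσ' fun d hd hlo hhi => ?_
    obtain ⟨k, c, m, rfl, -⟩ := inlineHandler_covers hd h le_rfl
      (by rw [ghostLabel_next h hi]; omega) hlo hhi
    simp [Instr.asInvoke] at hi
  have hsub : ∀ θ : Subst, (∀ x, θ.stat (.sec x) = .stat (.sec x)) →
      (∀ x, θ.ghost (.ms x) = .ghost (.ms x)) → σ.Sat I T (C.inv.subst θ) :=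
    fun θ h1 h2 => (C.holds_inv_subst h1 h2).2 hσ
  unfold wp FlowCondition
  generalize hG : (ghostMethod T C (inlineMethod T C M)) = G at *
  cases i with
  | invoke k c m => simp [Instr.asInvoke] at hi
  | ghost u => exact hc.elim
  | other k b ts =>
    simp only [Instr.relabel] at hp
    rw [hp]
    refine ⟨trivial, fun σ' hσ' t ht => ?_, fun σ' v hσ' _ => hthr σ' (hσ'.sat_inv hσ)⟩
    rcases ht with ⟨rfl, rfl⟩ | ht
    · rw [hnext rfl]
      exact hσ'.sat_inv hσ
    · rw [List.map_map, List.mem_map] at ht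
      obtain ⟨t, ht, rfl⟩ := ht
      rw [Function.comp_apply, htgt t ht]
      exact hσ'.sat_inv hσ
  | athrow =>
    simp only [Instr.relabel] at hp
    rw [hp]
    exact ⟨hthr σ hσ, trivial⟩
  | ret =>
    simp only [Instr.relabel] at hp
    rw [hp]
    exact ⟨hσ, trivial⟩
  | exit =>
    simp only [Instr.relabel] at hp
    rw [hp]
    exact ⟨trivial, trivial⟩
  | goto t =>
    simp only [Instr.relabel] at hp
    rw [hp]
    refine ⟨?_, trivial⟩
    dsimp only
    rw [htgt t (by simp [Instr.targets])]
    exact hσ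
  | ificmpeq t =>
    simp only [Instr.relabel] at hp
    rw [hp]
    refine ⟨?_, trivial⟩
    dsimp only
    rw [htgt t (by simp [Instr.targets]), hnext trivial]
    have := hsub { stack := fun i => .stack (i + 2) } (fun _ => rfl) (fun _ => rfl)
    exact ⟨fun hn => hn.2 this, fun hn => hn.2 this⟩
  | ifeq t =>
    simp only [Instr.relabel] at hp
    rw [hp]
    refine ⟨?_, trivial⟩
    dsimp only
    rw [htgt t (by simp [Instr.targets]), hnext trivial]
    have := hsub { stack := fun i => .stack (i + 1) } (fun _ => rfl) (fun _ => rfl)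
    exact ⟨fun hn => hn.2 this, fun hn => hn.2 this⟩
  | putstatic x =>
    cases x with
    | sec x => exact hc.elim
    | user c f =>
      simp only [Instr.relabel] at hp
      rw [hp]
      refine ⟨?_, trivial⟩
      dsimp only
      rw [hnext trivial]
      unfold Config.Sat
      rw [Assn.holds_subst, Assn.shift, Contract.holds_inv_subst C (fun _ => rfl) fun _ => rfl,
        ← Assn.holds_subst, Contract.holds_inv_subst C (fun _ => by simp) fun _ => rfl]
      exact hσ
  | astore n =>
    simp only [Instr.relabel] at hp
    rw [hp]
    refine ⟨?_, trivial⟩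
    dsimp only
    rw [hnext trivial]
    unfold Config.Sat
    rw [Assn.holds_subst, Assn.shift, Contract.holds_inv_subst C (fun _ => rfl) fun _ => rfl,
      ← Assn.holds_subst, Contract.holds_inv_subst C (fun _ => rfl) fun _ => rfl]
    exact hσ
  | _ =>
    simp only [Instr.relabel] at hp
    rw [hp]
    refine ⟨?_, trivial⟩
    dsimp only
    rw [hnext trivial]
    exact hsub _ (fun _ => rfl) (fun _ => rfl)

section
variable {pre suf : List Instr} {k : InvokeKind} {c : ℕ} {m : MethodId}

/-- The labels of a block are in the range of the block. -/
theorem ghostLabel_block (h : M.code = pre ++ .invoke k c m :: suf) (start : ℕ) :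
    ghostLabel T C M (pre.length + 1) = ghostLabel T C M pre.length +
      (callPos T C M.maxLocals k c m + 8 + (blockRest T C M.maxLocals start k c m).length) := by
  rw [ghostLabel_succ h, instrAnns, Instr.asInvoke, Option.elim, length_blockAnns T C _ start]

/-- The assertion at the handler of a call. -/
theorem asgn_handler (h : M.code = pre ++ .invoke k c m :: suf) :
    asgn (methodAnns T C M) (ghostLabel T C M pre.length + callPos T C M.maxLocals k c m + 7) =
      C.inv.and (callFrame M.maxLocals k m).assn := by
  have hJ : Carries _ _ (blockAnns T C M.maxLocals k c m) := carries_methodAnns h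
  have hJ := hJ.blockAnnsFull
  unfold blockAnnsFull at hJ
  have := hJ.right.right.tail.tail.tail.tail.right.tail 0 _ rfl
  rw [← this]
  congr 1
  rw [callPos, length_eventCode _ _ _ _ _ _ _ ((ghostArgs k m).step
    ((ghostUpdate T C .before k c m).step (C.inv.and (callFrame M.maxLocals k m).assn)))]
  simp only [length_stepsAnns, List.length_cons, List.length_nil]
  omega

/-- Calls are locally valid. -/
theorem Valid.call (hM : M.WellFormed) (h : M.code = pre ++ .invoke k c m :: suf) :
    Valid T (ghostMethod T C (inlineMethod T C M)) (methodAnns T C M) C.inv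
      (ghostLabel T C M pre.length + callPos T C M.maxLocals k c m + 2) (.invoke k c m)
      (C.inv.and (callFrame M.maxLocals k m).assn) (C.inv.and (callFrame M.maxLocals k m).assn) := by
  intro I σ hp hnxt hσ
  unfold wp FlowCondition
  rw [hp]
  refine ⟨hσ.1, fun σ' v hf _ hσ' => ?_, fun σ' v hf _ hσ' => ?_⟩
  · rw [hnxt]
    exact ⟨hσ', hf.sat_assn hσ.2⟩
  · refine sat_throwWp_ghostMethod hM hσ' fun d hd hlo hhi => ?_
    obtain ⟨k', c', m', hi, -, ht⟩ := inlineHandler_covers hd h (by omega)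
      (by rw [ghostLabel_block h 0]; omega) hlo hhi
    obtain ⟨rfl, rfl, rfl⟩ := (Instr.invoke.injEq ..).mp hi
    rw [ht, asgn_handler h]
    exact ⟨hσ', hf.sat_assn hσ.2⟩

/-- The rethrowing instruction of a block is locally valid. -/
theorem Valid.rethrow (hM : M.WellFormed) (h : M.code = pre ++ .invoke k c m :: suf) (start : ℕ)
    (nxt : Assn) :
    Valid T (ghostMethod T C (inlineMethod T C M)) (methodAnns T C M) C.inv
      (ghostLabel T C M pre.length + callPos T C M.maxLocals k c m + 8 +
        (blockExc T C M.maxLocals start k c m).length) .athrow C.inv nxt := by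
  intro I σ hp _ hσ
  unfold wp FlowCondition
  rw [hp]
  refine ⟨sat_throwWp_ghostMethod hM hσ fun d hd hlo hhi => ?_, trivial⟩
  obtain ⟨k', c', m', hi, hlt, -⟩ := inlineHandler_covers hd h (by omega) (by
    rw [ghostLabel_block h start, blockRest, List.length_append, List.length_cons]
    omega) hlo hhi
  obtain ⟨rfl, rfl, rfl⟩ := (Instr.invoke.injEq ..).mp hi
  omega

end

end
end IRM

namespace IRM

section
variable {T : Hierarchy} {C : Contract} {M : MethodDef}

/-- The assertions of a method at its inlined code with ghost updates. -/
theorem Seg.method (hC : C.WellFormed) (hM : M.WellFormed) (suf : List Instr) :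
    ∀ pre, M.code = pre ++ suf →
      Seg (Checked C.inv (asgn (methodAnns T C M)) (methodAnns T C M).length
        (Valid T (ghostMethod T C (inlineMethod T C M)) (methodAnns T C M) C.inv)) .ff
        (ghostLabel T C M pre.length)
        (ghostWalk T C (ghostOffset T C (inlineMethod T C M))
          ((inlinePart T C M 0 pre).map Prod.fst).reverse (inlinePart T C M pre.length suf))
        (suf.flatMap (instrAnns T C M)) := by
  induction suf with
  | nil => exact fun pre _ => .nil _
  | cons i r ih =>
    intro pre h
    have ih' := ih (pre ++ [i]) (by simp [h])
    have hb : Calm ((inlinePart T C M 0 pre).map Prod.fst).reverse := calm_inlinePrefix pre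
    have hpart : ((inlinePart T C M 0 (pre ++ [i])).map Prod.fst).reverse =
        ((inlineChunk T C M.maxLocals (inlineOffset T C M pre.length) (inlineOffset T C M) i).map
          Prod.fst).reverse ++ ((inlinePart T C M 0 pre).map Prod.fst).reverse := by
      rw [inlinePart_append, inlinePart_cons, Nat.zero_add]
      simp [inlinePart]
    rw [hpart, List.length_append, List.length_singleton, ghostLabel_succ h] at ih'
    rw [inlinePart_cons, ghostWalk_append, List.flatMap_cons]
    generalize hrest : ghostWalk T C (ghostOffset T C (inlineMethod T C M))
      (((inlineChunk T C M.maxLocals (inlineOffset T C M pre.length) (inlineOffset T C M) i).map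
        Prod.fst).reverse ++ ((inlinePart T C M 0 pre).map Prod.fst).reverse)
          (inlinePart T C M (pre.length + 1) r) = rest at ih' ⊢
    rcases hi : i.asInvoke with _ | ⟨k, c, m⟩
    · rw [inlineChunk_client hi, ghostWalk_calm hb]
      · have ha : instrAnns T C M i = [C.inv] := by
          rw [instrAnns, hi]
          rfl
        rw [ha] at ih' ⊢
        refine .cons (.of_fixed rfl (.client hM h hi _)) ?_
        exact ih'
      · simpa using (i.asInvoke_relabel (inlineOffset T C M)).trans hi
    · have hi' := Instr.eq_of_asInvoke hi
      subst hi'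
      have hL : pre.length + 1 < M.code.length :=
        hM.next pre.length (.invoke k c m) (by simp [h]) trivial
      have hr : r ≠ [] := by
        rintro rfl
        simp [h] at hL
      have hhead : (r.flatMap (instrAnns T C M)).headD .ff = C.inv := by
        cases r with
        | nil => exact absurd rfl hr
        | cons j r =>
          obtain ⟨l, hl⟩ := instrAnns_eq_cons (T := T) (C := C) (M := M) j
          rw [List.flatMap_cons, hl]
          rfl
      have hs := ghostLabel_succ (T := T) (C := C) h
      have ha : instrAnns T C M (.invoke k c m) = blockAnns T C M.maxLocals k c m := rfl
      rw [inlineChunk, ghostWalk_block T C _ _ k c m hb]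
      rw [ha] at ih' hs ⊢
      have hblock : Seg (Checked C.inv (asgn (methodAnns T C M)) (methodAnns T C M).length
          (Valid T (ghostMethod T C (inlineMethod T C M)) (methodAnns T C M) C.inv)) C.inv
          (ghostLabel T C M pre.length)
          (IRM.setFirst .inv (blockGhost T C M.maxLocals (inlineOffset T C M pre.length) k c m
            (ghostOffset T C (inlineMethod T C M)))) (blockAnns T C M.maxLocals k c m) := by
        refine Seg.block hC (fun j hj => ghostOffset_before h hj)
          (fun j h0 hj => ghostOffset_rest h _ h0 hj) (carries_methodAnns h) ?_ ?_
          (Valid.call hM h) (Valid.rethrow hM h _)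
        · rw [← hs]
          exact asgn_ghostLabel hL
        · rw [← hs]
          exact ghostLabel_lt hL
      refine Seg.append (hhead.symm ▸ hblock) ?_
      rw [← hblock.length_eq]
      exact ih'

theorem ghostLabel_zero : ghostLabel T C M 0 = 0 := by
  simp [ghostLabel, inlineOffset, ghostOffset]

theorem Seg.inlined (hC : C.WellFormed) (hM : M.WellFormed) :
    Seg (Checked C.inv (asgn (methodAnns T C M)) (methodAnns T C M).length
      (Valid T (ghostMethod T C (inlineMethod T C M)) (methodAnns T C M) C.inv)) .ff 0
      (ghostCode T C (inlineMethod T C M) ((inlineCode T C M).map Prod.snd))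
      (methodAnns T C M) := by
  have := Seg.method (T := T) hC hM M.code [] rfl
  rw [ghostCode_inline, methodAnns_eq]
  rw [methodAnns_eq, List.length_nil, ghostLabel_zero] at this
  exact this

/-- What `Seg.inlined` says of a label. -/
theorem checked_label (hC : C.WellFormed) (hM : M.WellFormed) {L : ℕ}
    (hL : L < (ghostMethod T C (inlineMethod T C M)).code.length) :
    ∃ i t, (ghostMethod T C (inlineMethod T C M)).code[L]? = some i ∧
      (methodTags T C M).getD L .client = t ∧
      Checked C.inv (asgn (methodAnns T C M)) (methodAnns T C M).length
        (Valid T (ghostMethod T C (inlineMethod T C M)) (methodAnns T C M) C.inv) L (i, t)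
        (asgn (methodAnns T C M) L) (asgn (methodAnns T C M) (L + 1)) := by
  have hs := Seg.inlined (T := T) hC hM
  have hcode := ghostMethod_code (T := T) (C := C) ((inlineCode T C M).map Prod.snd)
    (inlineMethod T C M)
  have htags : methodTags T C M = (ghostCode T C (inlineMethod T C M)
    ((inlineCode T C M).map Prod.snd)).map Prod.snd := rfl
  rw [hcode, List.length_map] at hL
  generalize ghostCode T C (inlineMethod T C M) ((inlineCode T C M).map Prod.snd) = l at *
  obtain ⟨a, ha, hc⟩ := hs.get (List.getElem?_eq_getElem hL)
  refine ⟨l[L].1, l[L].2, ?_, ?_, ?_⟩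
  · rw [hcode, List.getElem?_map, List.getElem?_eq_getElem hL]
    rfl
  · rw [htags, List.getD_eq_getElem?_getD, List.getElem?_map, List.getElem?_eq_getElem hL]
    rfl
  · rw [Nat.zero_add] at hc
    have : asgn (methodAnns T C M) L = a := by
      rw [asgn, List.getD_eq_getElem?_getD, ha, Option.getD_some]
    rw [this]
    exact hc

theorem length_methodAnns (hC : C.WellFormed) (hM : M.WellFormed) :
    (methodAnns T C M).length = (ghostMethod T C (inlineMethod T C M)).code.length := by
  rw [ghostMethod_code ((inlineCode T C M).map Prod.snd), List.length_map]
  exact (Seg.inlined hC hM).length_eq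

theorem solves_methodAnns (hC : C.WellFormed) (hM : M.WellFormed) :
    Solves C.inv (ghostMethod T C (inlineMethod T C M)) (methodTags T C M)
      (methodAnns T C M) := by
  refine ⟨length_methodAnns hC hM, ?_, fun L hL => ?_, fun L hL hf => ?_⟩
  · rw [ghostMethod_code ((inlineCode T C M).map Prod.snd), methodTags, List.length_map,
      List.length_map]
  · obtain ⟨i, t, hi, ht, h⟩ := checked_label hC hM hL
    rw [ht]
    rcases hf : t.fixed C.inv with _ | b
    · obtain ⟨hin, -, ha⟩ := h.inner hf
      rw [Option.getD_none, wp_of_inner hi hin]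
      exact ha
    · exact (h.fixed b hf).1
  · obtain ⟨i, t, hi, ht, h⟩ := checked_label hC hM hL
    rw [ht] at hf
    obtain ⟨hin, hs, -⟩ := h.inner hf
    rw [length_methodAnns hC hM] at hs
    exact ⟨i, hi, hin, hs⟩

theorem generateMethod_eq (hC : C.WellFormed) (hM : M.WellFormed) :
    generateMethod T C M = methodAnns T C M := (solves_methodAnns hC hM).annotate

theorem locallyValid_methodAnns (hC : C.WellFormed) (hM : M.WellFormed) (I : Interp) :
    LocallyValid I T (ghostMethod T C (inlineMethod T C M)) (methodAnns T C M) C.inv C.inv := by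
  refine ⟨length_methodAnns hC hM, fun σ hσ => ?_, fun L hL σ hσ => ?_⟩
  · have := asgn_ghostLabel (T := T) (C := C) (List.length_pos_iff.2 hM.nonempty)
    rwa [← this, ghostLabel_zero] at hσ
  · obtain ⟨i, t, hi, ht, h⟩ := checked_label hC hM hL
    rcases hf : t.fixed C.inv with _ | b
    · obtain ⟨hin, -, ha⟩ := h.inner hf
      refine Valid.of_inner hin (fun I σ hσ => ?_) I σ hi rfl hσ
      rw [ha] at hσ
      exact hσ
    · exact (h.fixed b hf).2 I σ hi rfl hσ

end

theorem inlineProgram_hierarchy (api : Api) (P : Program) (C : Contract) :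
    (inlineProgram api P C).hierarchy api = P.hierarchy api := by
  simp [Program.hierarchy, Program.sigs, inlineProgram, Function.comp_def]

theorem isAdherenceProof_generateProof {api : Api} {P : Program} {C : Contract}
    (hP : P.WellFormed api) (hC : C.WellFormed) (I : Interp) :
    IsAdherenceProof I api (inlineProgram api P C) C (generateProof api P C) := by
  unfold IsAdherenceProof
  rw [inlineProgram_hierarchy]
  simp only [inlineProgram, generateProof, List.forall₂_map_left_iff, List.forall₂_map_right_iff]
  refine List.forall₂_same.2 fun cd hcd => ?_
  refine List.forall₂_same.2 fun m hm => ⟨inlineMethod_handlersAhead.ghostReady, ?_⟩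
  have hM := hP.methods cd hcd m hm
  rw [generateMethod_eq hC hM]
  exact locallyValid_methodAnns hC hM I

theorem generateProof_eq {api : Api} {P : Program} {C : Contract} (hP : P.WellFormed api)
    (hC : C.WellFormed) : generateProof api P C = P.classes.map fun cd =>
      cd.methods.map fun m => methodAnns (P.hierarchy api) C m.2 :=
  List.map_congr_left fun cd hcd => List.map_congr_left fun m hm =>
    generateMethod_eq hC (hP.methods cd hcd m hm)

end IRM

theorem mainTheorem2 (api : IRM.Api) (hapi : api.WellFormed) :
    ∃ (alg : IRM.Algorithm) (p : Polynomial ℕ),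
      ∀ (P : IRM.Program) (C : IRM.Contract), P.WellFormed api → C.WellFormed →
        (∃ t : ℕ, IRM.Runs alg (IRM.Enc.enc (P, C)) (IRM.Enc.enc (IRM.generateProof api P C)) t ∧
          t ≤ p.eval (IRM.sizeOfEnc P + IRM.sizeOfEnc C)) ∧
        (∀ I : IRM.Interp,
          IRM.IsAdherenceProof I api (IRM.inlineProgram api P C) C (IRM.generateProof api P C)) ∧
        ∀ cd ∈ P.classes, ∀ m ∈ cd.methods,
          IRM.AnnotatedByWp C.inv
            (IRM.ghostMethod (P.hierarchy api) C (IRM.inlineMethod (P.hierarchy api) C m.2))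
            (IRM.methodTags (P.hierarchy api) C m.2)
            (IRM.generateMethod (P.hierarchy api) C m.2) := by
  obtain ⟨alg, p, halg⟩ := IRM.Poly.programAnns api
  refine ⟨alg, p.comp (Polynomial.X + 1), fun P C hP hC => ⟨?_, ?_, ?_⟩⟩
  · obtain ⟨t, ht, hrun⟩ := halg (P, C)
    refine ⟨t, ?_, ?_⟩
    · rw [IRM.generateProof_eq hP hC]
      exact hrun
    · rw [IRM.sizeOfEnc_prod] at ht
      simpa using ht
  · exact IRM.isAdherenceProof_generateProof hP hC
  · intro cd hcd m hm
    have hM := hP.methods cd hcd m hm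
    rw [IRM.generateMethod_eq hC hM]
    exact (IRM.solves_methodAnns hC hM).annotatedByWp
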